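/- Let $\mathcal G$ be an undirected, unweighted (simple) graph with $n\ge 2$ vertices, degrees $d_u$, Laplacian $\mathbf L=\mathbf D-\mathbf A$ and normalized Laplacian $\mathcal L=\mathbf D^{-1/2}\mathbf L\mathbf D^{-1/2}$. For vertices $s,t$ let $r_{\mathcal G}(s,t)=(\mathbf e_s-\mathbf e_t)^{T}\mathbf L^{\dagger}(\mathbf e_s-\mathbf e_t)$ be the effective resistance, where $\mathbf L^\dagger$ is the Moore–Penrose pseudo-inverse, and let $d=\min\{d_s,d_t\}$. The conductance $\phi_{\mathcal G}$ is the minimum of $|E(S,V\setminus S)|/\min\{\sum_{u\in S}d_u,\sum_{u\in V\setminus S}d_u\}$ over non-empty proper vertex subsets $S$ (a ratio $0/0$ counts as $0$), and $\kappa(\mathcal L)$ is the largest eigenvalue of $\mathcal L$ divided by its smallest non-zero eigenvalue. A local algorithm is a program of a randomized real RAM (integer and real registers and arrays; unit-cost addition, truncated subtraction and comparison of integers; unit-cost field operations and comparison of reals; no rounding; unit-cost uniform sampling from $\{0,\dots,y-1\}$ for an integer $y$ in a register) that accesses $\mathcal G$, whose vertices are labelled $0,\dots,n-1$, only through unit-cost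 degree queries, neighbor queries (the $i$-th neighbor of $u$, in an arbitrary fixed order) and jump queries (a uniformly random vertex). For every constant $c\in\mathbb N$ the following hold. 1. (Expanders.) For all constants $\phi_0>0$ and $k\in\mathbb N$ there are a local algorithm and constants $C,a$, depending only on $c,\phi_0,k$, such that for every graph $\mathcal G$ with $n\ge2$ vertices and $\phi_{\mathcal G}\ge \phi_0/(\log n)^k$, every enumeration of its adjacency lists, all vertices $s,t$ and all $\epsilon\in(0,1)$, the algorithm on input $(n,s,t,\epsilon)$ always halts within time $$C\,\bigl(\log\tfrac n\epsilon\bigr)^{a}\cdot\frac{\sqrt d}{\epsilon}$$ and with probability at least $1-n^{-c}$ outputs a number $\hat r$ with $(1-\epsilon)\,r_{\mathcal G}(s,t)\le\hat r\le(1+\epsilon)\,r_{\mathcal G}(s,t)$. 2. (General graphs.) There are a local algorithm and constants $C,a$, depending only on $c$, such that for every connected graph $\mathcal G$ with $n\ge2$ vertices, every enumeration of its adjacency lists, all vertices $s,t$, all $\epsilon\in(0,1)$ and every real $\kappa\ge\kappa(\mathcal L)$ (in particular $\kappa=\kappa(\mathcal L)$), the algorithm on input $(n,s,t,\epsilon,\kappa)$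 always halts within time $$C\,\bigl(\log\tfrac n\epsilon\bigr)^{a}\cdot\frac{\kappa^{3}\sqrt d}{\epsilon}$$ and with probability at least $1-n^{-c}$ outputs a number $\hat r$ with $(1-\epsilon)\,r_{\mathcal G}(s,t)\le\hat r\le(1+\epsilon)\,r_{\mathcal G}(s,t)$. -/

import Mathlib

open scoped Matrix

noncomputable section

namespace EffectiveResistance

/-! ### Linear algebra -/

/-- The Moore-Penrose pseudo-inverse `U diag(μ₁⁻¹, …, μₙ⁻¹) Uᵀ` of a real symmetric matrix with
spectral decomposition `U diag(μ₁, …, μₙ) Uᵀ`; zero eigenvalues stay zero because `0⁻¹ = 0`. -/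
def pinv {V : Type*} [Fintype V] [DecidableEq V] {A : Matrix V V ℝ} (hA : A.IsHermitian) :
    Matrix V V ℝ :=
  (hA.eigenvectorUnitary : Matrix V V ℝ) * Matrix.diagonal (fun i => (hA.eigenvalues i)⁻¹) *
    (hA.eigenvectorUnitary : Matrix V V ℝ)ᵀ

/-- The (finite) condition number of a positive semidefinite matrix: the largest eigenvalue divided
by the smallest non-zero eigenvalue. -/
def condNumber {V : Type*} [Fintype V] [DecidableEq V] (A : Matrix V V ℝ) : ℝ :=
  sSup (spectrum ℝ A) / sInf (spectrum ℝ A \ {0})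

/-! ### Graph notions -/

section Graph

variable {V : Type*} [Fintype V] [DecidableEq V] (G : SimpleGraph V) [DecidableRel G.Adj]

/-- The effective resistance `(e_s - e_t)ᵀ L† (e_s - e_t)`. -/
def effRes (s t : V) : ℝ :=
  (Pi.single s 1 - Pi.single t 1) ⬝ᵥ
    (pinv (G.isHermitian_lapMatrix ℝ) *ᵥ (Pi.single s 1 - Pi.single t 1))

/-- The normalized Laplacian `D^{-1/2} (D - A) D^{-1/2}`. -/
def normLap : Matrix V V ℝ :=
  Matrix.diagonal (fun v => (√(G.degree v : ℝ))⁻¹) * G.lapMatrix ℝ *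
    Matrix.diagonal (fun v => (√(G.degree v : ℝ))⁻¹)

/-- The volume of a vertex set: the sum of the degrees. -/
def vol (S : Finset V) : ℕ := ∑ u ∈ S, G.degree u

/-- The number of edges between `S` and its complement. -/
def cut (S : Finset V) : ℕ := ((S ×ˢ Sᶜ).filter fun p => G.Adj p.1 p.2).card

/-- The conductance: the minimum of `|E(S, V \ S)| / min (vol S) (vol (V \ S))` over the non-empty
proper vertex subsets `S` (it is `0` if some vertex of a graph with at least two vertices is
isolated). -/
def conductance : ℝ :=
  ⨅ S : {S : Finset V // S.Nonempty ∧ S ≠ Finset.univ},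
    (cut G S.1 : ℝ) / (min (vol G S.1) (vol G S.1ᶜ) : ℕ)

end Graph

/-- `x ≈_ε y`. -/
def ApproxEq (ε x y : ℝ) : Prop := (1 - ε) * y ≤ x ∧ x ≤ (1 + ε) * y

/-! ### The machine model

A randomized real RAM with access to a graph in the adjacency model. There are integer registers and
real registers, and integer and real arrays with random access (registers and array names are
literals in the program, so that a program uses finitely many of them). Everything is `0` initially,
apart from the input registers. Each basic instruction, each test and each sequencing step costs one
unit of time. Integers can be added, subtracted (truncated at `0`) and compared, but not multiplied;
real numbers admit the four field operations and comparison, and there is no rounding of reals to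
integers. -/

/-- The memory of the machine. -/
@[ext]
structure Store where
  /-- integer registers -/
  ireg : ℕ → ℕ
  /-- integer arrays, by name and index -/
  iarr : ℕ → ℕ → ℕ
  /-- real registers -/
  rreg : ℕ → ℝ
  /-- real arrays, by name and index -/
  rarr : ℕ → ℕ → ℝ

/-- Basic instructions. In integer instructions `x y z` are integer registers, in real
instructions they are real registers; `a` is the name of an array. -/
inductive Instr where
  /-- `x := k` -/
  | iconst (x k : ℕ)
  /-- `x := y` -/
  | icopy (x y : ℕ)
  /-- `x := y + z` -/
  | iadd (x y z : ℕ)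
  /-- `x := max (y - z) 0` -/
  | isub (x y z : ℕ)
  /-- `x := a[i]`, with `i` an integer register -/
  | iload (x a i : ℕ)
  /-- `a[i] := x`, with `i` an integer register -/
  | istore (a i x : ℕ)
  /-- `x := k` -/
  | rconst (x k : ℕ)
  /-- `x := y`, with `y` an integer register -/
  | rofint (x y : ℕ)
  /-- `x := y` -/
  | rcopy (x y : ℕ)
  /-- `x := y + z` -/
  | radd (x y z : ℕ)
  /-- `x := y - z` -/
  | rsub (x y z : ℕ)
  /-- `x := y * z` -/
  | rmul (x y z : ℕ)
  /-- `x := y / z` -/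
  | rdiv (x y z : ℕ)
  /-- `x := a[i]`, with `i` an integer register -/
  | rload (x a i : ℕ)
  /-- `a[i] := x`, with `i` an integer register -/
  | rstore (a i x : ℕ)
  /-- random number: `x` is uniform in `{0, …, y - 1}` -/
  | rand (x y : ℕ)
  /-- degree query: `x := deg y` -/
  | deg (x y : ℕ)
  /-- neighbor query: `x :=` the `z`-th neighbor of `y`, counted from `0` -/
  | neigh (x y z : ℕ)
  /-- jump query: `x` is a uniformly random vertex -/
  | jump (x : ℕ)

/-- Tests on two integer registers or on two real registers. -/
inductive Test where
  | ieq (x y : ℕ)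
  | ilt (x y : ℕ)
  | ile (x y : ℕ)
  | rlt (x y : ℕ)
  | rle (x y : ℕ)

/-- Programs. -/
inductive Program where
  | skip
  | instr (i : Instr)
  | seq (p q : Program)
  | ite (b : Test) (p q : Program)
  | while (b : Test) (p : Program)

/-- The truth of a test. -/
def Test.Holds (σ : Store) : Test → Prop
  | .ieq x y => σ.ireg x = σ.ireg y
  | .ilt x y => σ.ireg x < σ.ireg y
  | .ile x y => σ.ireg x ≤ σ.ireg y
  | .rlt x y => σ.rreg x < σ.rreg y
  | .rle x y => σ.rreg x ≤ σ.rreg y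

/-- Assignment to an integer register. -/
def Store.setI (σ : Store) (x v : ℕ) : Store := { σ with ireg := Function.update σ.ireg x v }

/-- Assignment to a real register. -/
def Store.setR (σ : Store) (x : ℕ) (v : ℝ) : Store :=
  { σ with rreg := Function.update σ.rreg x v }

/-- Assignment to an entry of an integer array. -/
def Store.setIArr (σ : Store) (a i v : ℕ) : Store :=
  { σ with iarr := Function.update σ.iarr a (Function.update (σ.iarr a) i v) }

/-- Assignment to an entry of a real array. -/
def Store.setRArr (σ : Store) (a i : ℕ) (v : ℝ) : Store :=
  { σ with rarr := Function.update σ.rarr a (Function.update (σ.rarr a) i v) }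

/-- The uniform distribution on `{0, …, k - 1}` (the point mass at `0` if `k = 0`). -/
def unif : ℕ → PMF ℕ
  | 0 => PMF.pure 0
  | k + 1 => (PMF.uniformOfFintype (Fin (k + 1))).map Fin.val

/-- Adjacency lists: an (arbitrary) enumeration of the neighbors of each vertex. -/
abbrev AdjLists {n : ℕ} (G : SimpleGraph (Fin n)) [DecidableRel G.Adj] : Type :=
  (u : Fin n) → Fin (G.degree u) ≃ G.neighborSet u

section Semantics

variable {n : ℕ} (G : SimpleGraph (Fin n)) [DecidableRel G.Adj] (N : AdjLists G)

/-- The answer to a degree query (`0` if `u` is not a vertex). -/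
def degQuery (u : ℕ) : ℕ := if h : u < n then G.degree ⟨u, h⟩ else 0

/-- The answer to a neighbor query (`0` if the query is invalid). -/
def neighQuery (u i : ℕ) : ℕ :=
  if h : u < n then
    if h' : i < G.degree ⟨u, h⟩ then ((N ⟨u, h⟩ ⟨i, h'⟩ : Fin n) : ℕ) else 0
  else 0

/-- The effect of a basic instruction. -/
def Instr.exec (σ : Store) : Instr → PMF Store
  | .iconst x k => PMF.pure (σ.setI x k)
  | .icopy x y => PMF.pure (σ.setI x (σ.ireg y))
  | .iadd x y z => PMF.pure (σ.setI x (σ.ireg y + σ.ireg z))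
  | .isub x y z => PMF.pure (σ.setI x (σ.ireg y - σ.ireg z))
  | .iload x a i => PMF.pure (σ.setI x (σ.iarr a (σ.ireg i)))
  | .istore a i x => PMF.pure (σ.setIArr a (σ.ireg i) (σ.ireg x))
  | .rconst x k => PMF.pure (σ.setR x k)
  | .rofint x y => PMF.pure (σ.setR x (σ.ireg y))
  | .rcopy x y => PMF.pure (σ.setR x (σ.rreg y))
  | .radd x y z => PMF.pure (σ.setR x (σ.rreg y + σ.rreg z))
  | .rsub x y z => PMF.pure (σ.setR x (σ.rreg y - σ.rreg z))
  | .rmul x y z => PMF.pure (σ.setR x (σ.rreg y * σ.rreg z))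
  | .rdiv x y z => PMF.pure (σ.setR x (σ.rreg y / σ.rreg z))
  | .rload x a i => PMF.pure (σ.setR x (σ.rarr a (σ.ireg i)))
  | .rstore a i x => PMF.pure (σ.setRArr a (σ.ireg i) (σ.rreg x))
  | .rand x y => (unif (σ.ireg y)).map (σ.setI x)
  | .deg x y => PMF.pure (σ.setI x (degQuery G (σ.ireg y)))
  | .neigh x y z => PMF.pure (σ.setI x (neighQuery G N (σ.ireg y) (σ.ireg z)))
  | .jump x => (unif n).map (σ.setI x)

/-- A configuration: the stack of program parts that remain to be executed, and the memory. The
machine has halted when the stack is empty. -/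
@[ext]
structure Config where
  todo : List Program
  store : Store

open Classical in
/-- One step of the machine (one unit of time). -/
def step : Config → PMF Config
  | ⟨[], σ⟩ => PMF.pure ⟨[], σ⟩
  | ⟨.skip :: K, σ⟩ => PMF.pure ⟨K, σ⟩
  | ⟨.instr i :: K, σ⟩ => (i.exec G N σ).map fun σ' => ⟨K, σ'⟩
  | ⟨.seq p q :: K, σ⟩ => PMF.pure ⟨p :: q :: K, σ⟩
  | ⟨.ite b p q :: K, σ⟩ => PMF.pure ⟨(if b.Holds σ then p else q) :: K, σ⟩
  | ⟨.while b p :: K, σ⟩ =>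
      PMF.pure (if b.Holds σ then ⟨p :: .while b p :: K, σ⟩ else ⟨K, σ⟩)

/-- The distribution of the configuration after `T` steps. -/
def run : ℕ → Config → PMF Config
  | 0, γ => PMF.pure γ
  | T + 1, γ => (step G N γ).bind (run T)

/-- The initial memory on input `(n, s, t, ε, κ)`. -/
def input (s t : Fin n) (ε κ : ℝ) : Store where
  ireg x := if x = 0 then n else if x = 1 then s else if x = 2 then t else 0
  iarr _ _ := 0
  rreg x := if x = 0 then ε else if x = 1 then κ else 0
  rarr _ _ := 0

/-- Started with memory `σ`, the program `P` halts within time `T` in every run, and with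
probability at least `p` it then has in real register `0` an `ε`-approximation of the effective
resistance between `s` and `t`. -/
def ApproximatesEffRes (P : Program) (σ : Store) (s t : Fin n) (ε T p : ℝ) : Prop :=
  (∀ γ ∈ (run G N ⌊T⌋₊ ⟨[P], σ⟩).support, γ.todo = []) ∧
    ENNReal.ofReal p ≤ (run G N ⌊T⌋₊ ⟨[P], σ⟩).toOuterMeasure
      {γ | ApproxEq ε (γ.store.rreg 0) (effRes G s t)}

end Semantics

end EffectiveResistance

end

noncomputable section

namespace EffectiveResistance

open scoped ENNReal

/-! ### Expected values and quantitative Hoare triples -/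

theorem tsum_bind_mul {α β : Type*} (p : PMF α) (f : α → PMF β) (g : β → ℝ≥0∞) :
    ∑' b, p.bind f b * g b = ∑' a, p a * ∑' b, f a b * g b := by
  simp only [PMF.bind_apply, ← ENNReal.tsum_mul_left, ← ENNReal.tsum_mul_right]
  rw [ENNReal.tsum_comm]
  simp only [mul_assoc]

theorem tsum_pure_mul {α : Type*} (a : α) (g : α → ℝ≥0∞) :
    ∑' b, PMF.pure a b * g b = g a := by
  rw [tsum_eq_single a]
  · simp
  · intro b hb
    simp [PMF.pure_apply, hb]

theorem tsum_map_mul {α β : Type*} (p : PMF α) (f : α → β) (g : β → ℝ≥0∞) :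
    ∑' b, p.map f b * g b = ∑' a, p a * g (f a) := by
  rw [← PMF.bind_pure_comp, tsum_bind_mul]
  simp

theorem tsum_unif_mul (k : ℕ) (hk : 0 < k) (g : ℕ → ℝ≥0∞) :
    ∑' b, unif k b * g b = (∑ i ∈ Finset.range k, g i) / k := by
  obtain ⟨k, rfl⟩ := Nat.exists_eq_succ_of_ne_zero hk.ne'
  simp only [unif, Nat.succ_eq_add_one]
  rw [tsum_map_mul, tsum_fintype, Finset.sum_range]
  simp only [PMF.uniformOfFintype_apply, Fintype.card_fin]
  rw [← Finset.mul_sum, mul_comm, ENNReal.div_eq_inv_mul, mul_comm]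

/-- The value of a configuration: `Φ` of the memory if the machine has halted, otherwise `∞`. -/
def terminal (Φ : Store → ℝ≥0∞) : Config → ℝ≥0∞
  | ⟨[], σ⟩ => Φ σ
  | ⟨_ :: _, _⟩ => ⊤

section Triples

variable {n : ℕ} (G : SimpleGraph (Fin n)) [DecidableRel G.Adj] (N : AdjLists G)

/-- The expected value of the configuration after `T` steps. -/
def expect (Φ : Store → ℝ≥0∞) (T : ℕ) (γ : Config) : ℝ≥0∞ :=
  ∑' γ', run G N T γ γ' * terminal Φ γ'

variable {G N}

theorem expect_zero (Φ : Store → ℝ≥0∞) (γ : Config) : expect G N Φ 0 γ = terminal Φ γ := by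
  simp [expect, run]

theorem expect_succ (Φ : Store → ℝ≥0∞) (T : ℕ) (γ : Config) :
    expect G N Φ (T + 1) γ = ∑' γ', step G N γ γ' * expect G N Φ T γ' := by
  simp only [expect, run, tsum_bind_mul]

theorem expect_succ_of_step_eq_pure {γ γ' : Config} (h : step G N γ = PMF.pure γ')
    (Φ : Store → ℝ≥0∞) (T : ℕ) : expect G N Φ (T + 1) γ = expect G N Φ T γ' := by
  rw [expect_succ, h, tsum_pure_mul]

theorem expect_succ_le (Φ : Store → ℝ≥0∞) (T : ℕ) (γ : Config) :
    expect G N Φ (T + 1) γ ≤ expect G N Φ T γ := by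
  induction T generalizing γ with
  | zero =>
    obtain ⟨_ | ⟨p, K⟩, σ⟩ := γ
    · rw [expect_succ_of_step_eq_pure (γ' := ⟨[], σ⟩) (by simp [step])]
    · simp [expect_zero, terminal]
  | succ T ih =>
    rw [expect_succ, expect_succ Φ T]
    exact ENNReal.tsum_le_tsum fun γ' => mul_le_mul_right (ih γ') _

theorem expect_anti (Φ : Store → ℝ≥0∞) (γ : Config) : Antitone fun T => expect G N Φ T γ :=
  antitone_nat_of_succ_le fun T => expect_succ_le Φ T γ

variable (G N)

/-- Started with memory `σ`, the program `P` takes time at most `t`, all possible outcomes satisfy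
`Q`, and the expectation of `φ` over the outcomes is at most `x`. -/
def Triple (P : Program) (t : ℕ) (σ : Store) (Q : Store → Prop) (φ : Store → ℝ) (x : ℝ) : Prop :=
  ∀ (K : List Program) (T : ℕ) (Φ : Store → ℝ≥0∞),
    (∀ σ', Q σ' → expect G N Φ T ⟨K, σ'⟩ ≤ ENNReal.ofReal (φ σ')) →
      expect G N Φ (T + t) ⟨P :: K, σ⟩ ≤ ENNReal.ofReal x

/-- Started with memory `σ`, the program `P` takes time at most `t`, and all possible outcomes
satisfy `Q`. -/
def Sure (P : Program) (t : ℕ) (σ : Store) (Q : Store → Prop) : Prop :=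
  ∀ (K : List Program) (T : ℕ) (Φ : Store → ℝ≥0∞) (x : ℝ≥0∞),
    (∀ σ', Q σ' → expect G N Φ T ⟨K, σ'⟩ ≤ x) → expect G N Φ (T + t) ⟨P :: K, σ⟩ ≤ x

variable {G N}

theorem Sure.triple {P : Program} {t : ℕ} {σ : Store} {Q : Store → Prop} {φ : Store → ℝ} {x : ℝ}
    (h : Sure G N P t σ Q) (hφ : ∀ σ', Q σ' → φ σ' ≤ x) : Triple G N P t σ Q φ x :=
  fun K T Φ hΦ => h K T Φ _ fun σ' hσ' => (hΦ σ' hσ').trans (ENNReal.ofReal_le_ofReal (hφ σ' hσ'))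

theorem Sure.mono {P : Program} {t t' : ℕ} {σ : Store} {Q Q' : Store → Prop}
    (h : Sure G N P t σ Q) (ht : t ≤ t') (hQ : ∀ σ', Q σ' → Q' σ') : Sure G N P t' σ Q' :=
  fun K T Φ x hΦ => (expect_anti Φ _ (Nat.add_le_add_left ht T)).trans
    (h K T Φ x fun σ' hσ' => hΦ σ' (hQ σ' hσ'))

theorem Triple.mono {P : Program} {t t' : ℕ} {σ : Store} {Q Q' : Store → Prop}
    {φ φ' : Store → ℝ} {x x' : ℝ} (h : Triple G N P t σ Q φ x) (ht : t ≤ t')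
    (hQ : ∀ σ', Q σ' → Q' σ' ∧ φ' σ' ≤ φ σ') (hx : x ≤ x') : Triple G N P t' σ Q' φ' x' :=
  fun K T Φ hΦ => (expect_anti Φ _ (Nat.add_le_add_left ht T)).trans
    ((h K T Φ fun σ' hσ' => (hΦ σ' (hQ σ' hσ').1).trans
      (ENNReal.ofReal_le_ofReal (hQ σ' hσ').2)).trans (ENNReal.ofReal_le_ofReal hx))

theorem sure_skip {σ : Store} {Q : Store → Prop} (h : Q σ) : Sure G N .skip 1 σ Q := by
  intro K T Φ x hΦ
  rw [expect_succ_of_step_eq_pure (γ' := ⟨K, σ⟩) (by simp [step])]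
  exact hΦ σ h

theorem Sure.seq {p q : Program} {t₁ t₂ : ℕ} {σ : Store} {R Q : Store → Prop}
    (hp : Sure G N p t₁ σ R) (hq : ∀ σ', R σ' → Sure G N q t₂ σ' Q) :
    Sure G N (.seq p q) (t₁ + t₂ + 1) σ Q := by
  intro K T Φ x hΦ
  rw [← add_assoc, expect_succ_of_step_eq_pure (γ' := ⟨p :: q :: K, σ⟩) (by simp [step]),
    show T + (t₁ + t₂) = T + t₂ + t₁ by omega]
  exact hp _ _ Φ x fun σ' hσ' => hq σ' hσ' K T Φ x hΦ

theorem Sure.seq_triple {p q : Program} {t₁ t₂ : ℕ} {σ : Store} {R Q : Store → Prop}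
    {φ : Store → ℝ} {x : ℝ}
    (hp : Sure G N p t₁ σ R) (hq : ∀ σ', R σ' → Triple G N q t₂ σ' Q φ x) :
    Triple G N (.seq p q) (t₁ + t₂ + 1) σ Q φ x := by
  intro K T Φ hΦ
  rw [← add_assoc, expect_succ_of_step_eq_pure (γ' := ⟨p :: q :: K, σ⟩) (by simp [step]),
    show T + (t₁ + t₂) = T + t₂ + t₁ by omega]
  exact hp _ _ Φ _ fun σ' hσ' => hq σ' hσ' K T Φ hΦ

theorem Triple.seq {p q : Program} {t₁ t₂ : ℕ} {σ : Store} {R Q : Store → Prop}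
    {ψ φ : Store → ℝ} {x : ℝ} (hp : Triple G N p t₁ σ R ψ x)
    (hq : ∀ σ', R σ' → Triple G N q t₂ σ' Q φ (ψ σ')) :
    Triple G N (.seq p q) (t₁ + t₂ + 1) σ Q φ x := by
  intro K T Φ hΦ
  rw [← add_assoc, expect_succ_of_step_eq_pure (γ' := ⟨p :: q :: K, σ⟩) (by simp [step]),
    show T + (t₁ + t₂) = T + t₂ + t₁ by omega]
  exact hp _ _ Φ fun σ' hσ' => hq σ' hσ' K T Φ hΦ

theorem sure_ite {b : Test} {p q : Program} {t : ℕ} {σ : Store} {Q : Store → Prop}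
    (hp : b.Holds σ → Sure G N p t σ Q) (hq : ¬b.Holds σ → Sure G N q t σ Q) :
    Sure G N (.ite b p q) (t + 1) σ Q := by
  intro K T Φ x hΦ
  by_cases h : b.Holds σ
  · rw [← add_assoc, expect_succ_of_step_eq_pure (γ' := ⟨p :: K, σ⟩) (by simp [step, h])]
    exact hp h K T Φ x hΦ
  · rw [← add_assoc, expect_succ_of_step_eq_pure (γ' := ⟨q :: K, σ⟩) (by simp [step, h])]
    exact hq h K T Φ x hΦ

theorem triple_ite {b : Test} {p q : Program} {t : ℕ} {σ : Store} {Q : Store → Prop}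
    {φ : Store → ℝ} {x : ℝ}
    (hp : b.Holds σ → Triple G N p t σ Q φ x) (hq : ¬b.Holds σ → Triple G N q t σ Q φ x) :
    Triple G N (.ite b p q) (t + 1) σ Q φ x := by
  intro K T Φ hΦ
  by_cases h : b.Holds σ
  · rw [← add_assoc, expect_succ_of_step_eq_pure (γ' := ⟨p :: K, σ⟩) (by simp [step, h])]
    exact hp h K T Φ hΦ
  · rw [← add_assoc, expect_succ_of_step_eq_pure (γ' := ⟨q :: K, σ⟩) (by simp [step, h])]
    exact hq h K T Φ hΦ

/-- The rule for loops; `I T σ` is the invariant, with `T` a bound on the remaining time. -/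
theorem sure_while {b : Test} {p : Program} {Q : Store → Prop} (I : ℕ → Store → Prop)
    (hbody : ∀ T σ, I T σ → b.Holds σ → ∃ t T', T' + t + 1 ≤ T ∧ Sure G N p t σ (I T'))
    (hexit : ∀ T σ, I T σ → ¬b.Holds σ → 1 ≤ T ∧ Q σ) {T : ℕ} {σ : Store} (hI : I T σ) :
    Sure G N (.while b p) T σ Q := by
  induction T using Nat.strong_induction_on generalizing σ with
  | _ T ih =>
    by_cases h : b.Holds σ
    · obtain ⟨t, T', hT, hp⟩ := hbody T σ hI h
      refine Sure.mono (t := T' + t + 1) ?_ hT fun _ h => h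
      intro K S Φ x hΦ
      rw [← add_assoc, expect_succ_of_step_eq_pure (γ' := ⟨p :: .while b p :: K, σ⟩)
        (by simp [step, h]), ← add_assoc]
      exact hp _ _ Φ x fun σ' hσ' => ih T' (by omega) hσ' K S Φ x hΦ
    · obtain ⟨hT, hQ⟩ := hexit T σ hI h
      refine Sure.mono (t := 1) ?_ hT fun _ h => h
      intro K S Φ x hΦ
      rw [expect_succ_of_step_eq_pure (γ' := ⟨K, σ⟩) (by simp [step, h])]
      exact hΦ σ hQ

/-- A loop whose body is executed `k` times, each time within time `t`. -/
theorem sure_while_count {b : Test} {p : Program} (I : ℕ → Store → Prop) {t : ℕ}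
    (hbody : ∀ k σ, I (k + 1) σ → b.Holds σ ∧ Sure G N p t σ (I k))
    (hexit : ∀ σ, I 0 σ → ¬b.Holds σ) {k : ℕ} {σ : Store} (hI : I k σ) :
    Sure G N (.while b p) (k * (t + 1) + 1) σ (I 0) := by
  refine sure_while (fun T σ => ∃ k, T = k * (t + 1) + 1 ∧ I k σ) ?_ ?_ ⟨k, rfl, hI⟩
  · rintro T σ ⟨_ | k, rfl, hk⟩ hb
    · exact absurd hb (hexit σ hk)
    · refine ⟨t, k * (t + 1) + 1, by ring_nf; omega, ?_⟩
      exact (hbody k σ hk).2.mono le_rfl fun σ' h => ⟨k, rfl, h⟩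
  · rintro T σ ⟨_ | k, rfl, hk⟩ hb
    · exact ⟨by omega, hk⟩
    · exact absurd (hbody k σ hk).1 hb

theorem triple_while_count {b : Test} {p : Program} (I : ℕ → Store → Prop) (ψ : ℕ → Store → ℝ)
    {t : ℕ}
    (hbody : ∀ k σ, I (k + 1) σ → b.Holds σ ∧ Triple G N p t σ (I k) (ψ k) (ψ (k + 1) σ))
    (hexit : ∀ σ, I 0 σ → ¬b.Holds σ) {k : ℕ} {σ : Store} (hI : I k σ) :
    Triple G N (.while b p) (k * (t + 1) + 1) σ (I 0) (ψ 0) (ψ k σ) := by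
  induction k generalizing σ with
  | zero =>
    intro K T Φ hΦ
    rw [show T + (0 * (t + 1) + 1) = T + 1 by ring,
      expect_succ_of_step_eq_pure (γ' := ⟨K, σ⟩) (by simp [step, hexit σ hI])]
    exact hΦ σ hI
  | succ k ih =>
    intro K T Φ hΦ
    obtain ⟨hb, hp⟩ := hbody k σ hI
    rw [show T + ((k + 1) * (t + 1) + 1) = T + (k * (t + 1) + 1) + t + 1 by ring,
      expect_succ_of_step_eq_pure (γ' := ⟨p :: .while b p :: K, σ⟩) (by simp [step, hb])]
    exact hp _ _ Φ fun σ' hσ' => ih hσ' K T Φ hΦ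

theorem triple_rand {x y : ℕ} {σ : Store} {Q : Store → Prop} {φ : Store → ℝ}
    (hy : 0 < σ.ireg y) (hQ : ∀ k < σ.ireg y, Q (σ.setI x k))
    (hφ : ∀ k < σ.ireg y, 0 ≤ φ (σ.setI x k)) :
    Triple G N (.instr (.rand x y)) 1 σ Q φ
      ((∑ k ∈ Finset.range (σ.ireg y), φ (σ.setI x k)) / σ.ireg y) := by
  intro K T Φ hΦ
  rw [expect_succ]
  simp only [step, Instr.exec]
  rw [tsum_map_mul, tsum_map_mul, tsum_unif_mul _ hy, ENNReal.ofReal_div_of_pos (by positivity),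
    ENNReal.ofReal_natCast]
  refine ENNReal.div_le_div_right ?_ _
  rw [ENNReal.ofReal_sum_of_nonneg fun k hk => hφ k (Finset.mem_range.1 hk)]
  exact Finset.sum_le_sum fun k hk => hΦ _ (hQ k (Finset.mem_range.1 hk))

variable (G N)

/-- The effect of a deterministic instruction. -/
def effect (σ : Store) : Instr → Store
  | .iconst x k => σ.setI x k
  | .icopy x y => σ.setI x (σ.ireg y)
  | .iadd x y z => σ.setI x (σ.ireg y + σ.ireg z)
  | .isub x y z => σ.setI x (σ.ireg y - σ.ireg z)
  | .iload x a i => σ.setI x (σ.iarr a (σ.ireg i))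
  | .istore a i x => σ.setIArr a (σ.ireg i) (σ.ireg x)
  | .rconst x k => σ.setR x k
  | .rofint x y => σ.setR x (σ.ireg y)
  | .rcopy x y => σ.setR x (σ.rreg y)
  | .radd x y z => σ.setR x (σ.rreg y + σ.rreg z)
  | .rsub x y z => σ.setR x (σ.rreg y - σ.rreg z)
  | .rmul x y z => σ.setR x (σ.rreg y * σ.rreg z)
  | .rdiv x y z => σ.setR x (σ.rreg y / σ.rreg z)
  | .rload x a i => σ.setR x (σ.rarr a (σ.ireg i))
  | .rstore a i x => σ.setRArr a (σ.ireg i) (σ.rreg x)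
  | .deg x y => σ.setI x (degQuery G (σ.ireg y))
  | .neigh x y z => σ.setI x (neighQuery G N (σ.ireg y) (σ.ireg z))
  | .rand _ _ => σ
  | .jump _ => σ

/-- Whether an instruction is deterministic. -/
def isDet : Instr → Bool
  | .rand _ _ => false
  | .jump _ => false
  | _ => true

/-- A straight-line program. -/
def block : List Instr → Program
  | [] => .skip
  | i :: l => .seq (.instr i) (block l)

variable {G N}

theorem exec_eq_pure {i : Instr} (hi : isDet i = true) (σ : Store) :
    i.exec G N σ = PMF.pure (effect G N σ i) := by
  cases i <;> simp_all [isDet, Instr.exec, effect]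

theorem sure_instr {i : Instr} (hi : isDet i = true) {σ : Store} {Q : Store → Prop}
    (h : Q (effect G N σ i)) : Sure G N (.instr i) 1 σ Q := by
  intro K T Φ x hΦ
  rw [expect_succ_of_step_eq_pure (γ' := ⟨K, effect G N σ i⟩)
    (by simp [step, exec_eq_pure hi, PMF.pure_map])]
  exact hΦ _ h

theorem sure_block {l : List Instr} (hl : l.all isDet = true) {σ : Store} {Q : Store → Prop}
    (h : Q (l.foldl (effect G N) σ)) : Sure G N (block l) (2 * l.length + 1) σ Q := by
  induction l generalizing σ with
  | nil => exact sure_skip h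
  | cons i l ih =>
    simp only [List.all_cons, Bool.and_eq_true] at hl
    refine Sure.mono (t := 1 + (2 * l.length + 1) + 1) ?_ (by simp; omega) fun _ h => h
    exact (sure_instr (Q := fun σ' => σ' = effect G N σ i) hl.1 rfl).seq fun σ' hσ' =>
      ih hl.2 (by subst hσ'; exact h)

variable (G N)

/-- A program that satisfies a triple for the indicator function of failure succeeds with high
probability. -/
theorem approximatesEffRes_of_triple {P : Program} {σ : Store} {s t : Fin n} {ε T x p : ℝ} {τ : ℕ}
    {Q : Store → Prop} {φ : Store → ℝ} (hτ : (τ : ℝ) ≤ T) (h : Triple G N P τ σ Q φ x)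
    (hφ : ∀ σ', Q σ' → ¬ApproxEq ε (σ'.rreg 0) (effRes G s t) → 1 ≤ φ σ')
    (hx : x ≤ 1 - p) (hx0 : 0 ≤ x) (hp : 0 ≤ p) :
    ApproximatesEffRes G N P σ s t ε T p := by
  classical
  let Φ : Store → ℝ≥0∞ := fun σ' => 
    if Q σ' then (if ApproxEq ε (σ'.rreg 0) (effRes G s t) then 0 else 1) else ⊤
  have key : expect G N Φ ⌊T⌋₊ ⟨[P], σ⟩ ≤ ENNReal.ofReal x := by
    refine (expect_anti Φ _ (Nat.le_floor hτ)).trans ?_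
    have := h [] 0 Φ
    rw [zero_add] at this
    refine this fun σ' hσ' => ?_
    rw [expect_zero]
    simp only [terminal, Φ, hσ', if_true]
    split_ifs with hA
    · simp
    · simpa using hφ σ' hσ' hA
  set μ := run G N ⌊T⌋₊ ⟨[P], σ⟩ with hμ
  have hlt : expect G N Φ ⌊T⌋₊ ⟨[P], σ⟩ < ⊤ := key.trans_lt ENNReal.ofReal_lt_top
  have hfin : ∀ γ ∈ μ.support, terminal Φ γ ≠ ⊤ := by
    intro γ hγ htop
    have : μ γ * terminal Φ γ < ⊤ := (ENNReal.le_tsum γ).trans_lt hlt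
    rw [htop, ENNReal.mul_top ((PMF.mem_support_iff _ _).1 hγ)] at this
    exact lt_irrefl _ this
  refine ⟨fun γ hγ => ?_, ?_⟩
  · obtain ⟨_ | ⟨q, K⟩, σ'⟩ := γ
    · rfl
    · exact absurd rfl (hfin _ hγ)
  · rw [← hμ]
    set A := {γ : Config | ApproxEq ε (γ.store.rreg 0) (effRes G s t)}
    have hcompl : μ.toOuterMeasure Aᶜ ≤ ENNReal.ofReal x := by
      refine le_trans ?_ key
      rw [PMF.toOuterMeasure_apply, expect]
      refine ENNReal.tsum_le_tsum fun γ => ?_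
      by_cases hγ : γ ∈ μ.support
      · by_cases hA : γ ∈ A
        · simp [hA]
        · rw [Set.indicator_of_mem (by exact hA)]
          obtain ⟨_ | ⟨q, K⟩, σ'⟩ := γ
          · have h1 : 1 ≤ terminal Φ ⟨[], σ'⟩ := by
              simp only [terminal, Φ]
              have : ¬ApproxEq ε (σ'.rreg 0) (effRes G s t) := hA
              split_ifs <;> simp
            calc _ = μ ⟨[], σ'⟩ * 1 := (mul_one _).symm
              _ ≤ _ := mul_le_mul_right h1 _
          · exact absurd rfl (hfin _ hγ)
      · have : μ γ = 0 := by simpa [PMF.mem_support_iff] using hγ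
        simp [Set.indicator_apply, this]
    have hsum : (1 : ℝ≥0∞) ≤ μ.toOuterMeasure A + μ.toOuterMeasure Aᶜ := by
      rw [← (PMF.toOuterMeasure_apply_eq_one_iff μ (s := Set.univ)).2 (Set.subset_univ _),
        ← Set.union_compl_self A]
      exact MeasureTheory.measure_union_le _ _
    have hp1 : ENNReal.ofReal p + ENNReal.ofReal x ≤ 1 := by
      rw [← ENNReal.ofReal_add hp hx0, ← ENNReal.ofReal_one]
      exact ENNReal.ofReal_le_ofReal (by linarith)
    have h2 : ENNReal.ofReal p + ENNReal.ofReal x ≤ μ.toOuterMeasure A + ENNReal.ofReal x :=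
      hp1.trans (hsum.trans (by gcongr))
    exact (ENNReal.add_le_add_iff_right ENNReal.ofReal_ne_top).1 h2

end Triples

/-! ### Spectral expansions -/

section Spectral

variable {V : Type*} [Fintype V] [DecidableEq V] {A : Matrix V V ℝ}

/-- The eigenvectors of a symmetric matrix. -/
def eigvec (hA : A.IsHermitian) (i v : V) : ℝ := hA.eigenvectorBasis i v

theorem mulVec_eigvec (hA : A.IsHermitian) (i : V) :
    A *ᵥ eigvec hA i = hA.eigenvalues i • eigvec hA i :=
  hA.mulVec_eigenvectorBasis i

theorem sum_eigvec_dotProduct_mul (hA : A.IsHermitian) (w z : V → ℝ) :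
    ∑ i, (eigvec hA i ⬝ᵥ w) * (eigvec hA i ⬝ᵥ z) = w ⬝ᵥ z := by
  have h := hA.eigenvectorBasis.sum_inner_mul_inner (WithLp.toLp 2 w) (WithLp.toLp 2 z)
  simp only [PiLp.inner_apply, RCLike.inner_apply, conj_trivial] at h
  have e1 : ∀ i, ∑ x, (hA.eigenvectorBasis i) x * w x = eigvec hA i ⬝ᵥ w := fun i => rfl
  have e2 : ∀ i, ∑ x, z x * (hA.eigenvectorBasis i) x = eigvec hA i ⬝ᵥ z := fun i => by
    rw [dotProduct_comm]; rfl
  simp only [e1, e2] at h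
  rw [h, dotProduct_comm]
  rfl

theorem sum_eigvec_dotProduct_smul (hA : A.IsHermitian) (w : V → ℝ) :
    ∑ i, (eigvec hA i ⬝ᵥ w) • eigvec hA i = w := by
  ext v
  have h := sum_eigvec_dotProduct_mul hA w (Pi.single v 1)
  simp only [dotProduct_single, mul_one] at h
  simpa [Finset.sum_apply] using h

theorem eigvec_ne_zero (hA : A.IsHermitian) (i : V) : eigvec hA i ≠ 0 := by
  intro h
  have := hA.eigenvectorBasis.toBasis.ne_zero i
  apply this
  ext v
  simpa [eigvec] using congrFun h v

theorem pinv_mulVec (hA : A.IsHermitian) (x : V → ℝ) :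
    pinv hA *ᵥ x = ∑ i, ((hA.eigenvalues i)⁻¹ * (eigvec hA i ⬝ᵥ x)) • eigvec hA i := by
  ext v
  have hU : ∀ v i, (hA.eigenvectorUnitary : Matrix V V ℝ) v i = eigvec hA i v := fun v i => rfl
  simp only [pinv, ← Matrix.mulVec_mulVec, Finset.sum_apply, Pi.smul_apply, smul_eq_mul]
  simp only [Matrix.mulVec, dotProduct, Matrix.transpose_apply, hU, Matrix.diagonal_apply,
    ite_mul, zero_mul, Finset.sum_ite_eq, Finset.mem_univ, if_true]
  exact Finset.sum_congr rfl fun i _ => by ring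

theorem mulVec_pinv_mulVec (hA : A.IsHermitian) {x : V → ℝ}
    (hx : ∀ z, A *ᵥ z = 0 → z ⬝ᵥ x = 0) : A *ᵥ (pinv hA *ᵥ x) = x := by
  rw [pinv_mulVec, Matrix.mulVec_sum]
  conv_rhs => rw [← sum_eigvec_dotProduct_smul hA x]
  refine Finset.sum_congr rfl fun i _ => ?_
  rw [Matrix.mulVec_smul, mulVec_eigvec, smul_smul]
  by_cases h : hA.eigenvalues i = 0
  · rw [hx (eigvec hA i) (by rw [mulVec_eigvec, h, zero_smul])]
    simp
  · congr 1
    field_simp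

end Spectral

/-! ### The lazy random walk -/

section Walk

variable {V : Type*} [Fintype V] (G : SimpleGraph V) [DecidableRel G.Adj]

/-- The transition operator of the lazy random walk, acting on functions. -/
def lazyWalk : (V → ℝ) →ₗ[ℝ] (V → ℝ) where
  toFun f v := f v / 2 + (∑ w ∈ G.neighborFinset v, f w) / (2 * G.degree v)
  map_add' f g := by
    ext v
    simp only [Pi.add_apply, Finset.sum_add_distrib]
    ring
  map_smul' a f := by
    ext v
    simp only [Pi.smul_apply, smul_eq_mul, RingHom.id_apply, ← Finset.mul_sum]
    ring

variable {G}

theorem lazyWalk_apply (f : V → ℝ) (v : V) :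
    lazyWalk G f v = f v / 2 + (∑ w ∈ G.neighborFinset v, f w) / (2 * G.degree v) := rfl

theorem sum_sum_neighborFinset_comm (F : V → V → ℝ) :
    ∑ v, ∑ w ∈ G.neighborFinset v, F v w = ∑ v, ∑ w ∈ G.neighborFinset v, F w v := by
  simp only [SimpleGraph.neighborFinset_eq_filter, Finset.sum_filter]
  rw [Finset.sum_comm]
  simp only [G.adj_comm]

theorem lazyWalk_mono {f g : V → ℝ} (h : f ≤ g) : lazyWalk G f ≤ lazyWalk G g := fun v => by
  rw [lazyWalk_apply, lazyWalk_apply]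
  have := h v
  have := Finset.sum_le_sum fun w (_ : w ∈ G.neighborFinset v) => h w
  gcongr

theorem lazyWalk_const (hd : ∀ v, 0 < G.degree v) (a : ℝ) :
    lazyWalk G (fun _ => a) = fun _ => a := by
  ext v
  have : (G.degree v : ℝ) ≠ 0 := by exact_mod_cast (hd v).ne'
  rw [lazyWalk_apply]
  simp
  field_simp
  ring

theorem lazyWalk_pow_mono {f g : V → ℝ} (h : f ≤ g) (k : ℕ) :
    (lazyWalk G ^ k) f ≤ (lazyWalk G ^ k) g := by
  induction k generalizing f g with
  | zero => exact h
  | succ k ih => simpa [pow_succ] using ih (lazyWalk_mono h)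

theorem lazyWalk_pow_const (hd : ∀ v, 0 < G.degree v) (a : ℝ) (k : ℕ) :
    (lazyWalk G ^ k) (fun _ => a) = fun _ => a := by
  induction k with
  | zero => rfl
  | succ k ih => simpa [pow_succ, lazyWalk_const hd] using ih

theorem abs_lazyWalk_le (hd : ∀ v, 0 < G.degree v) {f : V → ℝ} {a : ℝ} (h : ∀ v, |f v| ≤ a)
    (v : V) : |lazyWalk G f v| ≤ a := by
  have h1 := lazyWalk_mono (G := G) (f := f) (g := fun _ => a) (fun v => (abs_le.1 (h v)).2) v
  have h2 := lazyWalk_mono (G := G) (f := fun _ => -a) (g := f) (fun v => (abs_le.1 (h v)).1) v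
  rw [lazyWalk_const hd] at h1 h2
  exact abs_le.2 ⟨h2, h1⟩

theorem sum_degree_mul_abs_lazyWalk_le (hd : ∀ v, 0 < G.degree v) (f : V → ℝ) :
    ∑ v, (G.degree v : ℝ) * |lazyWalk G f v| ≤ ∑ v, (G.degree v : ℝ) * |f v| := by
  calc ∑ v, (G.degree v : ℝ) * |lazyWalk G f v|
      ≤ ∑ v, ((G.degree v : ℝ) * |f v| / 2 + (∑ w ∈ G.neighborFinset v, |f w|) / 2) := by
        refine Finset.sum_le_sum fun v _ => ?_
        have hv : (0 : ℝ) < G.degree v := by exact_mod_cast hd v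
        have h1 : |lazyWalk G f v| ≤ |f v| / 2 + (∑ w ∈ G.neighborFinset v, |f w|) /
            (2 * G.degree v) := by
          rw [lazyWalk_apply]
          refine (abs_add_le _ _).trans ?_
          rw [abs_div, abs_div, abs_of_pos (show (0 : ℝ) < 2 * G.degree v by positivity), abs_two]
          gcongr
          exact Finset.abs_sum_le_sum_abs _ _
        calc _ ≤ (G.degree v : ℝ) * (|f v| / 2 + (∑ w ∈ G.neighborFinset v, |f w|) /
              (2 * G.degree v)) := by gcongr
          _ = _ := by field_simp
    _ = _ := by
      rw [Finset.sum_add_distrib, ← Finset.sum_div, ← Finset.sum_div,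
        sum_sum_neighborFinset_comm fun _ w => |f w|]
      simp

theorem vol_mono {S T : Finset V} (h : S ⊆ T) : vol G S ≤ vol G T :=
  Finset.sum_le_sum_of_subset h

variable [DecidableEq V]

theorem lazyWalk_apply_eq_sub (hd : ∀ v, 0 < G.degree v) (f : V → ℝ) (v : V) :
    lazyWalk G f v = f v - (G.lapMatrix ℝ *ᵥ f) v / (2 * G.degree v) := by
  have : (G.degree v : ℝ) ≠ 0 := by exact_mod_cast (hd v).ne'
  rw [lazyWalk_apply, SimpleGraph.lapMatrix_mulVec_apply]
  field_simp
  ring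

theorem isHermitian_normLap : (normLap G).IsHermitian := by
  unfold normLap
  simp [Matrix.IsHermitian, (G.isSymm_lapMatrix (R := ℝ)).eq, Matrix.mul_assoc]

/-- The eigenfunctions of the random walk. -/
def eigfun (i v : V) : ℝ := (√(G.degree v : ℝ))⁻¹ * eigvec (isHermitian_normLap (G := G)) i v

/-- The eigenvalues of the normalized Laplacian. -/
def eigval (i : V) : ℝ := (isHermitian_normLap (G := G)).eigenvalues i

theorem normLap_mulVec_apply (z : V → ℝ) (v : V) : (normLap G *ᵥ z) v =
    (√(G.degree v : ℝ))⁻¹ * (G.lapMatrix ℝ *ᵥ fun w => (√(G.degree w : ℝ))⁻¹ * z w) v := by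
  rw [normLap, ← Matrix.mulVec_mulVec, ← Matrix.mulVec_mulVec, Matrix.mulVec_diagonal]
  congr 3
  ext w
  rw [Matrix.mulVec_diagonal]

theorem lapMatrix_mulVec_eigfun (hd : ∀ v, 0 < G.degree v) (i v : V) :
    (G.lapMatrix ℝ *ᵥ eigfun (G := G) i) v =
      eigval (G := G) i * (G.degree v * eigfun (G := G) i v) := by
  have h := congrFun (mulVec_eigvec (isHermitian_normLap (G := G)) i) v
  rw [normLap_mulVec_apply] at h
  have hv : (0 : ℝ) < G.degree v := by exact_mod_cast hd v
  have hs : √(G.degree v : ℝ) ≠ 0 := (Real.sqrt_pos.2 hv).ne'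
  have h2 : √(G.degree v : ℝ) * √(G.degree v : ℝ) = G.degree v := Real.mul_self_sqrt hv.le
  change _ * (G.lapMatrix ℝ *ᵥ eigfun (G := G) i) v = _ at h
  rw [inv_mul_eq_iff_eq_mul₀ hs] at h
  rw [h]
  simp only [Pi.smul_apply, smul_eq_mul, eigfun, eigval]
  nth_rewrite 2 [← h2]
  field_simp

theorem lazyWalk_eigfun (hd : ∀ v, 0 < G.degree v) (i : V) :
    lazyWalk G (eigfun (G := G) i) = (1 - eigval (G := G) i / 2) • eigfun (G := G) i := by
  ext v
  have hv : (0 : ℝ) < G.degree v := by exact_mod_cast hd v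
  rw [lazyWalk_apply_eq_sub hd, lapMatrix_mulVec_eigfun hd]
  simp
  field_simp

theorem eigfun_ne_zero (hd : ∀ v, 0 < G.degree v) (i : V) : eigfun (G := G) i ≠ 0 := by
  intro h
  apply eigvec_ne_zero (isHermitian_normLap (G := G)) i
  ext v
  have := congrFun h v
  have hv : (0 : ℝ) < G.degree v := by exact_mod_cast hd v
  have hs : √(G.degree v : ℝ) ≠ 0 := (Real.sqrt_pos.2 hv).ne'
  simpa [eigfun, hs] using this

theorem lazyWalk_pow_eigfun (hd : ∀ v, 0 < G.degree v) (i : V) (k : ℕ) :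
    (lazyWalk G ^ k) (eigfun (G := G) i) =
      (1 - eigval (G := G) i / 2) ^ k • eigfun (G := G) i := by
  induction k with
  | zero => simp
  | succ k ih => simp [pow_succ, lazyWalk_eigfun hd, ih, smul_smul, mul_comm]

theorem eigval_mem_Icc (hd : ∀ v, 0 < G.degree v) (i : V) :
    0 ≤ eigval (G := G) i ∧ eigval (G := G) i ≤ 2 := by
  obtain ⟨v, -, hv⟩ := Finset.exists_max_image Finset.univ (fun v => |eigfun (G := G) i v|)
    ⟨i, Finset.mem_univ i⟩
  have hpos : 0 < |eigfun (G := G) i v| := by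
    obtain ⟨w, hw⟩ := Function.ne_iff.1 (eigfun_ne_zero hd i)
    exact (abs_pos.2 hw).trans_le (hv w (Finset.mem_univ w))
  have hdv : (0 : ℝ) < G.degree v := by exact_mod_cast hd v
  have h := lapMatrix_mulVec_eigfun hd i v
  rw [SimpleGraph.lapMatrix_mulVec_apply] at h
  have h1 : |∑ w ∈ G.neighborFinset v, eigfun (G := G) i w| ≤
      G.degree v * |eigfun (G := G) i v| := by
    refine (Finset.abs_sum_le_sum_abs _ _).trans ?_
    refine (Finset.sum_le_card_nsmul _ _ _ fun w _ => hv w (Finset.mem_univ w)).trans ?_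
    simp
  have h2 : ∑ w ∈ G.neighborFinset v, eigfun (G := G) i w =
      (1 - eigval (G := G) i) * (G.degree v * eigfun (G := G) i v) := by linarith
  rw [h2, abs_mul, abs_mul, abs_of_pos hdv] at h1
  have h3 : |1 - eigval (G := G) i| ≤ 1 := by
    by_contra hc
    push Not at hc
    have : 0 < G.degree v * |eigfun (G := G) i v| := by positivity
    nlinarith
  rw [abs_le] at h3
  constructor <;> linarith [h3.1, h3.2]

/-- The coefficients of a function with respect to the eigenfunctions. -/
def coeff (y : V → ℝ) (i : V) : ℝ := ∑ v, (G.degree v : ℝ) * eigfun (G := G) i v * y v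

theorem sum_coeff_smul_eigfun (hd : ∀ v, 0 < G.degree v) (y : V → ℝ) :
    ∑ i, coeff (G := G) y i • eigfun (G := G) i = y := by
  ext v
  have h := congrFun (sum_eigvec_dotProduct_smul (isHermitian_normLap (G := G))
    fun v => √(G.degree v : ℝ) * y v) v
  have hs : ∀ v, √(G.degree v : ℝ) ≠ 0 := fun v =>
    (Real.sqrt_pos.2 (by exact_mod_cast hd v)).ne'
  have h2 : ∀ v, √(G.degree v : ℝ) * √(G.degree v : ℝ) = G.degree v := fun v =>
    Real.mul_self_sqrt (by positivity)
  have hc : ∀ i, coeff (G := G) y i = eigvec (isHermitian_normLap (G := G)) i ⬝ᵥ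
      fun v => √(G.degree v : ℝ) * y v := fun i => by
    unfold coeff dotProduct eigfun
    refine Finset.sum_congr rfl fun w _ => ?_
    linear_combination -((√(G.degree w : ℝ))⁻¹ * eigvec (isHermitian_normLap (G := G)) i w *
      y w) * h2 w + (√(G.degree w : ℝ) * eigvec (isHermitian_normLap (G := G)) i w * y w) *
      mul_inv_cancel₀ (hs w)
  simp only [Finset.sum_apply, Pi.smul_apply, smul_eq_mul, hc] at h ⊢
  rw [← mul_right_inj' (hs v), ← h, Finset.mul_sum]
  refine Finset.sum_congr rfl fun i _ => ?_
  unfold eigfun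
  field_simp [hs v]

theorem lapMatrix_mulVec_dotProduct (y z : V → ℝ) :
    (G.lapMatrix ℝ *ᵥ y) ⬝ᵥ z = y ⬝ᵥ (G.lapMatrix ℝ *ᵥ z) := by
  rw [Matrix.dotProduct_mulVec, ← Matrix.mulVec_transpose, (G.isSymm_lapMatrix (R := ℝ)).eq]

theorem lapMatrix_mulVec_dotProduct_lazyWalk_pow (hd : ∀ v, 0 < G.degree v) (y : V → ℝ) (k : ℕ) :
    (G.lapMatrix ℝ *ᵥ y) ⬝ᵥ (lazyWalk G ^ k) y =
      ∑ i, eigval (G := G) i * (1 - eigval (G := G) i / 2) ^ k * coeff (G := G) y i ^ 2 := by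
  conv_lhs => rw [← sum_coeff_smul_eigfun hd y, map_sum, sum_coeff_smul_eigfun hd y]
  rw [dotProduct_sum]
  refine Finset.sum_congr rfl fun i _ => ?_
  rw [map_smul, lazyWalk_pow_eigfun hd, dotProduct_smul, dotProduct_smul,
    lapMatrix_mulVec_dotProduct]
  have : y ⬝ᵥ (G.lapMatrix ℝ *ᵥ eigfun (G := G) i) =
      eigval (G := G) i * coeff (G := G) y i := by
    unfold dotProduct coeff
    rw [Finset.mul_sum]
    refine Finset.sum_congr rfl fun v _ => ?_
    rw [lapMatrix_mulVec_eigfun hd]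
    ring
  rw [this, smul_eq_mul, smul_eq_mul]
  ring

end Walk

section Resistance

variable {V : Type*} [Fintype V] [DecidableEq V] {G : SimpleGraph V} [DecidableRel G.Adj]

/-! ### Truncation of the random walk series -/

/-- The function `D⁻¹ (e_s - e_t)`. -/
def source (G : SimpleGraph V) [DecidableRel G.Adj] (s t : V) (v : V) : ℝ :=
  (Pi.single s 1 - Pi.single t 1 : V → ℝ) v / G.degree v

theorem lapMatrix_mulVec_pinv_mulVec (hG : G.Connected) (s t : V) :
    G.lapMatrix ℝ *ᵥ (pinv (G.isHermitian_lapMatrix ℝ) *ᵥ (Pi.single s 1 - Pi.single t 1)) =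
      Pi.single s 1 - Pi.single t 1 := by
  refine mulVec_pinv_mulVec _ fun z hz => ?_
  rw [SimpleGraph.lapMatrix_mulVec_eq_zero_iff_forall_reachable] at hz
  simp [dotProduct_sub, hz s t (hG.preconnected s t)]

/-- The walk of length less than `k` from `s` and `t` determines the effective resistance up to a
factor which tends to `1` exponentially fast. -/
theorem truncation_bounds (hG : G.Connected) (hd : ∀ v, 0 < G.degree v) {κ : ℝ} (hκ0 : 0 < κ)
    (hκ : ∀ i, eigval (G := G) i = 0 ∨ 1 ≤ κ * eigval (G := G) i) (s t : V) (k : ℕ) :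
    (1 - Real.exp (-(k / (2 * κ)))) * effRes G s t ≤
        (∑ i ∈ Finset.range k, ((lazyWalk G ^ i) (source G s t) s -
          (lazyWalk G ^ i) (source G s t) t)) / 2 ∧
      (∑ i ∈ Finset.range k, ((lazyWalk G ^ i) (source G s t) s -
          (lazyWalk G ^ i) (source G s t) t)) / 2 ≤ effRes G s t := by
  set x : V → ℝ := Pi.single s 1 - Pi.single t 1 with hx
  set y := pinv (G.isHermitian_lapMatrix ℝ) *ᵥ x with hy
  have hL : G.lapMatrix ℝ *ᵥ y = x := lapMatrix_mulVec_pinv_mulVec hG s t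
  have hr : effRes G s t = x ⬝ᵥ y := rfl
  have hq : ∀ i, x ⬝ᵥ (lazyWalk G ^ i) y =
      ∑ j, eigval (G := G) j * (1 - eigval (G := G) j / 2) ^ i * coeff (G := G) y j ^ 2 := by
    intro i
    rw [← lapMatrix_mulVec_dotProduct_lazyWalk_pow hd, hL]
  have hsrc : source G s t = (2 : ℝ) • (y - lazyWalk G y) := by
    ext v
    have : (G.degree v : ℝ) ≠ 0 := by exact_mod_cast (hd v).ne'
    simp only [source, Pi.smul_apply, Pi.sub_apply, smul_eq_mul, lazyWalk_apply_eq_sub hd, hL, hx]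
    field_simp
    ring
  have hsum : (∑ i ∈ Finset.range k, ((lazyWalk G ^ i) (source G s t) s -
      (lazyWalk G ^ i) (source G s t) t)) / 2 = x ⬝ᵥ y - x ⬝ᵥ (lazyWalk G ^ k) y := by
    induction k with
    | zero => simp
    | succ k ih =>
      rw [Finset.sum_range_succ, add_div, ih]
      have h1 : (lazyWalk G ^ k) (source G s t) =
          (2 : ℝ) • ((lazyWalk G ^ k) y - (lazyWalk G ^ (k + 1)) y) := by
        rw [hsrc, map_smul, map_sub, pow_succ]
        rfl
      have h2 : ∀ f : V → ℝ, x ⬝ᵥ f = f s - f t := fun f => by simp [hx, sub_dotProduct]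
      rw [h1, h2, h2, h2]
      simp only [Pi.smul_apply, Pi.sub_apply, smul_eq_mul]
      ring
  have h0 := hq 0
  simp only [pow_zero, mul_one] at h0
  rw [hsum, hr]
  have hb : ∀ j, 0 ≤ eigval (G := G) j * (1 - eigval (G := G) j / 2) ^ k ∧
      eigval (G := G) j * (1 - eigval (G := G) j / 2) ^ k ≤
        Real.exp (-(k / (2 * κ))) * eigval (G := G) j := by
    intro j
    obtain ⟨h1, h2⟩ := eigval_mem_Icc hd j
    refine ⟨mul_nonneg h1 (pow_nonneg (by linarith) _), ?_⟩
    rcases hκ j with h | h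
    · simp [h]
    · rw [mul_comm]
      refine mul_le_mul_of_nonneg_right ?_ h1
      calc (1 - eigval (G := G) j / 2) ^ k ≤ Real.exp (-(eigval (G := G) j / 2)) ^ k := by
            refine pow_le_pow_left₀ (by linarith) ?_ _
            linarith [Real.add_one_le_exp (-(eigval (G := G) j / 2))]
        _ = Real.exp (k * -(eigval (G := G) j / 2)) := by rw [Real.exp_nat_mul]
        _ ≤ _ := by
          rw [Real.exp_le_exp]
          have : 1 / (2 * κ) ≤ eigval (G := G) j / 2 := by
            rw [div_le_div_iff₀ (by positivity) (by norm_num)]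
            linarith
          have := mul_le_mul_of_nonneg_left this (Nat.cast_nonneg (α := ℝ) k)
          rw [mul_one_div] at this
          linarith
  have hlow : 0 ≤ x ⬝ᵥ (lazyWalk G ^ k) y := by
    rw [hq]
    exact Finset.sum_nonneg fun j _ => mul_nonneg (hb j).1 (sq_nonneg _)
  have hup : x ⬝ᵥ (lazyWalk G ^ k) y ≤ Real.exp (-(k / (2 * κ))) * (x ⬝ᵥ y) := by
    rw [hq, show x ⬝ᵥ y = _ from h0, Finset.mul_sum]
    refine Finset.sum_le_sum fun j _ => ?_
    rw [← mul_assoc]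
    exact mul_le_mul_of_nonneg_right (hb j).2 (sq_nonneg _)
  constructor <;> linarith

theorem le_effRes (hG : G.Connected) (hd : ∀ v, 0 < G.degree v) {κ : ℝ} (hκ0 : 0 < κ)
    (hκ : ∀ i, eigval (G := G) i = 0 ∨ 1 ≤ κ * eigval (G := G) i) {s t : V} (hst : s ≠ t) :
    1 / (2 * (min (G.degree s) (G.degree t) : ℕ)) ≤ effRes G s t := by
  have h := (truncation_bounds hG hd hκ0 hκ s t 1).2
  simp [source, hst, hst.symm] at h
  refine le_trans ?_ h
  have h1 : (0 : ℝ) < G.degree s := by exact_mod_cast hd s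
  have h2 : (0 : ℝ) < G.degree t := by exact_mod_cast hd t
  rcases min_choice (G.degree s) (G.degree t) with h | h <;> rw [h, mul_comm, ← div_div, one_div]
  · gcongr
    rw [neg_div, sub_neg_eq_add]
    exact le_add_of_nonneg_right (by positivity)
  · gcongr
    rw [neg_div, sub_neg_eq_add, one_div]
    exact le_add_of_nonneg_left (by positivity)

/-! ### The condition number -/

theorem exists_one_le_eigval [Nonempty V] (hd : ∀ v, 0 < G.degree v) :
    ∃ i, 1 ≤ eigval (G := G) i := by
  have htr : ∑ i, eigval (G := G) i = ∑ _i : V, (1 : ℝ) := by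
    have h := (isHermitian_normLap (G := G)).trace_eq_sum_eigenvalues
    simp only [RCLike.ofReal_real_eq_id, id] at h
    unfold eigval
    rw [← h, Matrix.trace]
    refine Finset.sum_congr rfl fun v _ => ?_
    have hv : (0 : ℝ) < G.degree v := by exact_mod_cast hd v
    have hs : √(G.degree v : ℝ) ≠ 0 := (Real.sqrt_pos.2 hv).ne'
    have h2 : √(G.degree v : ℝ) * √(G.degree v : ℝ) = G.degree v := Real.mul_self_sqrt hv.le
    rw [Matrix.diag_apply, normLap, Matrix.mul_diagonal, Matrix.diagonal_mul]
    simp only [SimpleGraph.lapMatrix, SimpleGraph.degMatrix, Matrix.sub_apply,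
      Matrix.diagonal_apply_eq, SimpleGraph.adjMatrix_apply, SimpleGraph.irrefl, if_false, sub_zero]
    nth_rewrite 2 [← h2]
    field_simp
  obtain ⟨i, -, hi⟩ := Finset.exists_le_of_sum_le Finset.univ_nonempty htr.ge
  exact ⟨i, hi⟩

theorem one_le_mul_eigval_of_condNumber_le [Nonempty V] (hd : ∀ v, 0 < G.degree v) {κ : ℝ}
    (hκ : condNumber (normLap G) ≤ κ) (i : V) :
    eigval (G := G) i = 0 ∨ 1 ≤ κ * eigval (G := G) i := by
  rcases eq_or_ne (eigval (G := G) i) 0 with h0 | h0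
  · exact Or.inl h0
  right
  have hspec : spectrum ℝ (normLap G) = Set.range (eigval (G := G)) :=
    (isHermitian_normLap (G := G)).spectrum_real_eq_range_eigenvalues
  rw [condNumber, hspec] at hκ
  obtain ⟨j, hj⟩ := exists_one_le_eigval hd
  have hsup : 1 ≤ sSup (Set.range (eigval (G := G))) :=
    hj.trans (le_csSup (Set.finite_range _).bddAbove ⟨j, rfl⟩)
  have hfin : (Set.range (eigval (G := G)) \ {0}).Finite := (Set.finite_range _).sdiff
  have hmem : eigval (G := G) i ∈ Set.range (eigval (G := G)) \ {0} := ⟨⟨i, rfl⟩, h0⟩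
  have hle := csInf_le hfin.bddBelow hmem
  obtain ⟨⟨l, hl⟩, hl0⟩ := Set.Nonempty.csInf_mem ⟨_, hmem⟩ hfin
  have hpos : 0 < sInf (Set.range (eigval (G := G)) \ {0}) := by
    refine lt_of_le_of_ne ?_ fun h => hl0 h.symm
    rw [← hl]
    exact (eigval_mem_Icc hd l).1
  rw [div_le_iff₀ hpos] at hκ
  have hκ0 : 0 < κ := pos_of_mul_pos_left (by linarith) hpos.le
  nlinarith

theorem half_le_of_forall_eigval [Nonempty V] (hd : ∀ v, 0 < G.degree v) {κ : ℝ}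
    (hκ : ∀ i, eigval (G := G) i = 0 ∨ 1 ≤ κ * eigval (G := G) i) : 1 / 2 ≤ κ := by
  obtain ⟨i, hi⟩ := exists_one_le_eigval hd
  have h2 := (eigval_mem_Icc hd i).2
  rcases hκ i with h | h
  · linarith
  · have hκ0 : 0 < κ := pos_of_mul_pos_left (by linarith) (show 0 ≤ eigval (G := G) i by linarith)
    nlinarith

/-! ### Cheeger's inequality -/

theorem cut_eq_sum (S : Finset V) : (cut G S : ℝ) =
    ∑ v, ∑ w ∈ G.neighborFinset v, if v ∈ S ∧ w ∉ S then (1 : ℝ) else 0 := by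
  simp only [cut, Finset.card_filter, Finset.sum_product, SimpleGraph.neighborFinset_eq_filter,
    Finset.sum_filter]
  push_cast
  rw [← Finset.sum_subset (Finset.subset_univ S)]
  · refine Finset.sum_congr rfl fun v hv => ?_
    rw [← Finset.sum_subset (Finset.subset_univ Sᶜ)]
    · refine Finset.sum_congr rfl fun w hw => ?_
      simp [hv, Finset.mem_compl.1 hw]
    · intro w _ hw
      simp [not_not.1 (mt Finset.mem_compl.2 hw)]
  · intro v _ hv
    simp [hv]

/-- The co-area inequality. -/
theorem mul_sum_degree_mul_le {φ : ℝ} {g : V → ℝ} (hg : 0 ≤ g)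
    (hφ : ∀ S : Finset V, S.Nonempty → (∀ v ∈ S, 0 < g v) → φ * vol G S ≤ cut G S) :
    φ * ∑ v, G.degree v * g v ≤ ∑ v, ∑ w ∈ G.neighborFinset v, max (g v - g w) 0 := by
  induction hc : (Finset.univ.filter fun v => 0 < g v).card using Nat.strong_induction_on
    generalizing g with
  | _ c ih =>
    set T := Finset.univ.filter fun v => 0 < g v with hT
    rcases T.eq_empty_or_nonempty with hTe | hTn
    · have h0 : g = 0 := by
        ext v
        refine le_antisymm (not_lt.1 fun h => ?_) (hg v)
        have : v ∈ T := Finset.mem_filter.2 ⟨Finset.mem_univ v, h⟩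
        simp [hTe] at this
      simp [h0]
    · have hmemT : ∀ v, v ∈ T ↔ 0 < g v := fun v => by simp [hT]
      obtain ⟨v₀, hv₀, hmin⟩ := T.exists_min_image g hTn
      set a := g v₀ with ha
      have ha0 : 0 < a := (hmemT v₀).1 hv₀
      set g' : V → ℝ := fun v => if v ∈ T then g v - a else 0 with hg'
      have hnot : ∀ v, v ∉ T → g v = 0 := fun v hv =>
        le_antisymm (not_lt.1 (mt (hmemT v).2 hv)) (hg v)
      have hg'0 : 0 ≤ g' := fun v => by
        simp only [hg', Pi.zero_apply]
        split_ifs with h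
        · linarith [hmin v h]
        · exact le_rfl
      have hsub : ∀ v, 0 < g' v → v ∈ T ∧ a < g v := fun v hv => by
        simp only [hg'] at hv
        split_ifs at hv with h
        · exact ⟨h, by linarith⟩
        · exact absurd hv (lt_irrefl _)
      have hlt : (Finset.univ.filter fun v => 0 < g' v).card < c := by
        rw [← hc]
        refine Finset.card_lt_card ((Finset.ssubset_iff_of_subset fun v hv => ?_).2
          ⟨v₀, hv₀, fun h => ?_⟩)
        · exact (hsub v (Finset.mem_filter.1 hv).2).1
        · exact lt_irrefl a (hsub v₀ (Finset.mem_filter.1 h).2).2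
      have hrec := ih _ hlt hg'0 (fun S hS hS' => hφ S hS fun v hv =>
        (hmemT v).1 (hsub v (hS' v hv)).1) rfl
      have hcut := mul_le_mul_of_nonneg_left (hφ T hTn fun v hv => (hmemT v).1 hv) ha0.le
      have e1 : ∑ v, G.degree v * g v = a * vol G T + ∑ v, G.degree v * g' v := by
        have : (vol G T : ℝ) = ∑ v, if v ∈ T then (G.degree v : ℝ) else 0 := by
          simp [vol]
        rw [this, Finset.mul_sum, ← Finset.sum_add_distrib]
        refine Finset.sum_congr rfl fun v _ => ?_
        simp only [hg']
        split_ifs with h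
        · ring
        · rw [hnot v h]
          ring
      have e2 : ∑ v, ∑ w ∈ G.neighborFinset v, max (g v - g w) 0 =
          a * cut G T + ∑ v, ∑ w ∈ G.neighborFinset v, max (g' v - g' w) 0 := by
        rw [cut_eq_sum, Finset.mul_sum, ← Finset.sum_add_distrib]
        refine Finset.sum_congr rfl fun v _ => ?_
        rw [Finset.mul_sum, ← Finset.sum_add_distrib]
        refine Finset.sum_congr rfl fun w _ => ?_
        simp only [hg']
        by_cases hv : v ∈ T <;> by_cases hw : w ∈ T
        · simp [hv, hw]
        · simp [hv, hw, hnot w hw, hmin v hv]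
          exact hg v
        · simp [hv, hw, hnot v hv, hmin w hw]
          exact hg w
        · simp [hv, hw, hnot v hv, hnot w hw]
      rw [e1, e2]
      linarith

theorem conductance_mul_vol_le_cut (hd : ∀ v, 0 < G.degree v) {S : Finset V} (hS : S.Nonempty)
    (h : vol G S ≤ vol G Sᶜ) : conductance G * vol G S ≤ cut G S := by
  have hpos : 0 < vol G S := Finset.sum_pos (fun v _ => hd v) hS
  have hne : S ≠ Finset.univ := by
    rintro rfl
    simp [vol] at h hpos
    exact absurd hpos (by simp [h])
  have h1 : conductance G ≤ (cut G S : ℝ) / (min (vol G S) (vol G Sᶜ) : ℕ) :=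
    ciInf_le (Set.finite_range _).bddBelow (⟨S, hS, hne⟩ : {S : Finset V // _})
  rwa [min_eq_left h, le_div_iff₀ (by exact_mod_cast hpos)] at h1

theorem sq_le_of_eigenfunction {φ μ : ℝ} (hφ : 0 ≤ φ) {f : V → ℝ}
    (hf : ∀ v, (G.lapMatrix ℝ *ᵥ f) v = μ * (G.degree v * f v)) (hd : ∀ v, 0 < G.degree v)
    (hpos : ∃ v, 0 < f v)
    (hcut : ∀ S : Finset V, S.Nonempty → (∀ v ∈ S, 0 < f v) → φ * vol G S ≤ cut G S) :
    φ ^ 2 ≤ 2 * μ := by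
  set p : V → ℝ := fun v => max (f v) 0 with hp
  have hp0 : ∀ v, 0 ≤ p v := fun v => le_max_right _ _
  set M := ∑ v, G.degree v * p v ^ 2 with hM
  have hM0 : 0 < M := by
    obtain ⟨v, hv⟩ := hpos
    refine Finset.sum_pos' (fun w _ => by positivity) ⟨v, Finset.mem_univ v, ?_⟩
    have h1 : (0 : ℝ) < G.degree v := by exact_mod_cast hd v
    have h2 : 0 < p v := lt_max_of_lt_left hv
    positivity
  have hdeg : ∀ F : V → ℝ, ∑ v, ∑ _w ∈ G.neighborFinset v, F v = ∑ v, G.degree v * F v :=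
    fun F => by simp
  have hco : φ * M ≤ ∑ v, ∑ w ∈ G.neighborFinset v, max (p v ^ 2 - p w ^ 2) 0 := by
    refine mul_sum_degree_mul_le (fun v => sq_nonneg _) fun S hS hS' => hcut S hS fun v hv => ?_
    by_contra h
    have := hS' v hv
    simp [hp, max_eq_right (not_lt.1 h)] at this
  have hhalf : ∑ v, ∑ w ∈ G.neighborFinset v, |p v ^ 2 - p w ^ 2| =
      2 * ∑ v, ∑ w ∈ G.neighborFinset v, max (p v ^ 2 - p w ^ 2) 0 := by
    rw [two_mul]
    conv_rhs => enter [2]; rw [sum_sum_neighborFinset_comm]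
    rw [← Finset.sum_add_distrib]
    refine Finset.sum_congr rfl fun v _ => ?_
    rw [← Finset.sum_add_distrib]
    refine Finset.sum_congr rfl fun w _ => ?_
    rcases le_total (p v ^ 2) (p w ^ 2) with h | h
    · rw [abs_of_nonpos (by linarith), max_eq_right (by linarith), max_eq_left (by linarith)]
      ring
    · rw [abs_of_nonneg (by linarith), max_eq_left (by linarith), max_eq_right (by linarith)]
      ring
  have henergy : ∑ v, ∑ w ∈ G.neighborFinset v, (p v - p w) ^ 2 ≤ 2 * μ * M := by
    have e : ∑ v, ∑ w ∈ G.neighborFinset v, (p v - p w) ^ 2 =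
        2 * ∑ v, ∑ w ∈ G.neighborFinset v, (p v ^ 2 - p v * p w) := by
      rw [two_mul]
      conv_rhs => enter [2]; rw [sum_sum_neighborFinset_comm]
      rw [← Finset.sum_add_distrib]
      refine Finset.sum_congr rfl fun v _ => ?_
      rw [← Finset.sum_add_distrib]
      exact Finset.sum_congr rfl fun w _ => by ring
    rw [e, mul_assoc]
    refine mul_le_mul_of_nonneg_left ?_ zero_le_two
    rw [hM, Finset.mul_sum]
    refine Finset.sum_le_sum fun v _ => ?_
    rcases le_or_gt (f v) 0 with h | h
    · simp [hp, max_eq_right h]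
    · have hpv : p v = f v := max_eq_left h.le
      have h1 := hf v
      rw [SimpleGraph.lapMatrix_mulVec_apply] at h1
      have h2 : ∑ w ∈ G.neighborFinset v, f w ≤ ∑ w ∈ G.neighborFinset v, p w :=
        Finset.sum_le_sum fun w _ => le_max_left _ _
      have h3 : ∑ w ∈ G.neighborFinset v, (p v ^ 2 - p v * p w) =
          p v * (G.degree v * f v - ∑ w ∈ G.neighborFinset v, p w) := by
        rw [Finset.sum_sub_distrib, ← Finset.mul_sum, Finset.sum_const,
          SimpleGraph.card_neighborFinset_eq_degree, nsmul_eq_mul, hpv]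
        ring
      rw [h3]
      calc _ ≤ p v * (μ * (G.degree v * f v)) := by
            have h4 : G.degree v * f v - ∑ w ∈ G.neighborFinset v, p w ≤
                μ * (G.degree v * f v) := by linarith
            exact mul_le_mul_of_nonneg_left h4 (hp0 v)
        _ = _ := by rw [hpv]; ring
  have hplus : ∑ v, ∑ w ∈ G.neighborFinset v, (p v + p w) ^ 2 ≤ 4 * M := by
    calc _ ≤ ∑ v, ∑ w ∈ G.neighborFinset v, (2 * p v ^ 2 + 2 * p w ^ 2) :=
          Finset.sum_le_sum fun v _ => Finset.sum_le_sum fun w _ => by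
            nlinarith [sq_nonneg (p v - p w)]
      _ = 4 * M := by
          simp only [Finset.sum_add_distrib]
          rw [sum_sum_neighborFinset_comm fun _ w => 2 * p w ^ 2, hdeg, hM, Finset.mul_sum,
            ← Finset.sum_add_distrib]
          exact Finset.sum_congr rfl fun v _ => by ring
  have hcs : (∑ v, ∑ w ∈ G.neighborFinset v, |p v ^ 2 - p w ^ 2|) ^ 2 ≤
      (∑ v, ∑ w ∈ G.neighborFinset v, (p v - p w) ^ 2) *
        ∑ v, ∑ w ∈ G.neighborFinset v, (p v + p w) ^ 2 := by
    simp only [Finset.sum_sigma']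
    refine le_trans (le_of_eq ?_) ((Finset.sum_mul_sq_le_sq_mul_sq
      (Finset.univ.sigma fun v => G.neighborFinset v) (fun e => |p e.1 - p e.2|)
      fun e => |p e.1 + p e.2|).trans (le_of_eq ?_))
    · congr 1
      refine Finset.sum_congr rfl fun e _ => ?_
      rw [← abs_mul]
      congr 1
      ring
    · simp only [sq_abs]
  rw [hhalf] at hcs
  have h1 : (2 * (φ * M)) ^ 2 ≤ 2 * μ * M * (4 * M) := by
    refine le_trans ?_ (hcs.trans (mul_le_mul henergy hplus
      (Finset.sum_nonneg fun v _ => Finset.sum_nonneg fun w _ => sq_nonneg _) ?_))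
    · exact pow_le_pow_left₀ (by positivity) (by linarith) 2
    · exact (Finset.sum_nonneg fun v _ => Finset.sum_nonneg fun w _ => sq_nonneg _).trans henergy
  have h2 : 0 < M ^ 2 := by positivity
  nlinarith

/-- The hard direction of Cheeger's inequality. -/
theorem conductance_sq_le_two_mul_eigval (hd : ∀ v, 0 < G.degree v) {i : V}
    (hi : eigval (G := G) i ≠ 0) (hφ : 0 ≤ conductance G) :
    conductance G ^ 2 ≤ 2 * eigval (G := G) i := by
  set f := eigfun (G := G) i with hfdef
  have hf := lapMatrix_mulVec_eigfun hd i
  rw [← hfdef] at hf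
  have hsum : ∑ v, (G.degree v : ℝ) * f v = 0 := by
    have h1 : ∑ v, (G.lapMatrix ℝ *ᵥ f) v = 0 := by
      have h2 := lapMatrix_mulVec_dotProduct (G := G) f fun _ => 1
      rw [SimpleGraph.lapMatrix_mulVec_const_eq_zero] at h2
      simpa [dotProduct] using h2
    simp only [hf, ← Finset.mul_sum] at h1
    exact (mul_eq_zero.1 h1).resolve_left hi
  have hsign : ∀ g : V → ℝ, g ≠ 0 → ∑ v, (G.degree v : ℝ) * g v = 0 → ∃ v, 0 < g v := by
    intro g hg h0
    by_contra! hc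
    have h1 : ∀ v ∈ Finset.univ, (G.degree v : ℝ) * g v = 0 :=
      (Finset.sum_eq_zero_iff_of_nonpos fun v _ =>
        mul_nonpos_of_nonneg_of_nonpos (Nat.cast_nonneg _) (hc v)).1 h0
    refine hg (funext fun v => ?_)
    exact (mul_eq_zero.1 (h1 v (Finset.mem_univ v))).resolve_left
      (by exact_mod_cast (hd v).ne')
  have key : ∀ g : V → ℝ, g ≠ 0 → ∑ v, (G.degree v : ℝ) * g v = 0 →
      (∀ v, (G.lapMatrix ℝ *ᵥ g) v = eigval (G := G) i * (G.degree v * g v)) →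
      vol G (Finset.univ.filter fun v => 0 < g v) ≤ vol G (Finset.univ.filter fun v => 0 < g v)ᶜ →
      conductance G ^ 2 ≤ 2 * eigval (G := G) i := by
    intro g hg h0 hL hvol
    refine sq_le_of_eigenfunction hφ hL hd (hsign g hg h0) fun S hS hS' => ?_
    have hsub : S ⊆ Finset.univ.filter fun v => 0 < g v := fun v hv => by simp [hS' v hv]
    exact conductance_mul_vol_le_cut hd hS ((vol_mono hsub).trans (hvol.trans
      (vol_mono (Finset.compl_subset_compl.2 hsub))))
  have hf0 : f ≠ 0 := eigfun_ne_zero hd i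
  rcases le_total (vol G (Finset.univ.filter fun v => 0 < f v))
    (vol G (Finset.univ.filter fun v => 0 < f v)ᶜ) with h | h
  · exact key f hf0 hsum hf h
  · refine key (-f) (neg_ne_zero.2 hf0) (by simp [hsum]) (fun v => ?_) ?_
    · rw [Matrix.mulVec_neg, Pi.neg_apply, hf, Pi.neg_apply]
      ring
    · have hdisj : (Finset.univ.filter fun v => 0 < (-f) v) ⊆
          (Finset.univ.filter fun v => 0 < f v)ᶜ := fun v hv => by
        simp at hv ⊢
        exact hv.le
      refine (vol_mono hdisj).trans (h.trans (vol_mono ?_))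
      rw [← Finset.compl_subset_compl, compl_compl]
      exact hdisj

theorem connected_of_conductance_pos [Nonempty V] (h : 0 < conductance G) : G.Connected := by
  classical
  by_contra hc
  obtain ⟨u, v, huv⟩ : ∃ u v, ¬G.Reachable u v := by
    by_contra! hcon
    exact hc ⟨hcon⟩
  set S := Finset.univ.filter fun w => G.Reachable u w with hS
  have hcut : cut G S = 0 := by
    rw [cut, Finset.card_eq_zero, Finset.filter_eq_empty_iff]
    rintro ⟨a, b⟩ hab hadj
    simp only [Finset.mem_product, hS, Finset.mem_compl, Finset.mem_filter, Finset.mem_univ,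
      true_and] at hab
    exact hab.2 (hab.1.trans hadj.reachable)
  have h1 : conductance G ≤ (cut G S : ℝ) / (min (vol G S) (vol G Sᶜ) : ℕ) :=
    ciInf_le (Set.finite_range _).bddBelow (⟨S, ⟨u, by simp [hS]⟩, fun h => huv (by
      have : v ∈ S := h ▸ Finset.mem_univ v
      simpa [hS] using this)⟩ : {S : Finset V // _})
  rw [hcut, Nat.cast_zero, zero_div] at h1
  exact absurd h (not_lt.2 h1)

end Resistance

section Push

variable {V : Type*} [Fintype V] {G : SimpleGraph V} [DecidableRel G.Adj]

/-! ### Pushing large values along the lazy random walk -/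

/-- The restriction of a function to its large values. -/
def large (θ : ℝ) (g : V → ℝ) (v : V) : ℝ := if θ < |g v| then g v else 0

variable (G) in
/-- The functions obtained from `g` by repeatedly discarding the small values and applying the lazy
random walk. -/
def level (θ : ℝ) (g : V → ℝ) : ℕ → V → ℝ
  | 0 => g
  | j + 1 => lazyWalk G (large θ (level θ g j))

variable (G) in
/-- The values discarded at a level. -/
def residual (θ : ℝ) (g : V → ℝ) (j : ℕ) : V → ℝ := level G θ g j - large θ (level G θ g j)

theorem lazyWalk_pow_eq (θ : ℝ) (g : V → ℝ) (i : ℕ) : (lazyWalk G ^ i) g =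
    large θ (level G θ g i) +
      ∑ j ∈ Finset.range (i + 1), (lazyWalk G ^ (i - j)) (residual G θ g j) := by
  induction i with
  | zero => simp [residual, level]
  | succ i ih =>
    rw [pow_succ', Module.End.mul_apply, ih, map_add, map_sum, Finset.sum_range_succ _ (i + 1)]
    have h : ∀ j ∈ Finset.range (i + 1), lazyWalk G ((lazyWalk G ^ (i - j)) (residual G θ g j)) =
        (lazyWalk G ^ (i + 1 - j)) (residual G θ g j) := fun j hj => by
      rw [show i + 1 - j = (i - j) + 1 by have := Finset.mem_range.1 hj; omega, pow_succ']
      rfl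
    rw [Finset.sum_congr rfl h]
    simp only [residual, level, Nat.sub_self, pow_zero, Module.End.one_apply]
    abel

theorem abs_large_le {V : Type*} (θ : ℝ) (g : V → ℝ) (v : V) : |large θ g v| ≤ |g v| := by
  unfold large
  split_ifs <;> simp

theorem abs_level_le (hd : ∀ v, 0 < G.degree v) {θ a : ℝ} {g : V → ℝ} (hg : ∀ v, |g v| ≤ a)
    (j : ℕ) (v : V) : |level G θ g j v| ≤ a := by
  induction j generalizing v with
  | zero => exact hg v
  | succ j ih => exact abs_lazyWalk_le hd (fun w => (abs_large_le _ _ w).trans (ih w)) v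

theorem abs_residual_le (hd : ∀ v, 0 < G.degree v) {θ a : ℝ} (hθ : 0 ≤ θ) {g : V → ℝ}
    (hg : ∀ v, |g v| ≤ a) (j : ℕ) (v : V) :
    |residual G θ g j v| ≤ θ ∧ |residual G θ g j v| ≤ a := by
  have ha : 0 ≤ a := (abs_nonneg _).trans (hg v)
  simp only [residual, Pi.sub_apply, large]
  split_ifs with h
  · simp [hθ, ha]
  · rw [sub_zero]
    exact ⟨not_lt.1 h, abs_level_le hd hg j v⟩

theorem sum_degree_mul_abs_level_le (hd : ∀ v, 0 < G.degree v) (θ : ℝ) (g : V → ℝ) (j : ℕ) :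
    ∑ v, G.degree v * |level G θ g j v| ≤ ∑ v, G.degree v * |g v| := by
  induction j with
  | zero => exact le_rfl
  | succ j ih =>
    refine (sum_degree_mul_abs_lazyWalk_le hd _).trans (le_trans ?_ ih)
    exact Finset.sum_le_sum fun v _ =>
      mul_le_mul_of_nonneg_left (abs_large_le _ _ v) (Nat.cast_nonneg _)

variable (G) in
/-- The vertices with a large value at a level. -/
def bigSet (θ : ℝ) (g : V → ℝ) (j : ℕ) : Finset V :=
  Finset.univ.filter fun v => θ < |level G θ g j v|

theorem sum_bigSet_le (hd : ∀ v, 0 < G.degree v) {θ a : ℝ} (hθ : 0 < θ) {g : V → ℝ}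
    (hg : ∑ v, G.degree v * |g v| ≤ a) (j : ℕ) :
    ((∑ v ∈ bigSet G θ g j, (G.degree v + 1) : ℕ) : ℝ) ≤ 2 * a / θ := by
  rw [le_div_iff₀ hθ]
  push_cast
  calc (∑ v ∈ bigSet G θ g j, ((G.degree v : ℝ) + 1)) * θ
      ≤ ∑ v ∈ bigSet G θ g j, 2 * (G.degree v * |level G θ g j v|) := by
        rw [Finset.sum_mul]
        refine Finset.sum_le_sum fun v hv => ?_
        have h1 : θ < |level G θ g j v| := (Finset.mem_filter.1 hv).2
        have h2 : (1 : ℝ) ≤ G.degree v := by exact_mod_cast hd v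
        nlinarith
    _ ≤ ∑ v, 2 * (G.degree v * |level G θ g j v|) :=
        Finset.sum_le_univ_sum_of_nonneg fun v => by positivity
    _ = 2 * ∑ v, G.degree v * |level G θ g j v| := by rw [Finset.mul_sum]
    _ ≤ 2 * a := by linarith [sum_degree_mul_abs_level_le hd θ g j]

/-! ### Random walks that sample the discarded values -/

variable (G) in
/-- The value of a random walk of length `m` that ends in `v`, for the discarded values of
level `j`. -/
def sampleVal (θ : ℝ) (g : V → ℝ) (k m j : ℕ) (v : V) : ℝ :=
  if j + m < k then residual G θ g j v else 0

variable (G) in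
/-- The expectation of `F` of the sampled value. -/
def sampleAvg (θ : ℝ) (g : V → ℝ) (k : ℕ) (s t : V) (F : ℝ → ℝ) : ℝ :=
  (∑ m ∈ Finset.range k, (∑ j ∈ Finset.range k,
    ((lazyWalk G ^ m) (fun v => F (sampleVal G θ g k m j v)) s +
      (lazyWalk G ^ m) (fun v => F (-sampleVal G θ g k m j v)) t) / 2) / k) / k

theorem sampleAvg_mono {θ B : ℝ} {g : V → ℝ} {k : ℕ} {s t : V} {F F' : ℝ → ℝ}
    (hB : ∀ m j v, |sampleVal G θ g k m j v| ≤ B) (h : ∀ y, |y| ≤ B → F y ≤ F' y) :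
    sampleAvg G θ g k s t F ≤ sampleAvg G θ g k s t F' := by
  unfold sampleAvg
  gcongr with m hm j hj
  · exact lazyWalk_pow_mono (fun v => h _ (hB m j v)) m s
  · exact lazyWalk_pow_mono (fun v => h _ (by rw [abs_neg]; exact hB m j v)) m t

theorem sampleAvg_affine (hd : ∀ v, 0 < G.degree v) {θ : ℝ} {g : V → ℝ} {k : ℕ} (hk : 0 < k)
    {s t : V} (a b : ℝ) :
    sampleAvg G θ g k s t (fun y => a + b * y) = a + b * sampleAvg G θ g k s t id := by
  have key : ∀ m (f : V → ℝ) v, (lazyWalk G ^ m) (fun w => a + b * f w) v =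
      a + b * (lazyWalk G ^ m) f v := fun m f v => by
    have : (fun w => a + b * f w) = (fun _ => a) + b • f := by
      ext w
      simp
    rw [this, map_add, map_smul, lazyWalk_pow_const hd]
    simp
  have hk' : (k : ℝ) ≠ 0 := by exact_mod_cast hk.ne'
  unfold sampleAvg
  simp only [key _ (fun v => sampleVal G θ g k _ _ v), key _ (fun v => -sampleVal G θ g k _ _ v), id]
  have h1 : ∀ m ∈ Finset.range k, (∑ j ∈ Finset.range k,
      (a + b * (lazyWalk G ^ m) (fun v => sampleVal G θ g k m j v) s +
        (a + b * (lazyWalk G ^ m) (fun v => -sampleVal G θ g k m j v) t)) / 2) / k =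
      a + b * ((∑ j ∈ Finset.range k,
      ((lazyWalk G ^ m) (fun v => sampleVal G θ g k m j v) s +
        (lazyWalk G ^ m) (fun v => -sampleVal G θ g k m j v) t) / 2) / k) := fun m _ => by
    rw [Finset.sum_congr rfl fun j _ => show _ = a + b * (((lazyWalk G ^ m)
      (fun v => sampleVal G θ g k m j v) s +
        (lazyWalk G ^ m) (fun v => -sampleVal G θ g k m j v) t) / 2) by ring,
      Finset.sum_add_distrib, ← Finset.mul_sum, Finset.sum_const, Finset.card_range, nsmul_eq_mul]
    field_simp
  rw [Finset.sum_congr rfl h1, Finset.sum_add_distrib, ← Finset.mul_sum, Finset.sum_const,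
    Finset.card_range, nsmul_eq_mul]
  field_simp

theorem sampleAvg_exp_le (hd : ∀ v, 0 < G.degree v) {θ B : ℝ} {g : V → ℝ} {k : ℕ} (hk : 0 < k)
    {s t : V} (hB : ∀ m j v, |sampleVal G θ g k m j v| ≤ B) {r : ℝ} (hr : |r| * (2 * B) ≤ 1) :
    sampleAvg G θ g k s t (fun y => Real.exp (r * (y - sampleAvg G θ g k s t id))) ≤
      Real.exp (4 * r ^ 2 * B ^ 2) := by
  set μ := sampleAvg G θ g k s t id with hμ
  have hμB : |μ| ≤ B := by
    have h1 := sampleAvg_mono (s := s) (t := t) (F := id) (F' := fun y => B + 0 * y) hB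
      fun y hy => by simpa using (abs_le.1 hy).2
    have h2 := sampleAvg_mono (s := s) (t := t) (F := fun y => -B + 0 * y) (F' := id) hB
      fun y hy => by simpa using (abs_le.1 hy).1
    rw [sampleAvg_affine hd hk] at h1 h2
    rw [abs_le]
    constructor <;> linarith
  calc _ ≤ sampleAvg G θ g k s t
        (fun y => (1 - r * μ + 4 * r ^ 2 * B ^ 2) + r * y) := by
        refine sampleAvg_mono hB fun y hy => ?_
        have hyB : |y - μ| ≤ 2 * B := by
          have := abs_sub y μ
          linarith
        have hx : |r * (y - μ)| ≤ 1 := by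
          rw [abs_mul]
          exact (mul_le_mul_of_nonneg_left hyB (abs_nonneg _)).trans hr
        have h1 := (abs_le.1 (Real.abs_exp_sub_one_sub_id_le hx)).2
        have h2 : (y - μ) ^ 2 ≤ (2 * B) ^ 2 := sq_le_sq' (abs_le.1 hyB).1 (abs_le.1 hyB).2
        have h3 : (r * (y - μ)) ^ 2 ≤ r ^ 2 * (2 * B) ^ 2 := by
          rw [mul_pow]
          exact mul_le_mul_of_nonneg_left h2 (sq_nonneg _)
        nlinarith
    _ = 4 * r ^ 2 * B ^ 2 + 1 := by
        rw [sampleAvg_affine hd hk, ← hμ]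
        ring
    _ ≤ _ := Real.add_one_le_exp _

theorem sum_range_sum_range_succ (F : ℕ → ℕ → ℝ) (k : ℕ) :
    ∑ i ∈ Finset.range k, ∑ j ∈ Finset.range (i + 1), F (i - j) j =
      ∑ m ∈ Finset.range k, ∑ j ∈ Finset.range k, if j + m < k then F m j else 0 := by
  simp only [← Finset.sum_filter, Finset.sum_sigma']
  refine Finset.sum_nbij' (fun p => ⟨p.1 - p.2, p.2⟩) (fun p => ⟨p.1 + p.2, p.2⟩) ?_ ?_ ?_ ?_ ?_
  · rintro ⟨i, j⟩ h
    simp at h ⊢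
    omega
  · rintro ⟨i, j⟩ h
    simp at h ⊢
    omega
  · rintro ⟨i, j⟩ h
    simp at h ⊢
    omega
  · rintro ⟨i, j⟩ h
    simp
  · rintro ⟨i, j⟩ h
    rfl

theorem truncation_eq (θ : ℝ) (g : V → ℝ) {k : ℕ} (hk : 0 < k) (s t : V) :
    (∑ i ∈ Finset.range k, ((lazyWalk G ^ i) g s - (lazyWalk G ^ i) g t)) / 2 =
      (∑ i ∈ Finset.range k, (large θ (level G θ g i) s - large θ (level G θ g i) t)) / 2 +
        k ^ 2 * sampleAvg G θ g k s t id := by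
  have hk' : (k : ℝ) ≠ 0 := by exact_mod_cast hk.ne'
  have h1 : ∀ i, (lazyWalk G ^ i) g s - (lazyWalk G ^ i) g t =
      (large θ (level G θ g i) s - large θ (level G θ g i) t) +
        ∑ j ∈ Finset.range (i + 1), ((lazyWalk G ^ (i - j)) (residual G θ g j) s -
          (lazyWalk G ^ (i - j)) (residual G θ g j) t) := fun i => by
    rw [lazyWalk_pow_eq θ g i, Finset.sum_sub_distrib]
    simp only [Pi.add_apply, Finset.sum_apply]
    ring
  rw [Finset.sum_congr rfl fun i _ => h1 i, Finset.sum_add_distrib, sum_range_sum_range_succ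
    fun m j => (lazyWalk G ^ m) (residual G θ g j) s - (lazyWalk G ^ m) (residual G θ g j) t,
    add_div]
  congr 1
  have h2 : ∀ m j, ((lazyWalk G ^ m) (fun v => sampleVal G θ g k m j v) s +
      (lazyWalk G ^ m) (fun v => -sampleVal G θ g k m j v) t) =
      if j + m < k then (lazyWalk G ^ m) (residual G θ g j) s -
        (lazyWalk G ^ m) (residual G θ g j) t else 0 := fun m j => by
    have e : (fun v => -sampleVal G θ g k m j v) = -sampleVal G θ g k m j := rfl
    have e' : (fun v => sampleVal G θ g k m j v) = sampleVal G θ g k m j := rfl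
    rw [e, e', map_neg, Pi.neg_apply, ← sub_eq_add_neg]
    unfold sampleVal
    split_ifs
    · rfl
    · have : (fun _ => 0 : V → ℝ) = 0 := rfl
      simp [this]
  simp only [sampleAvg, id, h2, ← Finset.sum_div]
  field_simp

end Push

/-! ### The set-up phase of the algorithm -/

/-- Two memories have the same arrays and the same registers, except possibly for the integer
registers in `I` and the real registers in `R`. -/
def Agree (I R : List ℕ) (σ σ' : Store) : Prop :=
  (∀ x, x ∉ I → σ'.ireg x = σ.ireg x) ∧ (∀ x, x ∉ R → σ'.rreg x = σ.rreg x) ∧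
    σ'.iarr = σ.iarr ∧ σ'.rarr = σ.rarr

theorem Agree.ireg {I R : List ℕ} {σ σ' : Store} (h : Agree I R σ σ') (x : ℕ) (hx : x ∉ I) :
    σ'.ireg x = σ.ireg x := h.1 x hx

theorem Agree.rreg {I R : List ℕ} {σ σ' : Store} (h : Agree I R σ σ') (x : ℕ) (hx : x ∉ R) :
    σ'.rreg x = σ.rreg x := h.2.1 x hx

theorem Agree.trans {I I' R R' : List ℕ} {σ σ' σ'' : Store} (h : Agree I R σ σ')
    (h' : Agree I' R' σ' σ'') : Agree (I ++ I') (R ++ R') σ σ'' :=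
  ⟨fun x hx => by simp at hx; rw [h'.1 x hx.2, h.1 x hx.1],
    fun x hx => by simp at hx; rw [h'.2.1 x hx.2, h.2.1 x hx.1],
    h'.2.2.1.trans h.2.2.1, h'.2.2.2.trans h.2.2.2⟩

/-- Real register 8 becomes `1 + ⌈log₂ n⌉`. -/
def logProg : Program :=
  .seq (block [.iconst 9 1, .rconst 3 1, .rconst 8 1])
    (.while (.ilt 9 0) (block [.iadd 9 9 9, .radd 8 8 3]))

/-- Real register 4 becomes `⌈√d⌉`, with `d` in real register 2. -/
def sqrtProg : Program :=
  .seq (block [.rconst 3 1, .rconst 4 0, .rconst 5 0])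
    (.while (.rlt 5 2) (block [.radd 4 4 3, .rmul 5 4 4]))

/-- Real register 6 becomes `⌈log₂ (4 / ε)⌉`. -/
def logInvProg : Program :=
  .seq (block [.rconst 3 1, .rconst 16 4, .rcopy 7 0, .rconst 6 0])
    (.while (.rlt 7 16) (block [.radd 7 7 7, .radd 6 6 3]))

/-- Integer register 5 and real register 10 become `⌈x⌉`, with `x` in real register 9. -/
def ceilProg : Program :=
  .seq (block [.rconst 3 1, .iconst 4 1, .iconst 5 0, .rconst 10 0])
    (.while (.rlt 10 9) (block [.iadd 5 5 4, .radd 10 10 3]))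

theorem degQuery_coe {n : ℕ} (G : SimpleGraph (Fin n)) [DecidableRel G.Adj] (v : Fin n) :
    degQuery G v = G.degree v := by
  simp [degQuery]

theorem neighQuery_coe {n : ℕ} (G : SimpleGraph (Fin n)) [DecidableRel G.Adj] (N : AdjLists G)
    (v : Fin n) {i : ℕ} (hi : i < G.degree v) :
    neighQuery G N v i = (N v ⟨i, hi⟩ : Fin n) := by
  simp [neighQuery, hi]

section Setup

variable {n : ℕ} {G : SimpleGraph (Fin n)} [DecidableRel G.Adj] {N : AdjLists G}

theorem sure_logProg {σ : Store} {l : ℕ} (h0 : ∀ k < l, 2 ^ k < σ.ireg 0) (h1 : σ.ireg 0 ≤ 2 ^ l) :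
    Sure G N logProg (6 * l + 20) σ fun σ' => Agree [9] [3, 8] σ σ' ∧ σ'.rreg 8 = 1 + l := by
  refine ((sure_block (Q := fun σ' => Agree [9] [3, 8] σ σ' ∧ σ'.ireg 9 = 2 ^ (l - l) ∧
    σ'.rreg 8 = 1 + l - l ∧ σ'.rreg 3 = 1 ∧ l ≤ l) rfl ?_).seq fun σ' hσ' =>
    sure_while_count (fun k σ' => Agree [9] [3, 8] σ σ' ∧ σ'.ireg 9 = 2 ^ (l - k) ∧
      σ'.rreg 8 = 1 + l - k ∧ σ'.rreg 3 = 1 ∧ k ≤ l) (t := 5) ?_ ?_ hσ').mono ?_ ?_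
  · simp +contextual [Agree, effect, Store.setI, Store.setR]
  · rintro k σ' ⟨hA, h9, h8, h3, hk⟩
    have e : l - k = l - (k + 1) + 1 := by omega
    refine ⟨?_, sure_block rfl ?_⟩
    · simp only [Test.Holds, h9, hA.ireg 0 (by decide)]
      exact h0 _ (by omega)
    · simp +contextual [Agree, effect, Store.setI, Store.setR, hA.1, hA.2.1,
        hA.2.2, h9, h8, h3]
      refine ⟨by rw [e, pow_succ]; ring, by ring, by omega⟩
  · rintro σ' ⟨hA, h9, -⟩
    simpa [Test.Holds, h9, hA.ireg 0 (by decide)] using h1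
  · simp
    omega
  · rintro σ' ⟨hA, -, h8, -⟩
    exact ⟨hA, by simpa using h8⟩

theorem sure_sqrtProg {σ : Store} {b : ℕ} (h0 : ∀ k < b, (k : ℝ) * k < σ.rreg 2)
    (h1 : σ.rreg 2 ≤ b * b) :
    Sure G N sqrtProg (6 * b + 20) σ fun σ' => Agree [] [3, 4, 5] σ σ' ∧ σ'.rreg 4 = b := by
  refine ((sure_block (Q := fun σ' => Agree [] [3, 4, 5] σ σ' ∧ σ'.rreg 5 = (b - b) * (b - b) ∧
    σ'.rreg 4 = b - b ∧ σ'.rreg 3 = 1 ∧ b ≤ b) rfl ?_).seq fun σ' hσ' =>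
    sure_while_count (fun k σ' => Agree [] [3, 4, 5] σ σ' ∧ σ'.rreg 5 = (b - k) * (b - k) ∧
      σ'.rreg 4 = b - k ∧ σ'.rreg 3 = 1 ∧ k ≤ b) (t := 5) ?_ ?_ hσ').mono ?_ ?_
  · simp +contextual [Agree, effect, Store.setI, Store.setR]
  · rintro k σ' ⟨hA, h5, h4, h3, hk⟩
    refine ⟨?_, sure_block rfl ?_⟩
    · have := h0 (b - (k + 1)) (by omega)
      rw [Nat.cast_sub hk] at this
      simpa only [Test.Holds, h5, hA.rreg 2 (by decide)] using this
    · simp +contextual [Agree, effect, Store.setI, Store.setR, hA.1, hA.2.1,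
        hA.2.2, h5, h4, h3]
      refine ⟨by ring, by ring, by omega⟩
  · rintro σ' ⟨hA, h5, -⟩
    simpa [Test.Holds, h5, hA.rreg 2 (by decide)] using h1
  · simp
    omega
  · rintro σ' ⟨hA, -, h4, -⟩
    exact ⟨hA, by simpa using h4⟩

theorem sure_logInvProg {σ : Store} {e : ℕ} (h0 : ∀ k < e, σ.rreg 0 * 2 ^ k < 4)
    (h1 : 4 ≤ σ.rreg 0 * 2 ^ e) :
    Sure G N logInvProg (6 * e + 20) σ fun σ' => Agree [] [3, 6, 7, 16] σ σ' ∧ σ'.rreg 6 = e := by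
  refine ((sure_block (Q := fun σ' => Agree [] [3, 6, 7, 16] σ σ' ∧
    σ'.rreg 7 = σ.rreg 0 * 2 ^ (e - e) ∧
    σ'.rreg 6 = e - e ∧ σ'.rreg 3 = 1 ∧ σ'.rreg 16 = 4 ∧ e ≤ e) rfl ?_).seq fun σ' hσ' =>
    sure_while_count (fun k σ' => Agree [] [3, 6, 7, 16] σ σ' ∧
      σ'.rreg 7 = σ.rreg 0 * 2 ^ (e - k) ∧
      σ'.rreg 6 = e - k ∧ σ'.rreg 3 = 1 ∧ σ'.rreg 16 = 4 ∧ k ≤ e) (t := 5) ?_ ?_ hσ').mono ?_ ?_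
  · simp +contextual [Agree, effect, Store.setI, Store.setR]
  · rintro k σ' ⟨hA, h7, h6, h3, h16, hk⟩
    have e' : e - k = e - (k + 1) + 1 := by omega
    refine ⟨?_, sure_block rfl ?_⟩
    · simp only [Test.Holds, h7, h16]
      exact h0 _ (by omega)
    · simp +contextual [Agree, effect, Store.setI, Store.setR, hA.1, hA.2.1,
        hA.2.2, h7, h6, h3, h16]
      refine ⟨by rw [e', pow_succ]; ring, by ring, by omega⟩
  · rintro σ' ⟨hA, h7, -, -, h16, -⟩
    simpa [Test.Holds, h7, h16] using h1
  · simp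
    omega
  · rintro σ' ⟨hA, -, h6, -⟩
    exact ⟨hA, by simpa using h6⟩

theorem sure_ceilProg {σ : Store} {k : ℕ} (h : k = ⌈σ.rreg 9⌉₊) :
    Sure G N ceilProg (6 * k + 20) σ fun σ' =>
      Agree [4, 5] [3, 10] σ σ' ∧ σ'.ireg 4 = 1 ∧ σ'.ireg 5 = k ∧ σ'.rreg 10 = k ∧
        σ'.rreg 3 = 1 := by
  refine ((sure_block (Q := fun σ' => Agree [4, 5] [3, 10] σ σ' ∧ σ'.ireg 5 = k - k ∧
    σ'.rreg 10 = k - k ∧ σ'.rreg 3 = 1 ∧ σ'.ireg 4 = 1 ∧ k ≤ k) rfl ?_).seq fun σ' hσ' =>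
    sure_while_count (fun i σ' => Agree [4, 5] [3, 10] σ σ' ∧ σ'.ireg 5 = k - i ∧
      σ'.rreg 10 = k - i ∧ σ'.rreg 3 = 1 ∧ σ'.ireg 4 = 1 ∧ i ≤ k) (t := 5) ?_ ?_ hσ').mono ?_ ?_
  · simp +contextual [Agree, effect, Store.setI, Store.setR]
  · rintro i σ' ⟨hA, h5, h10, h3, h4, hi⟩
    refine ⟨?_, sure_block rfl ?_⟩
    · have h1 : k - (i + 1) < ⌈σ.rreg 9⌉₊ := by omega
      have := Nat.lt_ceil.1 h1
      rw [Nat.cast_sub hi] at this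
      simpa only [Test.Holds, h10, hA.rreg 9 (by decide)] using this
    · simp +contextual [Agree, effect, Store.setI, Store.setR, hA.1, hA.2.1,
        hA.2.2, h5, h10, h3, h4]
      refine ⟨by omega, by ring, by omega⟩
  · rintro σ' ⟨hA, -, h10, -⟩
    simp only [Test.Holds, h10, hA.rreg 9 (by decide), Nat.cast_zero, sub_zero, not_lt, h]
    exact Nat.le_ceil _
  · simp
    omega
  · rintro σ' ⟨hA, h5, h10, h3, h4, -⟩
    exact ⟨hA, h4, by simpa using h5, by simpa using h10, h3⟩

end Setup

/-- The computation of the truncation length `k`, the threshold `θ` for pushing, and the number of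
samples from the smaller degree, in real register 2; the constant `a` determines the probability of
failure. -/
def paramProg (a : ℕ) : Program :=
  .seq sqrtProg (.seq logInvProg (.seq logProg (.seq (block [.rconst 17 2, .rmul 9 1 6, .rmul 9 9 17])
    (.seq ceilProg (block [.rmul 18 10 10, .rmul 18 18 4, .rdiv 11 0 18, .rmul 25 11 11,
      .rconst 19 a, .rmul 19 19 8, .rmul 19 19 18, .rdiv 12 19 0])))))

/-- The set-up phase: degree queries and the choice of the parameters. -/
def setupProg (a : ℕ) : Program :=
  .seq (block [.iconst 3 0, .deg 7 1, .deg 8 2])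
    (.seq (.ite (.ile 7 8) (block [.icopy 6 7]) (block [.icopy 6 8]))
      (.seq (block [.rofint 2 6]) (paramProg a)))

/-- The registers that stay constant after the set-up phase. -/
def Consts (n s t k : ℕ) (θ x : ℝ) (σ : Store) : Prop :=
  σ.ireg 0 = n ∧ σ.ireg 1 = s ∧ σ.ireg 2 = t ∧ σ.ireg 3 = 0 ∧ σ.ireg 4 = 1 ∧ σ.ireg 5 = k ∧
    σ.rreg 3 = 1 ∧ σ.rreg 10 = k ∧ σ.rreg 12 = x ∧ σ.rreg 17 = 2 ∧ σ.rreg 25 = θ * θ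

theorem sure_paramProg {n : ℕ} {G : SimpleGraph (Fin n)} [DecidableRel G.Adj] {N : AdjLists G}
    (a : ℕ) {σ : Store} {s t : Fin n} {b e l k : ℕ} (hn : σ.ireg 0 = n) (hs : σ.ireg 1 = s)
    (ht : σ.ireg 2 = t) (hb0 : ∀ i < b, i * i < min (G.degree s) (G.degree t))
    (hb1 : min (G.degree s) (G.degree t) ≤ b * b)
    (he0 : ∀ i < e, σ.rreg 0 * 2 ^ i < 4) (he1 : 4 ≤ σ.rreg 0 * 2 ^ e)
    (hl0 : ∀ i < l, 2 ^ i < n) (hl1 : n ≤ 2 ^ l) (hk : k = ⌈σ.rreg 1 * e * 2⌉₊) {σ₀ : Store}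
    (hσ₀ : Agree [3, 7, 8, 6] [2] σ σ₀ ∧ σ₀.ireg 3 = 0 ∧ σ₀.ireg 7 = G.degree s ∧
      σ₀.ireg 8 = G.degree t ∧ σ₀.rreg 2 = (min (G.degree s) (G.degree t) : ℕ)) :
    Sure G N (paramProg a) (6 * (b + e + l + k) + 150) σ₀ fun σ' =>
      Consts n s t k (σ.rreg 0 / (k * k * b)) (a * (1 + l) * (k * k * b) / σ.rreg 0) σ' ∧
        σ'.ireg 7 = G.degree s ∧ σ'.ireg 8 = G.degree t ∧
        σ'.iarr = σ.iarr ∧ σ'.rarr = σ.rarr := by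
  obtain ⟨hA₀, h3, h7, h8, h2⟩ := hσ₀
  refine Sure.mono ((sure_sqrtProg (b := b) ?_ ?_).seq fun σ₁ h₁ =>
    (sure_logInvProg (e := e) ?_ ?_).seq fun σ₂ h₂ => 
    (sure_logProg (l := l) ?_ ?_).seq fun σ₃ h₃ =>
    (sure_block (Q := fun σ₄ => Agree [] [9, 17] σ₃ σ₄ ∧ σ₄.rreg 17 = 2 ∧
      σ₄.rreg 9 = σ.rreg 1 * e * 2) rfl ?_).seq fun σ₄ h₄ =>
    (sure_ceilProg (k := k) ?_).seq fun σ₅ h₅ =>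
    sure_block (Q := fun σ' =>
      Consts n s t k (σ.rreg 0 / (k * k * b)) (a * (1 + l) * (k * k * b) / σ.rreg 0) σ' ∧
      σ'.ireg 7 = G.degree s ∧ σ'.ireg 8 = G.degree t ∧
      σ'.iarr = σ.iarr ∧ σ'.rarr = σ.rarr) rfl ?_) ?_ fun _ h => h
  · intro i hi
    rw [h2]
    exact_mod_cast hb0 i hi
  · rw [h2]
    exact_mod_cast hb1
  · rwa [h₁.1.rreg 0 (by decide), hA₀.rreg 0 (by decide)]
  · rwa [h₁.1.rreg 0 (by decide), hA₀.rreg 0 (by decide)]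
  · rwa [h₂.1.ireg 0 (by decide), h₁.1.ireg 0 (by decide), hA₀.ireg 0 (by decide), hn]
  · rwa [h₂.1.ireg 0 (by decide), h₁.1.ireg 0 (by decide), hA₀.ireg 0 (by decide), hn]
  · have e1 := ((hA₀.trans h₁.1).trans (h₂.1.trans h₃.1)).rreg 1 (by decide)
    have e6 := h₃.1.rreg 6 (by decide)
    rw [h₂.2] at e6
    simp +contextual [Agree, effect, Store.setI, Store.setR, e1, e6]
  · rw [h₄.2.2, hk]
  · have hA := (((hA₀.trans h₁.1).trans (h₂.1.trans h₃.1)).trans h₄.1).trans h₅.1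
    have hA1 := ((h₁.1.trans (h₂.1.trans h₃.1)).trans h₄.1).trans h₅.1
    have hA2 := (h₂.1.trans (h₃.1.trans h₄.1)).trans h₅.1
    have hA4 := h₄.1.trans h₅.1
    have i0 := hA.ireg 0 (by decide)
    have i1 := hA.ireg 1 (by decide)
    have i2 := hA.ireg 2 (by decide)
    have i3 := hA1.ireg 3 (by decide)
    have i7 := hA1.ireg 7 (by decide)
    have i8 := hA1.ireg 8 (by decide)
    have r0 := hA.rreg 0 (by decide)
    have r4 := hA2.rreg 4 (by decide)
    have r8 := hA4.rreg 8 (by decide)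
    have r17 := h₅.1.rreg 17 (by decide)
    have r3 : σ₅.rreg 3 = 1 := h₅.2.2.2.2
    simp [effect, Store.setI, Store.setR, Consts, hA.2.2, i0, i1, i2, i3, i7, i8, r0, r4, r8,
      r17, r3, h₁.2, h₃.2, h₅.2, h₄.2, hn, hs, ht, h3, h7, h8]
  · simp
    omega

theorem sure_setupProg {n : ℕ} {G : SimpleGraph (Fin n)} [DecidableRel G.Adj] {N : AdjLists G}
    (a : ℕ) {σ : Store} {s t : Fin n} {b e l k : ℕ} (hn : σ.ireg 0 = n) (hs : σ.ireg 1 = s)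
    (ht : σ.ireg 2 = t) (hb0 : ∀ i < b, i * i < min (G.degree s) (G.degree t))
    (hb1 : min (G.degree s) (G.degree t) ≤ b * b)
    (he0 : ∀ i < e, σ.rreg 0 * 2 ^ i < 4) (he1 : 4 ≤ σ.rreg 0 * 2 ^ e)
    (hl0 : ∀ i < l, 2 ^ i < n) (hl1 : n ≤ 2 ^ l) (hk : k = ⌈σ.rreg 1 * e * 2⌉₊) :
    Sure G N (setupProg a) (6 * (b + e + l + k) + 200) σ fun σ' =>
      Consts n s t k (σ.rreg 0 / (k * k * b)) (a * (1 + l) * (k * k * b) / σ.rreg 0) σ' ∧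
        σ'.ireg 7 = G.degree s ∧ σ'.ireg 8 = G.degree t ∧
        σ'.iarr = σ.iarr ∧ σ'.rarr = σ.rarr := by
  refine Sure.mono ((sure_block (Q := fun σ' => Agree [3, 7, 8] [] σ σ' ∧ σ'.ireg 3 = 0 ∧
    σ'.ireg 7 = G.degree s ∧ σ'.ireg 8 = G.degree t) rfl ?_).seq fun σ₁ h₁ =>
    (sure_ite (Q := fun σ' => Agree [3, 7, 8, 6] [] σ σ' ∧ σ'.ireg 3 = 0 ∧
      σ'.ireg 7 = G.degree s ∧ σ'.ireg 8 = G.degree t ∧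
      σ'.ireg 6 = min (G.degree s) (G.degree t)) (t := 3)
      (fun hb => sure_block (l := [.icopy 6 7]) rfl ?_)
      fun hb => sure_block (l := [.icopy 6 8]) rfl ?_).seq fun σ₂ h₂ =>
    (sure_block (Q := fun σ' => Agree [3, 7, 8, 6] [2] σ σ' ∧ σ'.ireg 3 = 0 ∧
      σ'.ireg 7 = G.degree s ∧ σ'.ireg 8 = G.degree t ∧
      σ'.rreg 2 = (min (G.degree s) (G.degree t) : ℕ)) rfl ?_).seq fun σ' hσ' =>
      sure_paramProg a hn hs ht hb0 hb1 he0 he1 hl0 hl1 hk hσ') ?_ fun _ h => h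
  · simp +contextual [Agree, effect, Store.setI, hs, ht, degQuery_coe]
  · obtain ⟨hA, h3, h7, h8⟩ := h₁
    simp only [Test.Holds, h7, h8] at hb
    simp +contextual [Agree, effect, Store.setI, hA.1, hA.2, h3, h7, h8, hb]
  · obtain ⟨hA, h3, h7, h8⟩ := h₁
    simp only [Test.Holds, h7, h8, not_le] at hb
    simp +contextual [Agree, effect, Store.setI, hA.1, hA.2, h3, h7, h8, hb.le]
  · obtain ⟨hA, h3, h7, h8, h6⟩ := h₂
    simp +contextual [Agree, effect, Store.setR, hA.1, hA.2.1, hA.2.2, h3, h7, h8, h6]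
  · simp
    omega

/-! ### The push phase of the algorithm -/

/-- Two memories have the same registers, except possibly for the integer registers in `I` and the
real registers in `R`. -/
def RegAgree (I R : List ℕ) (σ σ' : Store) : Prop :=
  (∀ x, x ∉ I → σ'.ireg x = σ.ireg x) ∧ (∀ x, x ∉ R → σ'.rreg x = σ.rreg x)

theorem RegAgree.ireg {I R : List ℕ} {σ σ' : Store} (h : RegAgree I R σ σ') (x : ℕ)
    (hx : x ∉ I) : σ'.ireg x = σ.ireg x := h.1 x hx

theorem RegAgree.rreg {I R : List ℕ} {σ σ' : Store} (h : RegAgree I R σ σ') (x : ℕ)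
    (hx : x ∉ R) : σ'.rreg x = σ.rreg x := h.2 x hx

theorem RegAgree.trans {I I' R R' : List ℕ} {σ σ' σ'' : Store} (h : RegAgree I R σ σ')
    (h' : RegAgree I' R' σ' σ'') : RegAgree (I ++ I') (R ++ R') σ σ'' :=
  ⟨fun x hx => by simp at hx; rw [h'.1 x hx.2, h.1 x hx.1],
    fun x hx => by simp at hx; rw [h'.2 x hx.2, h.2 x hx.1]⟩

/-- A real array seen as a sequence of functions on the vertices. -/
def view {n : ℕ} (a : ℕ) (σ : Store) (i : ℕ) (v : Fin n) : ℝ := σ.rarr a (i * n + v)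

theorem index_eq_iff {n : ℕ} {i j : ℕ} {v w : Fin n} :
    i * n + (v : ℕ) = j * n + w ↔ i = j ∧ v = w := by
  refine ⟨fun h => ?_, by rintro ⟨rfl, rfl⟩; rfl⟩
  have hn : 0 < n := v.pos
  have h1 : ∀ (i : ℕ) (v : Fin n), (i * n + v) / n = i := fun i v => by
    rw [mul_comm, Nat.mul_add_div hn, Nat.div_eq_of_lt v.2, add_zero]
  have h2 : i = j := by rw [← h1 i v, h, h1]
  subst h2
  exact ⟨rfl, Fin.ext (by omega)⟩

/-- Distribute the value in real register 23 over the neighbors of a vertex. -/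
def spreadProg : Program :=
  .while (.ilt 20 19) (block [.neigh 21 16 20, .deg 22 21, .rofint 26 22, .rdiv 26 23 26,
    .iadd 18 14 21, .rload 24 0 18, .radd 24 24 26, .rstore 0 18 24, .istore 0 11 21,
    .iadd 11 11 4, .iadd 20 20 4])

section PushPhase

variable {n : ℕ} {G : SimpleGraph (Fin n)} [DecidableRel G.Adj] {N : AdjLists G}

theorem sum_adjLists (u v : Fin n) (c : ℝ) :
    ∑ q : Fin (G.degree u), (if (N u q : Fin n) = v then c else 0) =
      if G.Adj u v then c else 0 := by
  rw [Fintype.sum_equiv (N u) _ (fun w : G.neighborSet u => if (w : Fin n) = v then c else 0)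
    fun _ => rfl]
  split_ifs with h
  · rw [Finset.sum_eq_single_of_mem ⟨v, h⟩ (Finset.mem_univ _)]
    · simp
    · intro w _ hw
      exact if_neg fun h' => hw (Subtype.ext h')
  · refine Finset.sum_eq_zero fun w _ => if_neg ?_
    rintro rfl
    exact h w.2

theorem sure_spreadProg {σ : Store} {u : Fin n} {j : ℕ} (h4 : σ.ireg 4 = 1)
    (h14 : σ.ireg 14 = j * n) (h16 : σ.ireg 16 = u) (h19 : σ.ireg 19 = G.degree u)
    (h20 : σ.ireg 20 = 0) :
    Sure G N spreadProg (24 * G.degree u + 1) σ fun σ' =>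
      RegAgree [11, 18, 20, 21, 22] [24, 26] σ σ' ∧ (∀ a ≠ 0, σ'.iarr a = σ.iarr a) ∧
        (∀ a ≠ 0, σ'.rarr a = σ.rarr a) ∧ σ'.ireg 11 = σ.ireg 11 + G.degree u ∧
        (∀ i v, view 0 σ' i v = view 0 σ i v +
          if i = j ∧ G.Adj u v then σ.rreg 23 / G.degree v else 0) ∧
        (∀ q < σ.ireg 11, σ'.iarr 0 q = σ.iarr 0 q) ∧
        (∀ q, σ.ireg 11 ≤ q → q < σ'.ireg 11 → σ'.iarr 0 q < n) ∧
        ∀ v, G.Adj u v → ∃ q, σ.ireg 11 ≤ q ∧ q < σ'.ireg 11 ∧ σ'.iarr 0 q = v := by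
  set I : ℕ → Store → Prop := fun k σ' => k ≤ G.degree u ∧
    RegAgree [11, 18, 20, 21, 22] [24, 26] σ σ' ∧
    (∀ a, a ≠ 0 → σ'.iarr a = σ.iarr a) ∧ (∀ a, a ≠ 0 → σ'.rarr a = σ.rarr a) ∧
    σ'.ireg 20 = G.degree u - k ∧ σ'.ireg 11 = σ.ireg 11 + (G.degree u - k) ∧
    (∀ i (v : Fin n), view 0 σ' i v = view 0 σ i v + ∑ q : Fin (G.degree u),
      if i = j ∧ (q : ℕ) < G.degree u - k ∧ (N u q : Fin n) = v then
        σ.rreg 23 / G.degree v else 0) ∧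
    (∀ q < σ.ireg 11, σ'.iarr 0 q = σ.iarr 0 q) ∧
    (∀ q : Fin (G.degree u), (q : ℕ) < G.degree u - k →
      σ'.iarr 0 (σ.ireg 11 + q) = (N u q : Fin n)) with hI
  refine (sure_while_count (b := .ilt 20 19) I (t := 23) (k := G.degree u) ?_ ?_ ?_).mono ?_ ?_
  · rintro k σ' ⟨hk, hR, hia, hra, h20', h11', hv, hq, hq'⟩
    have hlt : G.degree u - (k + 1) < G.degree u := by omega
    have e4 := hR.ireg 4 (by decide)
    have e14 := hR.ireg 14 (by decide)
    have e16 := hR.ireg 16 (by decide)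
    have e19 := hR.ireg 19 (by decide)
    have e23 := hR.rreg 23 (by decide)
    refine ⟨by simpa [Test.Holds, h20', e19, h19] using hlt, sure_block rfl ?_⟩
    set w : Fin n := (N u ⟨_, hlt⟩ : Fin n) with hw
    have hN : neighQuery G N u (G.degree u - (k + 1)) = w := neighQuery_coe G N u hlt
    simp +contextual [hI, RegAgree, effect, Store.setI, Store.setR, Store.setRArr, Store.setIArr,
      e4, e14, e16, e23, h4, h14, h16, h20', h11', hN, degQuery_coe, hR.1, hR.2, hia, hra]
    refine ⟨by omega, by omega, by omega, fun i v => ?_, fun q hq₁ => ?_, fun q hq₁ => ?_⟩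
    · have e : ∀ q : Fin (G.degree u),
          (if i = j ∧ (q : ℕ) < G.degree u - k ∧ (N u q : Fin n) = v then
            σ.rreg 23 / G.degree v else 0) =
          (if i = j ∧ (q : ℕ) < G.degree u - (k + 1) ∧ (N u q : Fin n) = v then
            σ.rreg 23 / G.degree v else 0) +
          if q = ⟨_, hlt⟩ then (if i = j ∧ v = w then σ.rreg 23 / G.degree w else 0) else 0 := by
        intro q
        by_cases hqe : q = ⟨_, hlt⟩
        · subst hqe
          rw [← hw]
          have h1 : G.degree u - (k + 1) < G.degree u - k := by omega
          by_cases hvw : v = w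
          · rw [hvw]
            simp [h1]
          · simp [hvw, Ne.symm hvw]
        · have h1 : (q : ℕ) < G.degree u - k ↔ (q : ℕ) < G.degree u - (k + 1) := by
            have : (q : ℕ) ≠ G.degree u - (k + 1) := fun h => hqe (Fin.ext h)
            omega
          simp [hqe, h1]
      rw [Finset.sum_congr rfl fun q _ => e q, Finset.sum_add_distrib, Finset.sum_ite_eq',
        if_pos (Finset.mem_univ _), ← add_assoc, ← hv]
      simp only [view, Function.update_self, Function.update_apply, index_eq_iff]
      by_cases h : i = j ∧ v = w
      · obtain ⟨rfl, rfl⟩ := h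
        simp
      · simp [h]
    · rw [Function.update_of_ne (by omega), hq q hq₁]
    · by_cases hqe : q = ⟨_, hlt⟩
      · subst hqe
        simp [hw]
      · have : (q : ℕ) ≠ G.degree u - (k + 1) := fun h => hqe (Fin.ext h)
        rw [Function.update_of_ne (by omega), hq' q (by omega)]
  · rintro σ' ⟨-, hR, -, -, h20', -⟩
    simp [Test.Holds, h20', hR.ireg 19 (by decide), h19]
  · refine ⟨le_rfl, ⟨fun _ _ => rfl, fun _ _ => rfl⟩, fun _ _ => rfl, fun _ _ => rfl, by simp [h20],
      by simp, by simp, fun _ _ => rfl, by simp⟩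
  · omega
  · rintro σ' ⟨-, hR, hia, hra, h20', h11', hv, hq, hq'⟩
    simp only [Nat.sub_zero] at *
    refine ⟨hR, hia, hra, h11', fun i v => ?_, hq, fun q h1 h2 => ?_, fun v hv => ?_⟩
    · rw [hv, ite_and, ← sum_adjLists (N := N)]
      by_cases h : i = j <;> simp [h]
    · have := hq' ⟨q - σ.ireg 11, by omega⟩ (by simp; omega)
      simp only [Nat.add_sub_cancel' h1] at this
      rw [this]
      exact Fin.is_lt _
    · have := hq' ((N u).symm ⟨v, hv⟩) (Fin.is_lt _)
      exact ⟨_, Nat.le_add_right _ ((N u).symm ⟨v, hv⟩), by omega, by simpa using this⟩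

theorem lazyWalk_single (u v : Fin n) (x : ℝ) : lazyWalk G (Pi.single u x) v =
    (if v = u then x / 2 else 0) + if G.Adj u v then x / 2 / G.degree v else 0 := by
  rw [lazyWalk_apply]
  simp only [Pi.single_apply, Finset.sum_ite_eq', SimpleGraph.mem_neighborFinset, G.adj_comm v u]
  split_ifs <;> simp <;> ring

end PushPhase

/-- Move the value at a vertex, which is also in real register 23, to the array of the large values,
and apply the lazy random walk to it. -/
def pushProg : Program :=
  .seq (block [.rstore 1 17 23, .rconst 24 0, .rstore 0 17 24, .rdiv 23 23 17, .iadd 18 14 16,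
    .rload 24 0 18, .radd 24 24 23, .rstore 0 18 24, .istore 0 11 16, .iadd 11 11 4, .deg 19 16,
    .iconst 20 0]) spreadProg

section PushPhase

variable {n : ℕ} {G : SimpleGraph (Fin n)} [DecidableRel G.Adj] {N : AdjLists G}

theorem sure_pushProg {σ : Store} {u : Fin n} {j : ℕ} {x : ℝ} (h4 : σ.ireg 4 = 1)
    (h14 : σ.ireg 14 = (j + 1) * n) (h16 : σ.ireg 16 = u) (h17 : σ.ireg 17 = j * n + u)
    (hr17 : σ.rreg 17 = 2) (hr23 : σ.rreg 23 = x) :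
    Sure G N pushProg (24 * G.degree u + 30) σ fun σ' =>
      RegAgree [11, 18, 19, 20, 21, 22] [23, 24, 26] σ σ' ∧ (∀ a ≠ 0, σ'.iarr a = σ.iarr a) ∧
        σ'.ireg 11 = σ.ireg 11 + (G.degree u + 1) ∧
        (∀ i v, view 1 σ' i v = if i = j ∧ v = u then x else view 1 σ i v) ∧
        (∀ i v, view 0 σ' i v = if i = j ∧ v = u then 0 else view 0 σ i v +
          if i = j + 1 then lazyWalk G (Pi.single u x) v else 0) ∧
        (∀ q < σ.ireg 11, σ'.iarr 0 q = σ.iarr 0 q) ∧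
        (∀ q, σ.ireg 11 ≤ q → q < σ'.ireg 11 → σ'.iarr 0 q < n) ∧
        ∀ v, lazyWalk G (Pi.single u x) v ≠ 0 →
          ∃ q, σ.ireg 11 ≤ q ∧ q < σ'.ireg 11 ∧ σ'.iarr 0 q = v := by
  refine Sure.mono ((sure_block (Q := fun σ' => RegAgree [11, 18, 19, 20] [23, 24] σ σ' ∧
    σ'.ireg 11 = σ.ireg 11 + 1 ∧ σ'.ireg 19 = G.degree u ∧ σ'.ireg 20 = 0 ∧ σ'.rreg 23 = x / 2 ∧
    (∀ a ≠ 0, σ'.iarr a = σ.iarr a) ∧ (∀ q < σ.ireg 11, σ'.iarr 0 q = σ.iarr 0 q) ∧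
    σ'.iarr 0 (σ.ireg 11) = u ∧
    (∀ i (v : Fin n), view 1 σ' i v = if i = j ∧ v = u then x else view 1 σ i v) ∧
    (∀ i (v : Fin n), view 0 σ' i v = if i = j ∧ v = u then 0 else view 0 σ i v +
          if i = j + 1 ∧ v = u then x / 2 else 0)) rfl ?_).seq fun σ₁ h₁ =>
    (sure_spreadProg (u := u) (j := j + 1) ?_ ?_ ?_ ?_ ?_).mono le_rfl ?_) ?_ fun _ h => h
  · simp +contextual [RegAgree, effect, Store.setI, Store.setR, Store.setRArr, Store.setIArr,
      h4, h14, h16, h17, hr17, hr23, degQuery_coe, view]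
    refine ⟨fun q hq => Function.update_of_ne hq.ne _ _, fun i v => ?_, fun i v => ?_⟩
    · rw [Function.update_apply]
      simp only [index_eq_iff]
    · simp only [Function.update_apply, index_eq_iff]
      by_cases h : i = j + 1 ∧ v = u
      · obtain ⟨rfl, rfl⟩ := h
        simp
      · simp [h]
  · rw [h₁.1.ireg 4 (by decide), h4]
  · rw [h₁.1.ireg 14 (by decide), h14]
  · rw [h₁.1.ireg 16 (by decide), h16]
  · exact h₁.2.2.1
  · exact h₁.2.2.2.1
  · obtain ⟨hR, h11, -, -, h23, hia, hq, hqu, hv1, hv0⟩ := h₁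
    rintro σ' ⟨hR', hia', hra', h11', hv', hq', hn', hc'⟩
    have hdeg : σ'.ireg 11 = σ.ireg 11 + (G.degree u + 1) := by omega
    refine ⟨?_, fun a ha => (hia' a ha).trans (hia a ha), hdeg,
      fun i v => ?_, fun i v => ?_, fun q hq₁ => ?_, fun q h1 h2 => ?_, fun v hv => ?_⟩
    · have := hR.trans hR'
      exact ⟨fun x hx => this.1 x fun h => hx (by simp at h ⊢; omega),
        fun x hx => this.2 x fun h => hx (by simp at h ⊢; omega)⟩
    · rw [← hv1, view, view, hra' 1 one_ne_zero]
    · rw [hv', hv0, h23, lazyWalk_single]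
      by_cases hi : i = j + 1
      · simp [hi, add_assoc]
      · simp [hi]
    · rw [hq' q (by omega), hq q hq₁]
    · rcases h1.eq_or_lt with rfl | h1
      · rw [hq' _ (by omega), hqu]
        exact u.2
      · exact hn' q (by omega) h2
    · rw [lazyWalk_single] at hv
      by_cases hvu : v = u
      · exact ⟨σ.ireg 11, le_rfl, by omega, by rw [hq' _ (by omega), hqu, hvu]⟩
      · by_cases hadj : G.Adj u v
        · obtain ⟨q, h1, h2, h3⟩ := hc' v hadj
          exact ⟨q, by omega, h2, h3⟩
        · simp [hvu, hadj] at hv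
  · simp
    omega

end PushPhase

/-- Process the next entry of the queue. -/
def scanBody : Program :=
  .seq (block [.iload 16 0 10, .iadd 10 10 4, .iadd 17 12 16, .rload 23 0 17, .rmul 24 23 23])
    (.ite (.rlt 25 24) pushProg .skip)

section ScanPhase

variable {n : ℕ} (G : SimpleGraph (Fin n)) [DecidableRel G.Adj]

/-- The restriction of a function to a set. -/
def restrict (S : Finset (Fin n)) (f : Fin n → ℝ) (v : Fin n) : ℝ := if v ∈ S then f v else 0

theorem large_level_eq_restrict (θ : ℝ) (g : Fin n → ℝ) (j : ℕ) :
    large θ (level G θ g j) = restrict (bigSet G θ g j) (level G θ g j) := by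
  ext v
  simp [large, restrict, bigSet]

theorem restrict_insert {S : Finset (Fin n)} {u : Fin n} (hu : u ∉ S) (f : Fin n → ℝ) :
    restrict (insert u S) f = restrict S f + Pi.single u (f u) := by
  ext v
  by_cases hv : v = u
  · subst hv
    simp [restrict, hu]
  · simp [restrict, hv]

/-- The registers during the processing of a level. -/
def ScanRegs (s t : Fin n) (k : ℕ) (θ x acc : ℝ) (j fin : ℕ) (σ : Store) : Prop :=
  Consts n s t k θ x σ ∧ σ.ireg 12 = j * n ∧ σ.ireg 13 = j ∧ σ.ireg 14 = (j + 1) * n ∧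
    σ.ireg 15 = fin ∧ σ.rreg 13 = acc

/-- The arrays while level `j` is being processed and the vertices in `S` have been pushed; the
queue of this level ends before index `fin`. -/
structure ScanState (θ : ℝ) (g : Fin n → ℝ) (j fin : ℕ) (S : Finset (Fin n)) (σ : Store) :
    Prop where
  subset : S ⊆ bigSet G θ g j
  view_zero : ∀ i v, view 0 σ i v = if i < j then residual G θ g i v else
    if i = j then (if v ∈ S then 0 else level G θ g j v) else
    if i = j + 1 then lazyWalk G (restrict S (level G θ g j)) v else 0
  view_one : ∀ i v, j ≤ i → view 1 σ i v = if i = j ∧ v ∈ S then level G θ g j v else 0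
  base : ∀ i ≤ j, σ.iarr 1 i = i * n
  le_fin : σ.ireg 10 ≤ fin
  cover : ∀ u ∈ bigSet G θ g j, u ∉ S → ∃ q, σ.ireg 10 ≤ q ∧ q < fin ∧ σ.iarr 0 q = u
  tail : σ.ireg 11 = fin + ∑ u ∈ S, (G.degree u + 1)
  lt : ∀ q, σ.ireg 10 ≤ q → q < σ.ireg 11 → σ.iarr 0 q < n
  next : ∀ v, lazyWalk G (restrict S (level G θ g j)) v ≠ 0 →
    ∃ q, fin ≤ q ∧ q < σ.ireg 11 ∧ σ.iarr 0 q = v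

variable {G} {N : AdjLists G}

theorem RegAgree.scanRegs {I R : List ℕ} {σ σ' : Store} (h : RegAgree I R σ σ')
    {s t : Fin n} {k : ℕ} {θ x acc : ℝ} {j fin : ℕ}
    (hI : ∀ x ∈ I, x ∉ [0, 1, 2, 3, 4, 5, 12, 13, 14, 15])
    (hR : ∀ x ∈ R, x ∉ [3, 10, 12, 17, 25, 13])
    (hσ : ScanRegs s t k θ x acc j fin σ) : ScanRegs s t k θ x acc j fin σ' := by
  have h1 : ∀ x ∈ [0, 1, 2, 3, 4, 5, 12, 13, 14, 15], σ'.ireg x = σ.ireg x :=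
    fun x hx => h.1 x fun hx' => hI x hx' hx
  have h2 : ∀ x ∈ [3, 10, 12, 17, 25, 13], σ'.rreg x = σ.rreg x :=
    fun x hx => h.2 x fun hx' => hR x hx' hx
  simp only [List.mem_cons, forall_eq_or_imp, List.not_mem_nil, false_implies, forall_const] at h1 h2
  simpa only [ScanRegs, Consts, h1, h2] using hσ

theorem sure_scan {s t : Fin n} {k : ℕ} {θ x acc : ℝ} (hθ : 0 ≤ θ) {g : Fin n → ℝ} {j fin : ℕ}
    {σ : Store} (hσ : ScanRegs s t k θ x acc j fin σ) (hS : ScanState G θ g j fin ∅ σ) :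
    Sure G N (.while (.ilt 10 15) scanBody)
      (20 * (fin - σ.ireg 10) + 60 * (∑ u ∈ bigSet G θ g j, (G.degree u + 1)) + 1) σ fun σ' =>
      ScanRegs s t k θ x acc j fin σ' ∧ ScanState G θ g j fin (bigSet G θ g j) σ' ∧
        σ'.ireg 10 = fin := by
  refine sure_while (fun T σ' => ∃ S, ScanRegs s t k θ x acc j fin σ' ∧ ScanState G θ g j fin S σ' ∧
    T = 20 * (fin - σ'.ireg 10) + 60 * (∑ u ∈ bigSet G θ g j \ S, (G.degree u + 1)) + 1) ?_ ?_
    ⟨∅, hσ, hS, by simp⟩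
  · rintro T σ ⟨S, hσ, hS, rfl⟩ hb
    obtain ⟨⟨c0, c1, c2, c3, c4, c5, cr3, cr10, cr12, cr17, cr25⟩, h12, h13, h14, h15, h13'⟩ := id hσ
    simp only [Test.Holds, h15] at hb
    have htail := hS.tail
    set u : Fin n := ⟨_, hS.lt _ le_rfl (by omega)⟩ with hu
    have hread : σ.iarr 0 (σ.ireg 10) = u := rfl
    set y := view 0 σ j u with hy
    have hy' : y = if u ∈ S then 0 else level G θ g j u := by simp [hy, hS.view_zero]
    have hblock : Sure G N (block [.iload 16 0 10, .iadd 10 10 4, .iadd 17 12 16, .rload 23 0 17,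
        .rmul 24 23 23]) 11 σ fun σ' => RegAgree [10, 16, 17] [23, 24] σ σ' ∧
        σ'.iarr = σ.iarr ∧ σ'.rarr = σ.rarr ∧ σ'.ireg 10 = σ.ireg 10 + 1 ∧ σ'.ireg 16 = u ∧
        σ'.ireg 17 = j * n + u ∧ σ'.rreg 23 = y ∧ σ'.rreg 24 = y * y := by
      refine sure_block rfl ?_
      simp +contextual [RegAgree, effect, Store.setI, Store.setR, c4, h12, hread, hy, view]
    by_cases hlt : θ * θ < y * y
    · have habs : θ < |y| := by
        rw [← abs_of_nonneg hθ, ← sq_lt_sq, sq, sq]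
        exact hlt
      have huS : u ∉ S := fun h => by
        rw [hy', if_pos h, abs_zero] at habs
        linarith
      rw [if_neg huS] at hy'
      have hbig : u ∈ bigSet G θ g j := by simpa [bigSet, ← hy'] using habs
      have hsum : ∑ w ∈ bigSet G θ g j \ S, (G.degree w + 1) =
          (∑ w ∈ bigSet G θ g j \ insert u S, (G.degree w + 1)) + (G.degree u + 1) := by
        rw [Finset.sdiff_insert, add_comm]
        exact (Finset.add_sum_erase _ _ (Finset.mem_sdiff.2 ⟨hbig, huS⟩)).symm
      have hres : restrict (insert u S) (level G θ g j) =
          restrict S (level G θ g j) + Pi.single u y := by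
        rw [restrict_insert huS, ← hy']
      refine ⟨_, 20 * (fin - (σ.ireg 10 + 1)) +
        60 * (∑ u ∈ bigSet G θ g j \ insert u S, (G.degree u + 1)) + 1, ?_,
        hblock.seq fun σ₁ h₁ => sure_ite (t := 24 * G.degree u + 30)
          (fun _ => (sure_pushProg (u := u) (j := j) (x := y) ?_ ?_ ?_ ?_ ?_ ?_).mono le_rfl ?_)
          fun hn => ?_⟩
      · omega
      · rw [h₁.1.ireg 4 (by decide), c4]
      · rw [h₁.1.ireg 14 (by decide), h14]
      · exact h₁.2.2.2.2.1
      · exact h₁.2.2.2.2.2.1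
      · rw [h₁.1.rreg 17 (by decide), cr17]
      · exact h₁.2.2.2.2.2.2.1
      · obtain ⟨hR, hia, hra, h10, h16, h17, h23, h24⟩ := h₁
        rintro σ' ⟨hR', hia', h11', hv1, hv0, hq, hn', hc⟩
        have e10 : σ'.ireg 10 = σ.ireg 10 + 1 := by rw [hR'.ireg 10 (by decide), h10]
        have e11 := hR.ireg 11 (by decide)
        rw [e11] at h11' hq hn' hc
        rw [hia] at hq
        have hview0 : ∀ i (v : Fin n), view 0 σ₁ i v = view 0 σ i v := fun i v => by
          rw [view, view, hra]
        have hview1 : ∀ i (v : Fin n), view 1 σ₁ i v = view 1 σ i v := fun i v => by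
          rw [view, view, hra]
        refine ⟨insert u S, (hR.trans hR').scanRegs (by decide) (by decide) hσ, ?_, by rw [e10]⟩
        refine ⟨Finset.insert_subset hbig hS.subset, fun i v => ?_, fun i v hi => ?_, fun i hi => ?_,
          by omega, fun w hw hwS => ?_, ?_, fun q h1 h2 => ?_, fun v hv => ?_⟩
        · rw [hv0, hview0, hS.view_zero, hres, map_add]
          rcases lt_trichotomy i j with h | h | h
          · simp [h, h.ne, show i ≠ j + 1 by omega]
          · subst h
            by_cases hvu : v = u <;> simp [hvu]
          · have h' : ¬i < j := by omega
            by_cases h'' : i = j + 1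
            · subst h''
              simp
            · simp [h.ne', h', h'']
        · rw [hv1, hview1, hS.view_one i v hi]
          by_cases h : i = j
          · by_cases hvu : v = u <;> simp [h, hvu, hy']
          · simp [h]
        · rw [hia' 1 one_ne_zero, hia, hS.base i hi]
        · rw [Finset.mem_insert, not_or] at hwS
          obtain ⟨q, h1, h2, h3⟩ := hS.cover w hw hwS.2
          refine ⟨q, ?_, h2, by rw [hq q (by omega), h3]⟩
          rw [e10]
          rcases h1.eq_or_lt with rfl | h1
          · exact absurd (Fin.ext (h3.symm.trans hread)) hwS.1
          · exact h1
        · rw [h11', htail, Finset.sum_insert huS]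
          ring
        · rw [e10] at h1
          by_cases h : q < σ.ireg 11
          · rw [hq q h]
            exact hS.lt q (by omega) h
          · exact hn' q (by omega) h2
        · rw [hres, map_add, Pi.add_apply] at hv
          by_cases h : lazyWalk G (restrict S (level G θ g j)) v = 0
          · rw [h, zero_add] at hv
            obtain ⟨q, h1, h2, h3⟩ := hc v hv
            exact ⟨q, by omega, h2, h3⟩
          · obtain ⟨q, h1, h2, h3⟩ := hS.next v h
            exact ⟨q, h1, by omega, by rw [hq q h2, h3]⟩
      · simp [Test.Holds, h₁.2.2.2.2.2.2.2, h₁.1.rreg 25 (by decide), cr25] at hn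
        linarith
    · refine ⟨_, 20 * (fin - (σ.ireg 10 + 1)) +
        60 * (∑ u ∈ bigSet G θ g j \ S, (G.degree u + 1)) + 1, ?_,
        hblock.seq fun σ₁ h₁ => sure_ite (t := 1) (fun hn => ?_) fun _ => sure_skip ?_⟩
      · omega
      · simp only [Test.Holds, h₁.2.2.2.2.2.2.2, h₁.1.rreg 25 (by decide), cr25] at hn
        exact absurd hn hlt
      · obtain ⟨hR, hia, hra, h10, h16, h17, h23, h24⟩ := h₁
        have e11 := hR.ireg 11 (by decide)
        refine ⟨S, hR.scanRegs (by decide) (by decide) hσ, ?_, by rw [h10]⟩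
        refine ⟨hS.subset, fun i v => ?_, fun i v hi => ?_, fun i hi => ?_, by omega,
          fun w hw hwS => ?_, by rw [e11, htail], fun q h1 h2 => ?_, fun v hv => ?_⟩
        · rw [view, hra]
          exact hS.view_zero i v
        · rw [view, hra]
          exact hS.view_one i v hi
        · rw [hia, hS.base i hi]
        · obtain ⟨q, h1, h2, h3⟩ := hS.cover w hw hwS
          refine ⟨q, ?_, h2, by rw [hia, h3]⟩
          rw [h10]
          rcases h1.eq_or_lt with rfl | h1
          · exfalso
            have hwu : w = u := Fin.ext (h3.symm.trans hread)
            subst hwu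
            rw [if_neg hwS] at hy'
            have habs : θ < |y| := by
              rw [hy']
              exact (Finset.mem_filter.1 hw).2
            rw [← abs_of_nonneg hθ, ← sq_lt_sq, sq, sq] at habs
            exact hlt habs
          · exact h1
        · rw [hia]
          exact hS.lt q (by omega) (by omega)
        · rw [hia, e11]
          exact hS.next v hv
  · rintro T σ ⟨S, hσ, hS, rfl⟩ hb
    have h15 : σ.ireg 15 = fin := hσ.2.2.2.2.1
    simp only [Test.Holds, h15, not_lt] at hb
    have h10 : σ.ireg 10 = fin := le_antisymm hS.le_fin hb
    have hSeq : S = bigSet G θ g j := by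
      refine Finset.Subset.antisymm hS.subset fun u hu => ?_
      by_contra huS
      obtain ⟨q, h1, h2, -⟩ := hS.cover u hu huS
      omega
    subst hSeq
    exact ⟨by omega, hσ, hS, h10⟩

end ScanPhase

/-- Process a level. -/
def levelBody : Program :=
  .seq (block [.istore 1 13 12, .iadd 14 12 0, .icopy 15 11])
    (.seq (.while (.ilt 10 15) scanBody)
      (block [.iadd 17 12 1, .rload 24 1 17, .radd 13 13 24, .iadd 17 12 2, .rload 24 1 17,
        .rsub 13 13 24, .icopy 12 14, .iadd 13 13 4]))

/-- The push phase. -/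
def pushPhase : Program :=
  .seq (block [.rofint 20 7, .rdiv 20 3 20, .rstore 0 1 20, .rofint 21 8, .rdiv 21 3 21,
    .rconst 22 0, .rsub 21 22 21, .rstore 0 2 21, .iconst 10 0, .istore 0 10 1, .iconst 11 1,
    .istore 0 11 2, .iconst 11 2, .iconst 12 0, .iconst 13 0, .rconst 13 0])
    (.while (.ilt 13 5) levelBody)

section LevelPhase

variable {n : ℕ} (G : SimpleGraph (Fin n)) [DecidableRel G.Adj]

/-- The memory before level `j` is processed; `M` bounds the length of the queue. -/
structure LevelState (s t : Fin n) (k : ℕ) (θ x : ℝ) (g : Fin n → ℝ) (M j : ℕ) (σ : Store) :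
    Prop where
  consts : Consts n s t k θ x σ
  ireg12 : σ.ireg 12 = j * n
  ireg13 : σ.ireg 13 = j
  acc : σ.rreg 13 = ∑ i ∈ Finset.range j,
    (large θ (level G θ g i) s - large θ (level G θ g i) t)
  view_zero : ∀ i v, view 0 σ i v = if i < j then residual G θ g i v else
    if i = j then level G θ g j v else 0
  view_one : ∀ i (v : Fin n), j ≤ i → view 1 σ i v = 0
  base : ∀ i < j, σ.iarr 1 i = i * n
  le_tail : σ.ireg 10 ≤ σ.ireg 11
  tail_le : σ.ireg 11 ≤ σ.ireg 10 + M
  lt : ∀ q, σ.ireg 10 ≤ q → q < σ.ireg 11 → σ.iarr 0 q < n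
  cover : ∀ v, level G θ g j v ≠ 0 → ∃ q, σ.ireg 10 ≤ q ∧ q < σ.ireg 11 ∧ σ.iarr 0 q = v

variable {G} {N : AdjLists G}

theorem sure_levelBody {s t : Fin n} {k : ℕ} {θ x : ℝ} (hθ : 0 ≤ θ) {g : Fin n → ℝ} {M j : ℕ}
    (hM : ∑ u ∈ bigSet G θ g j, (G.degree u + 1) ≤ M) {σ : Store}
    (hσ : LevelState G s t k θ x g M j σ) :
    Sure G N levelBody (80 * M + 50) σ (LevelState G s t k θ x g M (j + 1)) := by
  obtain ⟨hc, h12, h13, hacc, hv0, hv1, hbase, hle, htail, hlt, hcover⟩ := hσ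
  obtain ⟨c0, c1, c2, c3, c4, c5, cr3, cr10, cr12, cr17, cr25⟩ := id hc
  have hblock : Sure G N (block [.istore 1 13 12, .iadd 14 12 0, .icopy 15 11]) 7 σ fun σ' =>
      ScanRegs s t k θ x (σ.rreg 13) j (σ.ireg 11) σ' ∧ ScanState G θ g j (σ.ireg 11) ∅ σ' ∧
        σ'.ireg 10 = σ.ireg 10 := by
    refine sure_block rfl ⟨?_, ?_, ?_⟩
    · simp [ScanRegs, Consts, effect, Store.setI, Store.setIArr, c0, c1, c2, c3, c4, c5, cr3, cr10,
        cr12, cr17, cr25, h12, h13]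
      ring
    · have hr : restrict (∅ : Finset (Fin n)) (level G θ g j) = 0 := by
        ext v
        simp [restrict]
      refine ⟨Finset.empty_subset _, fun i v => ?_, fun i v hi => ?_, fun i hi => ?_, ?_,
        fun u hu _ => ?_, ?_, ?_, fun v hv => ?_⟩
      · have := hv0 i v
        simp only [view] at this
        simp [view, effect, Store.setI, Store.setIArr, this, hr]
      · have := hv1 i v hi
        simp only [view] at this
        simp [view, effect, Store.setI, Store.setIArr, this]
      · simp only [List.foldl_cons, List.foldl_nil, effect, Store.setI, Store.setIArr, h12, h13,
          Function.update_self]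
        rcases hi.eq_or_lt with rfl | hi
        · simp
        · rw [Function.update_of_ne hi.ne, hbase i hi]
      · simpa [effect, Store.setI, Store.setIArr] using hle
      · have : level G θ g j u ≠ 0 := fun h => by
          have := (Finset.mem_filter.1 hu).2
          rw [h, abs_zero] at this
          linarith
        simpa [effect, Store.setI, Store.setIArr] using hcover u this
      · simp [effect, Store.setI, Store.setIArr]
      · simpa [effect, Store.setI, Store.setIArr] using hlt
      · simp [hr] at hv
    · simp [effect, Store.setI, Store.setIArr]
  refine Sure.mono (hblock.seq fun σ₁ h₁ => ((sure_scan hθ h₁.1 h₁.2.1).mono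
    (t' := 20 * M + 60 * M + 1) ?_ fun _ h => h).seq fun σ₂ h₂ =>
    sure_block (Q := LevelState G s t k θ x g M (j + 1)) rfl ?_) ?_ fun _ h => h
  · rw [h₁.2.2]
    omega
  · obtain ⟨⟨⟨c0, c1, c2, c3, c4, c5, cr3, cr10, cr12, cr17, cr25⟩, h12, h13, h14, h15, hr13⟩, hS,
      h10⟩ := h₂
    have hlev : lazyWalk G (restrict (bigSet G θ g j) (level G θ g j)) = level G θ g (j + 1) := by
      rw [← large_level_eq_restrict, level]
    have hl : ∀ v, σ₂.rarr 1 (j * n + (v : Fin n)) = large θ (level G θ g j) v := fun v => by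
      have := hS.view_one j v le_rfl
      rw [view] at this
      rw [this, large_level_eq_restrict]
      simp [restrict]
    have htl := hS.tail
    refine ⟨?_, ?_, ?_, ?_, fun i v => ?_, fun i v hi => ?_, fun i hi => ?_, ?_, ?_, ?_, ?_⟩
    · simp [Consts, effect, Store.setI, Store.setR, c0, c1, c2, c3, c4, c5, cr3, cr10,
        cr12, cr17, cr25]
    · simp [effect, Store.setI, Store.setR, h14]
    · simp [effect, Store.setI, Store.setR, h13, c4]
    · simp [effect, Store.setI, Store.setR, h12, c1, c2, hr13, hl, hacc, Finset.sum_range_succ]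
      ring
    · have h := hS.view_zero i v
      rw [hlev] at h
      simp only [view] at h
      simp only [view, List.foldl_cons, List.foldl_nil, effect, Store.setI, Store.setR, h]
      rcases lt_trichotomy i j with h | h | h
      · simp [h, show i < j + 1 by omega]
      · subst h
        simp [residual, large_level_eq_restrict, restrict]
        split_ifs <;> simp
      · simp [h.ne', show ¬i < j by omega, show ¬i < j + 1 by omega]
    · have h := hS.view_one i v (by omega)
      simp only [view] at h
      simp [view, effect, Store.setI, Store.setR, h, show i ≠ j by omega]
    · simpa [effect, Store.setI, Store.setR] using hS.base i (by omega)
    · simp [effect, Store.setI, Store.setR]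
      omega
    · simp [effect, Store.setI, Store.setR]
      omega
    · simpa [effect, Store.setI, Store.setR] using hS.lt
    · intro v hv
      rw [← hlev] at hv
      simpa [effect, Store.setI, Store.setR, h10] using hS.next v hv
  · simp
    omega

theorem sure_pushPhase {s t : Fin n} (hst : s ≠ t) {k : ℕ} {θ x : ℝ} (hθ : 0 ≤ θ) {M : ℕ}
    (hM : ∀ j, ∑ u ∈ bigSet G θ (source G s t) j, (G.degree u + 1) ≤ M) (hM2 : 2 ≤ M) {σ : Store}
    (hσ : Consts n s t k θ x σ) (h7 : σ.ireg 7 = G.degree s) (h8 : σ.ireg 8 = G.degree t)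
    (hia : σ.iarr = fun _ _ => 0) (hra : σ.rarr = fun _ _ => 0) :
    Sure G N pushPhase (k * (80 * M + 51) + 50) σ
      (LevelState G s t k θ x (source G s t) M k) := by
  obtain ⟨c0, c1, c2, c3, c4, c5, cr3, cr10, cr12, cr17, cr25⟩ := id hσ
  have hst' : (t : ℕ) ≠ s := fun h => hst (Fin.ext h.symm)
  refine Sure.mono ((sure_block (Q := LevelState G s t k θ x (source G s t) M 0) rfl ?_).seq
    fun σ₁ h₁ => (sure_while_count (fun i σ' => i ≤ k ∧
      LevelState G s t k θ x (source G s t) M (k - i) σ') (t := 80 * M + 50) ?_ ?_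
      ⟨le_rfl, by simpa using h₁⟩).mono le_rfl fun σ' h => by simpa using h) ?_ fun _ h => h
  · refine ⟨?_, ?_, ?_, ?_, fun i v => ?_, fun i v hi => ?_, ?_, ?_, ?_, fun q _ hq => ?_, 
      fun v hv => ?_⟩
    · simp [Consts, effect, Store.setI, Store.setR, Store.setIArr, Store.setRArr, c0, c1, c2, c3,
        c4, c5, cr3, cr10, cr12, cr17, cr25]
    · simp [effect, Store.setI, Store.setR, Store.setIArr, Store.setRArr]
    · simp [effect, Store.setI, Store.setR, Store.setIArr, Store.setRArr]
    · simp [effect, Store.setI, Store.setR, Store.setIArr, Store.setRArr]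
    · have hs0 : (s : ℕ) = 0 * n + s := by simp
      have ht0 : (t : ℕ) = 0 * n + t := by simp
      simp [view, effect, Store.setI, Store.setR, Store.setIArr, Store.setRArr, c1, c2, hra, h7, h8,
        cr3, level]
      rw [ht0, hs0]
      simp only [Function.update_apply, index_eq_iff]
      by_cases hi : i = 0
      · by_cases hvt : v = t
        · simp [hi, hvt, source, hst, hst.symm, neg_div]
          rw [hvt]
        · by_cases hvs : v = s
          · simp [hi, hvs, source, hst]
            rw [hvs]
          · simp [hi, hvs, hvt, source]
      · simp [hi]
    · simp [view, effect, Store.setI, Store.setR, Store.setIArr, Store.setRArr, hra]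
    · simp
    · simp [effect, Store.setI, Store.setR, Store.setIArr, Store.setRArr]
    · simpa [effect, Store.setI, Store.setR, Store.setIArr, Store.setRArr] using hM2
    · have hq' : q < 2 := by
        simpa [effect, Store.setI, Store.setR, Store.setIArr, Store.setRArr] using hq
      interval_cases q <;>
        simp [effect, Store.setI, Store.setR, Store.setIArr, Store.setRArr, c1, c2]
    · simp only [level] at hv
      by_cases hvt : v = t
      · exact ⟨1, by simp [effect, Store.setI, Store.setR, Store.setIArr, Store.setRArr, c1, c2,
          hvt]⟩
      · by_cases hvs : v = s
        · exact ⟨0, by simp [effect, Store.setI, Store.setR, Store.setIArr, Store.setRArr, c1, c2,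
            hvs]⟩
        · simp [source, hvs, hvt] at hv
  · rintro i σ' ⟨hi, h⟩
    have e : k - i = k - (i + 1) + 1 := by omega
    refine ⟨?_, ?_⟩
    · simp only [Test.Holds, h.ireg13, h.consts.2.2.2.2.2.1]
      omega
    · rw [e]
      exact (sure_levelBody hθ (hM _) h).mono le_rfl fun σ'' h' => ⟨by omega, h'⟩
  · rintro σ' ⟨-, h⟩
    simp [Test.Holds, h.ireg13, h.consts.2.2.2.2.2.1]
  · simp
    linarith

end LevelPhase

/-! ### The sampling phase of the algorithm -/

/-- A lazy random walk; the current vertex is in integer register 26, and the length of the walk in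
integer register 23. -/
def walkProg : Program :=
  .while (.ilt 27 23) (.seq (block [.deg 28 26, .iadd 29 28 28]) (.seq (.instr (.rand 30 29))
    (.seq (.ite (.ilt 30 28) (.instr (.neigh 26 26 30)) .skip) (.instr (.iadd 27 27 4)))))

/-- Add the sampled value to the sum in real register 14. -/
def recordProg : Program :=
  .seq (block [.iadd 31 24 23]) (.seq (.ite (.ilt 31 5)
    (block [.iload 32 1 24, .iadd 32 32 26, .rload 28 0 32, .rmul 28 28 27, .radd 14 14 28]) .skip)
    (block [.radd 15 15 3]))

/-- Choose the start of a random walk. -/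
def startProg : Program :=
  .seq (.ite (.ieq 25 3) (block [.icopy 26 1, .rconst 27 1])
    (block [.icopy 26 2, .rconst 27 0, .rsub 27 27 3])) (block [.iconst 27 0])

/-- Take a sample. -/
def sampleBody : Program :=
  .seq (.instr (.rand 23 5)) (.seq (.instr (.rand 24 5)) (.seq (.instr (.rand 25 33))
    (.seq startProg (.seq walkProg recordProg))))

section SamplePhase

variable {n : ℕ} {G : SimpleGraph (Fin n)} [DecidableRel G.Adj] {N : AdjLists G}

/-- Extend a function on the vertices by zero. -/
def extend (f : Fin n → ℝ) (x : ℕ) : ℝ := if h : x < n then f ⟨x, h⟩ else 0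

@[simp]
theorem extend_coe (f : Fin n → ℝ) (v : Fin n) : extend f v = f v := by simp [extend]

theorem extend_nonneg {f : Fin n → ℝ} (hf : ∀ v, 0 ≤ f v) (x : ℕ) : 0 ≤ extend f x := by
  unfold extend
  split_ifs
  exacts [hf _, le_rfl]

theorem sum_range_two_mul_degree (hd : ∀ v, 0 < G.degree v) (f : Fin n → ℝ) (v : Fin n) :
    (∑ i ∈ Finset.range (G.degree v + G.degree v),
      if i < G.degree v then extend f (neighQuery G N v i) else f v) /
        ((G.degree v + G.degree v : ℕ) : ℝ) = lazyWalk G f v := by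
  have hv : (G.degree v : ℝ) ≠ 0 := by exact_mod_cast (hd v).ne'
  have h1 : ∑ i ∈ Finset.range (G.degree v),
      (if i < G.degree v then extend f (neighQuery G N v i) else f v) =
        ∑ w ∈ G.neighborFinset v, f w := by
    rw [Finset.sum_range]
    have : ∑ w ∈ G.neighborFinset v, f w = ∑ w : G.neighborSet v, f w :=
      (Finset.sum_subtype _ (by simp) f)
    rw [this, ← Equiv.sum_comp (N v)]
    refine Finset.sum_congr rfl fun i _ => ?_
    rw [if_pos i.2, neighQuery_coe G N v i.2, extend_coe]
  rw [Finset.sum_range_add, h1, lazyWalk_apply]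
  simp
  field_simp
  ring

theorem lazyWalk_pow_nonneg (hd : ∀ v, 0 < G.degree v) {f : Fin n → ℝ} (hf : ∀ v, 0 ≤ f v) (k : ℕ)
    (v : Fin n) : 0 ≤ (lazyWalk G ^ k) f v := by
  have := lazyWalk_pow_mono (G := G) (f := fun _ => 0) (g := f) hf k v
  rwa [lazyWalk_pow_const hd] at this

theorem triple_walkProg (hd : ∀ v, 0 < G.degree v) {σ : Store} {m : ℕ} {v : Fin n}
    {f : Fin n → ℝ} (hf : ∀ v, 0 ≤ f v) (h4 : σ.ireg 4 = 1) (h23 : σ.ireg 23 = m)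
    (h26 : σ.ireg 26 = v) (h27 : σ.ireg 27 = 0) :
    Triple G N walkProg (13 * m + 1) σ
      (fun σ' => Agree [26, 27, 28, 29, 30] [] σ σ' ∧ ∃ w : Fin n, σ'.ireg 26 = w)
      (fun σ' => extend f (σ'.ireg 26)) ((lazyWalk G ^ m) f v) := by
  refine (triple_while_count (b := .ilt 27 23) (k := m) (t := 12)
    (fun k σ' => k ≤ m ∧ Agree [26, 27, 28, 29, 30] [] σ σ' ∧ σ'.ireg 27 = m - k ∧
      ∃ w : Fin n, σ'.ireg 26 = w) (fun k σ' => extend ((lazyWalk G ^ k) f) (σ'.ireg 26))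
    ?_ ?_ ⟨le_rfl, ⟨fun _ _ => rfl, fun _ _ => rfl, rfl, rfl⟩, by simp [h27], v, h26⟩).mono ?_ ?_ ?_
  · rintro k σ' ⟨hk, hA, h27', w, h26'⟩
    refine ⟨?_, ?_⟩
    · simp only [Test.Holds, h27', hA.ireg 23 (by decide), h23]
      omega
    have e4 := hA.ireg 4 (by decide)
    have hwd := hd w
    have hval : extend ((lazyWalk G ^ (k + 1)) f) (σ'.ireg 26) =
        (∑ i ∈ Finset.range (G.degree w + G.degree w),
          if i < G.degree w then extend ((lazyWalk G ^ k) f) (neighQuery G N w i) else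
            (lazyWalk G ^ k) f w) / ((G.degree w + G.degree w : ℕ) : ℝ) := by
      rw [sum_range_two_mul_degree hd, h26', extend_coe, pow_succ']
      rfl
    rw [hval]
    refine ((sure_block (Q := fun σ₁ => Agree [28, 29] [] σ' σ₁ ∧ σ₁.ireg 28 = G.degree w ∧
      σ₁.ireg 29 = G.degree w + G.degree w) (l := [.deg 28 26, .iadd 29 28 28]) rfl ?_).seq_triple
      (t₂ := 6) fun σ₁ h₁ => ?_).mono (by simp) (fun _ h => ⟨h, le_rfl⟩) le_rfl
    · simp +contextual [Agree, effect, Store.setI, h26', degQuery_coe]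
    obtain ⟨hA₁, h28, h29⟩ := h₁
    have hrand := triple_rand (G := G) (N := N) (x := 30) (y := 29) (σ := σ₁)
      (Q := fun σ₂ => ∃ i, i < G.degree w + G.degree w ∧ σ₂ = σ₁.setI 30 i)
      (φ := fun σ₂ => if σ₂.ireg 30 < G.degree w then
        extend ((lazyWalk G ^ k) f) (neighQuery G N w (σ₂.ireg 30)) else (lazyWalk G ^ k) f w)
      (by rw [h29]; omega) (fun i hi => ⟨i, h29 ▸ hi, rfl⟩) (fun i _ => by
        split_ifs
        exacts [extend_nonneg (lazyWalk_pow_nonneg hd hf k) _, lazyWalk_pow_nonneg hd hf k w])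
    rw [h29] at hrand
    simp only [Store.setI, Function.update_self] at hrand
    refine hrand.seq (t₂ := 4) fun σ₂ h₂ => ?_
    obtain ⟨i, hi, rfl⟩ := h₂
    have hA₂ : Agree [26, 27, 28, 29, 30] [] σ (σ₁.setI 30 i) := by
      refine ⟨fun x hx => ?_, fun x hx => ?_, ?_, ?_⟩
      · simp only [List.mem_cons, List.not_mem_nil, or_false, not_or] at hx
        simp [Store.setI, hx, hA₁.1, hA.1]
      · simp [Store.setI, hA₁.2.1, hA.2.1]
      · simp [Store.setI, hA₁.2.2.1, hA.2.2.1]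
      · simp [Store.setI, hA₁.2.2.2, hA.2.2.2]
    have j26 : σ₁.ireg 26 = w := by rw [hA₁.ireg 26 (by decide), h26']
    have j27 : σ₁.ireg 27 = m - (k + 1) := by rw [hA₁.ireg 27 (by decide), h27']
    have hite : Sure G N (.ite (.ilt 30 28) (.instr (.neigh 26 26 30)) .skip) 2 (σ₁.setI 30 i)
        fun σ₃ => Agree [26] [] (σ₁.setI 30 i) σ₃ ∧ (∃ w' : Fin n, σ₃.ireg 26 = w') ∧
          extend ((lazyWalk G ^ k) f) (σ₃.ireg 26) = if i < G.degree w then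
            extend ((lazyWalk G ^ k) f) (neighQuery G N w i) else (lazyWalk G ^ k) f w := by
      refine sure_ite (t := 1) (fun hb => sure_instr rfl ?_) fun hb => sure_skip ?_
      · simp only [Test.Holds, Store.setI, Function.update_self] at hb
        rw [Function.update_of_ne (by decide), h28] at hb
        simp +contextual [Agree, effect, Store.setI, j26, hb, neighQuery_coe G N w hb]
      · simp only [Test.Holds, Store.setI, Function.update_self] at hb
        rw [Function.update_of_ne (by decide), h28] at hb
        simp [Agree, Store.setI, j26, hb]
    refine (hite.seq (t₂ := 1) fun σ₃ h₃ => sure_instr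
      (Q := fun σ' => (k ≤ m ∧ Agree [26, 27, 28, 29, 30] [] σ σ' ∧ σ'.ireg 27 = m - k ∧
        ∃ w : Fin n, σ'.ireg 26 = w) ∧ extend ((lazyWalk G ^ k) f) (σ'.ireg 26) =
          if i < G.degree w then extend ((lazyWalk G ^ k) f) (neighQuery G N w i)
            else (lazyWalk G ^ k) f w) rfl ?_).triple (fun σ' h => le_of_eq ?_) |>.mono le_rfl
              (fun σ' h => ⟨h.1, le_rfl⟩) le_rfl
    · obtain ⟨hA₃, hw', hv⟩ := h₃
      have hA₄ := hA₂.trans hA₃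
      have e27 := hA₃.ireg 27 (by decide)
      have e4' := hA₄.ireg 4 (by decide)
      refine ⟨⟨by omega, ⟨fun x hx => ?_, fun x hx => ?_, ?_, ?_⟩, ?_, ?_⟩, ?_⟩
      · have := hA₄.1 x (by simp at hx ⊢; omega)
        simp only [List.mem_cons, List.not_mem_nil, or_false, not_or] at hx
        simp [effect, Store.setI, hx, this]
      · simp [effect, Store.setI, hA₄.2.1]
      · simp [effect, Store.setI, hA₄.2.2.1]
      · simp [effect, Store.setI, hA₄.2.2.2]
      · simp [effect, Store.setI, e4', h4, e27, j27]
        omega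
      · simpa [effect, Store.setI] using hw'
      · simpa [effect, Store.setI] using hv
    · rw [h.2]
      simp [Store.setI]
  · rintro σ' ⟨-, hA, h27', -⟩
    simp [Test.Holds, h27', hA.ireg 23 (by decide), h23]
  · omega
  · rintro σ' ⟨-, hA, -, hw⟩
    exact ⟨⟨hA, hw⟩, by simp⟩
  · simp [h26]

end SamplePhase

section SamplePhase

variable {n : ℕ} {G : SimpleGraph (Fin n)} [DecidableRel G.Adj] {N : AdjLists G}

theorem triple_rand_agree {x y k : ℕ} {σ : Store} (hk : 0 < k) (hy : σ.ireg y = k) {ψ : ℕ → ℝ}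
    (hψ : ∀ i, 0 ≤ ψ i) :
    Triple G N (.instr (.rand x y)) 1 σ (fun σ' => Agree [x] [] σ σ' ∧ σ'.ireg x < k)
      (fun σ' => ψ (σ'.ireg x)) ((∑ i ∈ Finset.range k, ψ i) / k) := by
  have h := triple_rand (G := G) (N := N) (x := x) (y := y) (σ := σ)
    (Q := fun σ' => Agree [x] [] σ σ' ∧ σ'.ireg x < k) (φ := fun σ' => ψ (σ'.ireg x)) (by omega)
    (fun i hi => by
      simp +contextual [Agree, Store.setI]
      omega) fun i _ => hψ _
  rw [hy] at h
  simpa [Store.setI] using h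

variable (G) in
/-- The memory during the sampling phase. -/
structure SampleState (s t : Fin n) (k : ℕ) (θ x : ℝ) (g : Fin n → ℝ) (A : ℝ) (σ : Store) :
    Prop where
  consts : Consts n s t k θ x σ
  two : σ.ireg 33 = 2
  acc : σ.rreg 13 = A
  residual : ∀ i < k, ∀ v, view 0 σ i v = residual G θ g i v
  base : ∀ i < k, σ.iarr 1 i = i * n

theorem SampleState.of_agree {s t : Fin n} {k : ℕ} {θ x : ℝ} {g : Fin n → ℝ} {A : ℝ}
    {σ σ' : Store} (h : SampleState G s t k θ x g A σ) {I R : List ℕ} (hA : Agree I R σ σ')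
    (hI : ∀ x ∈ I, x ∉ [0, 1, 2, 3, 4, 5, 33]) (hR : ∀ x ∈ R, x ∉ [3, 10, 12, 17, 25, 13]) :
    SampleState G s t k θ x g A σ' := by
  obtain ⟨hc, h2, ha, hr, hb⟩ := h
  have h1 : ∀ x ∈ [0, 1, 2, 3, 4, 5, 33], σ'.ireg x = σ.ireg x :=
    fun x hx => hA.1 x fun hx' => hI x hx' hx
  have h2 : ∀ x ∈ [3, 10, 12, 17, 25, 13], σ'.rreg x = σ.rreg x :=
    fun x hx => hA.2.1 x fun hx' => hR x hx' hx
  simp only [List.mem_cons, forall_eq_or_imp, List.not_mem_nil, false_implies, forall_const] at h1 h2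
  refine ⟨by simpa only [Consts, h1, h2] using hc, by simpa only [h1], by simpa only [h2], ?_, ?_⟩
  · simpa only [view, hA.2.2.2] using hr
  · simpa only [hA.2.2.1] using hb

theorem sure_recordProg {s t : Fin n} {k : ℕ} {θ x : ℝ} {g : Fin n → ℝ} {A : ℝ} {σ : Store}
    (h : SampleState G s t k θ x g A σ) {m j : ℕ} {w : Fin n} (h23 : σ.ireg 23 = m)
    (h24 : σ.ireg 24 = j) (h26 : σ.ireg 26 = w) :
    Sure G N recordProg 25 σ fun σ' => Agree [31, 32] [14, 15, 28] σ σ' ∧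
      σ'.rreg 14 = σ.rreg 14 + sampleVal G θ g k m j w * σ.rreg 27 ∧
      σ'.rreg 15 = σ.rreg 15 + 1 := by
  obtain ⟨⟨c0, c1, c2, c3, c4, c5, cr3, cr10, cr12, cr17, cr25⟩, h33, ha, hr, hb⟩ := id h
  refine Sure.mono ((sure_block (Q := fun σ' => Agree [31] [] σ σ' ∧ σ'.ireg 31 = j + m)
    (l := [.iadd 31 24 23]) rfl ?_).seq
    fun σ₁ h₁ => (sure_ite (t := 11) (Q := fun σ' => Agree [31, 32] [14, 28] σ σ' ∧
      σ'.rreg 14 = σ.rreg 14 + sampleVal G θ g k m j w * σ.rreg 27)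
    (fun hlt => sure_block (l := [.iload 32 1 24, .iadd 32 32 26, .rload 28 0 32, .rmul 28 28 27,
      .radd 14 14 28]) rfl ?_) fun hlt => Sure.mono (t := 1) (sure_skip ?_) (by norm_num)
        fun _ h => h).seq fun σ₂ h₂ => sure_block (l := [.radd 15 15 3]) rfl ?_) ?_ fun _ h => h
  · simp +contextual [Agree, effect, Store.setI, h23, h24]
  · obtain ⟨hA, h31⟩ := h₁
    simp only [Test.Holds, h31, hA.ireg 5 (by decide), c5] at hlt
    have e14 := hA.rreg 14 (by simp)
    have e27 := hA.rreg 27 (by simp)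
    have e24 := hA.ireg 24 (by simp)
    have e26 := hA.ireg 26 (by simp)
    have hb' := hb j (by omega)
    have hr' := hr j (by omega) w
    rw [view] at hr'
    simp +contextual [Agree, effect, Store.setI, Store.setR, hA.1, hA.2.1, hA.2.2, e14, e24, e26,
      e27, h24, h26, hb', hr', sampleVal, hlt]
  · obtain ⟨hA, h31⟩ := h₁
    simp only [Test.Holds, h31, hA.ireg 5 (by decide), c5] at hlt
    have e14 := hA.rreg 14 (by simp)
    refine ⟨⟨fun x hx => hA.1 x fun h => hx (by simp at h ⊢; omega), fun x hx => hA.2.1 x (by simp),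
      hA.2.2⟩, ?_⟩
    simp [sampleVal, hlt, e14]
  · obtain ⟨hA, h14⟩ := h₂
    have e15 := hA.rreg 15 (by simp)
    have e3 := hA.rreg 3 (by simp)
    refine ⟨⟨fun x hx => ?_, fun x hx => ?_, ?_, ?_⟩, ?_, ?_⟩
    · simpa [effect, Store.setR] using hA.1 x hx
    · have := hA.2.1 x (by simp at hx ⊢; omega)
      simp only [List.mem_cons, List.not_mem_nil, or_false, not_or] at hx
      simp [effect, Store.setR, hx, this]
    · simp [effect, Store.setR, hA.2.2.1]
    · simp [effect, Store.setR, hA.2.2.2]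
    · simpa [effect, Store.setR] using h14
    · simp [effect, Store.setR, e15, e3, cr3]
  · simp

theorem sure_startProg {s t : Fin n} {k : ℕ} {θ x : ℝ} {σ : Store}
    (h : Consts n s t k θ x σ) :
    Sure G N startProg 12 σ fun σ' => Agree [26, 27] [27] σ σ' ∧ σ'.ireg 27 = 0 ∧
      σ'.ireg 26 = (if σ.ireg 25 = 0 then s else t : Fin n) ∧
      σ'.rreg 27 = if σ.ireg 25 = 0 then 1 else -1 := by
  obtain ⟨c0, c1, c2, c3, c4, c5, cr3, cr10, cr12, cr17, cr25⟩ := id h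
  refine Sure.mono ((sure_ite (t := 7) (Q := fun σ' => Agree [26, 27] [27] σ σ' ∧
      σ'.ireg 26 = (if σ.ireg 25 = 0 then s else t : Fin n) ∧
      σ'.rreg 27 = if σ.ireg 25 = 0 then 1 else -1)
    (fun hb => Sure.mono (sure_block (Q := fun σ' => Agree [26, 27] [27] σ σ' ∧
      σ'.ireg 26 = (if σ.ireg 25 = 0 then s else t : Fin n) ∧
      σ'.rreg 27 = if σ.ireg 25 = 0 then 1 else -1)
      (l := [.icopy 26 1, .rconst 27 1]) rfl ?_) (by simp) fun _ h => h) fun hb =>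
      sure_block (l := [.icopy 26 2, .rconst 27 0, .rsub 27 27 3]) rfl ?_).seq
    fun σ₁ h₁ => sure_block (l := [.iconst 27 0]) rfl ?_) ?_ fun _ h => h
  · simp only [Test.Holds, c3] at hb
    simp +contextual [Agree, effect, Store.setI, Store.setR, hb, c1]
  · simp only [Test.Holds, c3] at hb
    simp +contextual [Agree, effect, Store.setI, Store.setR, hb, c2, cr3]
  · obtain ⟨hA, h26, h27⟩ := h₁
    simp +contextual [Agree, effect, Store.setI, hA.1, hA.2.1, hA.2.2, h26, h27]
  · simp

theorem triple_sampleBody (hd : ∀ v, 0 < G.degree v) {s t : Fin n} {k : ℕ} (hk : 0 < k) {θ x : ℝ}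
    {g : Fin n → ℝ} {A : ℝ} {σ : Store} (h : SampleState G s t k θ x g A σ) {F : ℝ → ℝ}
    (hF : ∀ y, 0 ≤ F y) :
    Triple G N sampleBody (13 * k + 50) σ
      (fun σ' => SampleState G s t k θ x g A σ' ∧ σ'.rreg 15 = σ.rreg 15 + 1)
      (fun σ' => F (σ'.rreg 14)) (sampleAvg G θ g k s t fun y => F (σ.rreg 14 + y)) := by
  have hp : ∀ (m j : ℕ) (v : Fin n) (r : ℝ),
      0 ≤ (lazyWalk G ^ m) (fun v => F (σ.rreg 14 + sampleVal G θ g k m j v * r)) v :=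
    fun m j v r => lazyWalk_pow_nonneg hd (fun _ => hF _) m v
  set ψ₃ : ℕ → ℕ → ℕ → ℝ := fun m j c => (lazyWalk G ^ m) (fun v => F (σ.rreg 14 +
    sampleVal G θ g k m j v * if c = 0 then 1 else -1)) (if c = 0 then s else t) with hψ₃
  have hψ₃0 : ∀ m j c, 0 ≤ ψ₃ m j c := fun m j c => hp m j _ _
  set ψ₂ : ℕ → ℕ → ℝ := fun m j => (∑ c ∈ Finset.range 2, ψ₃ m j c) / (2 : ℕ) with hψ₂
  have hψ₂0 : ∀ m j, 0 ≤ ψ₂ m j := fun m j =>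
    div_nonneg (Finset.sum_nonneg fun c _ => hψ₃0 m j c) (Nat.cast_nonneg _)
  set ψ₁ : ℕ → ℝ := fun m => (∑ j ∈ Finset.range k, ψ₂ m j) / k with hψ₁
  have hψ₁0 : ∀ m, 0 ≤ ψ₁ m := fun m =>
    div_nonneg (Finset.sum_nonneg fun c _ => hψ₂0 m c) (Nat.cast_nonneg _)
  have hval : (sampleAvg G θ g k s t fun y => F (σ.rreg 14 + y)) =
      (∑ m ∈ Finset.range k, ψ₁ m) / k := by
    simp [sampleAvg, hψ₁, hψ₂, hψ₃, Finset.sum_range_succ]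
  rw [hval]
  have hc5 : σ.ireg 5 = k := h.consts.2.2.2.2.2.1
  refine Triple.mono ((triple_rand_agree hk hc5 hψ₁0).seq fun σ₁ h₁ =>
    (triple_rand_agree (k := k) (ψ := ψ₂ (σ₁.ireg 23)) hk ?_ (hψ₂0 _)).seq fun σ₂ h₂ =>
    (triple_rand_agree (k := 2) (ψ := ψ₃ (σ₁.ireg 23) (σ₂.ireg 24)) two_pos ?_ (hψ₃0 _ _)).seq
    fun σ₃ h₃ => (sure_startProg (s := s) (t := t) (k := k) (θ := θ) (x := x) ?_).seq_triple
    fun σ₄ h₄ => ((triple_walkProg (m := σ₁.ireg 23) (v := if σ₃.ireg 25 = 0 then s else t)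
      (f := fun v => F (σ.rreg 14 +
        sampleVal G θ g k (σ₁.ireg 23) (σ₂.ireg 24) v * if σ₃.ireg 25 = 0 then 1 else -1))
      hd (fun _ => hF _) ?_ ?_ ?_ ?_).mono
      (t' := 13 * k + 1) ?_ (fun _ h => ⟨h, le_rfl⟩) le_rfl).seq fun σ₅ h₅ =>
    (Sure.triple (t := 25) (x := extend (fun v => F (σ.rreg 14 +
        sampleVal G θ g k (σ₁.ireg 23) (σ₂.ireg 24) v * if σ₃.ireg 25 = 0 then 1 else -1))
        (σ₅.ireg 26)) (Q := fun σ' => (SampleState G s t k θ x g A σ' ∧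
          σ'.rreg 15 = σ.rreg 15 + 1) ∧ F (σ'.rreg 14) = extend (fun v => F (σ.rreg 14 +
        sampleVal G θ g k (σ₁.ireg 23) (σ₂.ireg 24) v * if σ₃.ireg 25 = 0 then 1 else -1))
        (σ₅.ireg 26)) (φ := fun σ' => F (σ'.rreg 14)) ?_ fun σ' h => h.2.le).mono
      (Q' := fun σ' => SampleState G s t k θ x g A σ' ∧ σ'.rreg 15 = σ.rreg 15 + 1)
      (φ' := fun σ' => F (σ'.rreg 14)) le_rfl
      (fun σ' h => ⟨h.1, le_rfl⟩) le_rfl) ?_ (fun σ' h => ⟨h, le_rfl⟩) le_rfl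
  · exact (h.of_agree h₁.1 (by decide) (by decide)).consts.2.2.2.2.2.1
  · exact ((h.of_agree h₁.1 (by decide) (by decide)).of_agree h₂.1 (by decide) (by decide)).two
  · exact (h.of_agree ((h₁.1.trans h₂.1).trans h₃.1) (by decide) (by decide)).consts
  · exact (h.of_agree (((h₁.1.trans h₂.1).trans h₃.1).trans h₄.1) (by decide)
      (by decide)).consts.2.2.2.2.1
  · exact ((h₂.1.trans h₃.1).trans h₄.1).ireg 23 (by decide)
  · exact h₄.2.2.1
  · exact h₄.2.1
  · have := h₁.2
    omega
  · obtain ⟨hA₅, w, hw⟩ := h₅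
    have hA := (((h₁.1.trans h₂.1).trans h₃.1).trans h₄.1).trans hA₅
    have e23 := (((h₂.1.trans h₃.1).trans h₄.1).trans hA₅).ireg 23 (by decide)
    have e24 := ((h₃.1.trans h₄.1).trans hA₅).ireg 24 (by decide)
    have e27 := hA₅.rreg 27 (by decide)
    have e14 := hA.rreg 14 (by decide)
    have e15 := hA.rreg 15 (by decide)
    have hst := h.of_agree hA (by decide) (by decide)
    refine (sure_recordProg hst e23 e24 hw).mono le_rfl ?_
    rintro σ' ⟨hA', h14, h15⟩
    refine ⟨⟨hst.of_agree hA' (by decide) (by decide), by rw [h15, e15]⟩, ?_⟩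
    rw [hw, extend_coe, h14, e14, e27, h₄.2.2.2]
  · omega

end SamplePhase

/-- The sampling phase. -/
def samplePhase : Program :=
  .seq (block [.iconst 33 2, .rconst 14 0, .rconst 15 0]) (.while (.rlt 15 12) sampleBody)

section Concentration

variable {n : ℕ} {G : SimpleGraph (Fin n)} [DecidableRel G.Adj] {N : AdjLists G}

theorem sampleAvg_linear {θ : ℝ} {g : Fin n → ℝ} {k : ℕ} {s t : Fin n} (a b : ℝ) (F F' : ℝ → ℝ) :
    sampleAvg G θ g k s t (fun y => a * F y + b * F' y) =
      a * sampleAvg G θ g k s t F + b * sampleAvg G θ g k s t F' := by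
  have key : ∀ m (f f' : Fin n → ℝ) v, (lazyWalk G ^ m) (fun w => a * f w + b * f' w) v =
      a * (lazyWalk G ^ m) f v + b * (lazyWalk G ^ m) f' v := fun m f f' v => by
    have : (fun w => a * f w + b * f' w) = a • f + b • f' := rfl
    rw [this, map_add, map_smul, map_smul]
    rfl
  unfold sampleAvg
  simp only [key _ (fun v => F (sampleVal G θ g k _ _ v)) fun v => F' (sampleVal G θ g k _ _ v),
    key _ (fun v => F (-sampleVal G θ g k _ _ v)) fun v => F' (-sampleVal G θ g k _ _ v)]
  rw [mul_div_assoc', mul_div_assoc', ← add_div, Finset.mul_sum, Finset.mul_sum,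
    ← Finset.sum_add_distrib]
  congr 1
  refine Finset.sum_congr rfl fun m _ => ?_
  rw [mul_div_assoc', mul_div_assoc', ← add_div, Finset.mul_sum, Finset.mul_sum,
    ← Finset.sum_add_distrib]
  congr 1
  exact Finset.sum_congr rfl fun j _ => by ring

theorem triple_samplePhase (hd : ∀ v, 0 < G.degree v) {s t : Fin n} {k : ℕ} (hk : 0 < k)
    {θ x : ℝ} {g : Fin n → ℝ} {M : ℕ} {σ : Store} (h : LevelState G s t k θ x g M k σ)
    {B r : ℝ} (hB : ∀ m j v, |sampleVal G θ g k m j v| ≤ B) (hr : 0 ≤ r) (hrB : r * (2 * B) ≤ 1)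
    {w : ℝ} (hw : 0 ≤ w) :
    Triple G N samplePhase (⌈x⌉₊ * (13 * k + 51) + 10) σ
      (fun σ' => SampleState G s t k θ x g (∑ i ∈ Finset.range k,
        (large θ (level G θ g i) s - large θ (level G θ g i) t)) σ' ∧ σ'.rreg 15 = ⌈x⌉₊)
      (fun σ' => w * (Real.exp (r * (σ'.rreg 14 - ⌈x⌉₊ * sampleAvg G θ g k s t id)) +
        Real.exp (-r * (σ'.rreg 14 - ⌈x⌉₊ * sampleAvg G θ g k s t id))))
      (w * (2 * Real.exp (⌈x⌉₊ * (4 * r ^ 2 * B ^ 2)))) := by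
  set q := ⌈x⌉₊ with hq
  set μ := sampleAvg G θ g k s t id with hμ
  set A := ∑ i ∈ Finset.range k, (large θ (level G θ g i) s - large θ (level G θ g i) t) with hA
  set ρ := Real.exp (4 * r ^ 2 * B ^ 2) with hρ
  set ψ : ℕ → ℝ → ℝ := fun i y => w * (Real.exp (r * (y - (q - i) * μ)) +
    Real.exp (-r * (y - (q - i) * μ))) * ρ ^ i with hψ
  have hψ0 : ∀ i y, 0 ≤ ψ i y := fun i y => by positivity
  have hloop := fun σ' (h' : SampleState G s t k θ x g A σ' ∧ σ'.rreg 15 = q - q ∧ q ≤ q) =>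
    triple_while_count (G := G) (N := N) (b := .rlt 15 12) (p := sampleBody) (t := 13 * k + 50)
    (fun i σ' => SampleState G s t k θ x g A σ' ∧ σ'.rreg 15 = q - i ∧ i ≤ q)
    (fun i σ' => ψ i (σ'.rreg 14)) (fun i σ' h' => ?_) (fun σ' h' => ?_) (k := q) (σ := σ') (by exact h')
  · refine Triple.mono ((sure_block (Q := fun σ' => (SampleState G s t k θ x g A σ' ∧
      σ'.rreg 15 = q - q ∧ q ≤ q) ∧ σ'.rreg 14 = 0) rfl ?_).seq_triple
      (x := w * (2 * Real.exp (q * (4 * r ^ 2 * B ^ 2)))) fun σ₁ h₁ =>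
      (hloop σ₁ h₁.1).mono le_rfl (fun _ h => ⟨h, le_rfl⟩) ?_) ?_ (fun σ' h => ⟨⟨h.1, ?_⟩, ?_⟩) le_rfl
    · obtain ⟨c0, c1, c2, c3, c4, c5, cr3, cr10, cr12, cr17, cr25⟩ := h.consts
      have hv := h.view_zero
      simp only [view] at hv
      refine ⟨⟨⟨?_, ?_, ?_, fun i hi v => ?_, fun i hi => ?_⟩, ?_, le_rfl⟩, ?_⟩
      · simp [Consts, effect, Store.setI, Store.setR, c0, c1, c2, c3, c4, c5, cr3, cr10, cr12, cr17,
          cr25]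
      · simp [effect, Store.setI, Store.setR]
      · simp [effect, Store.setI, Store.setR, h.acc, hA]
      · simp [view, effect, Store.setI, Store.setR, hv, hi]
      · simpa [effect, Store.setI, Store.setR] using h.base i hi
      · simp [effect, Store.setI, Store.setR]
      · simp [effect, Store.setI, Store.setR]
    · simp only [hψ, h₁.2, sub_self, zero_mul, mul_zero, Real.exp_zero]
      rw [hρ, ← Real.exp_nat_mul]
      refine le_of_eq ?_
      ring
    · simp
      linarith
    · simpa using h.2.1
    · simp [hψ]
  · obtain ⟨hst, h15, hi⟩ := h'
    have hi' : ((i + 1 : ℕ) : ℝ) ≤ q := by exact_mod_cast hi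
    push_cast at hi' h15
    refine ⟨?_, ?_⟩
    · simp only [Test.Holds, h15, hst.consts.2.2.2.2.2.2.2.2.1]
      have : q - (i + 1) < q := by omega
      have := Nat.lt_ceil.1 this
      rw [Nat.cast_sub hi] at this
      exact_mod_cast this
    · refine (triple_sampleBody hd hk hst (hψ0 i)).mono le_rfl (fun σ'' h'' => ⟨⟨h''.1, ?_, by omega⟩,
        le_rfl⟩) ?_
      · rw [h''.2, h15]
        ring
      · have hexp : ∀ y, ψ i (σ'.rreg 14 + y) =
            w * Real.exp (r * (σ'.rreg 14 - (q - (i + 1)) * μ)) * ρ ^ i * Real.exp (r * (y - μ)) +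
            w * Real.exp (-r * (σ'.rreg 14 - (q - (i + 1)) * μ)) * ρ ^ i * Real.exp (-r * (y - μ)) := by
          intro y
          have e1 : ∀ r' : ℝ, Real.exp (r' * (σ'.rreg 14 + y - (q - i) * μ)) =
              Real.exp (r' * (σ'.rreg 14 - (q - (i + 1)) * μ)) * Real.exp (r' * (y - μ)) :=
            fun r' => by
              rw [← Real.exp_add]
              congr 1
              ring
          simp only [hψ, e1]
          ring
        simp only [hexp]
        rw [sampleAvg_linear]
        have h1 := sampleAvg_exp_le (s := s) (t := t) hd hk hB (r := r) (by rwa [abs_of_nonneg hr])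
        have h2 := sampleAvg_exp_le (s := s) (t := t) hd hk hB (r := -r)
          (by rwa [abs_neg, abs_of_nonneg hr])
        rw [neg_sq] at h2
        calc _ ≤ w * Real.exp (r * (σ'.rreg 14 - (q - (i + 1)) * μ)) * ρ ^ i * ρ +
              w * Real.exp (-r * (σ'.rreg 14 - (q - (i + 1)) * μ)) * ρ ^ i * ρ := by gcongr
          _ = _ := by
            simp only [hψ]
            push_cast
            ring
  · obtain ⟨hst, h15, -⟩ := h'
    simp only [Test.Holds, h15, hst.consts.2.2.2.2.2.2.2.2.1, Nat.cast_zero, sub_zero, not_lt]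
    exact Nat.le_ceil x

end Concentration

/-! ### The algorithm -/

/-- Combine the estimates. -/
def outputProg : Program :=
  block [.rdiv 14 14 15, .rmul 14 14 10, .rmul 14 14 10, .rdiv 13 13 17, .radd 0 13 14]

/-- The algorithm. -/
def mainProg (a : ℕ) : Program :=
  .ite (.ieq 1 2) (block [.rconst 0 0])
    (.seq (setupProg a) (.seq pushPhase (.seq samplePhase outputProg)))

theorem two_mul_exp_le {n : ℝ} {l c : ℕ} (hn : 0 < n) (hl : n ≤ 2 ^ l) {y : ℝ}
    (hy : (c + 1) * (1 + l) ≤ y) : 2 * Real.exp (-y) ≤ 1 / n ^ c := by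
  have h1 : Real.exp (-1 : ℝ) ≤ 1 / 2 := by
    have := Real.add_one_le_exp (1 : ℝ)
    rw [Real.exp_neg, ← one_div]
    exact one_div_le_one_div_of_le two_pos (by linarith)
  have h2 : Real.exp (-y) ≤ (1 / 2) ^ ((c + 1) * (1 + l)) := by
    calc Real.exp (-y) ≤ Real.exp (((c + 1) * (1 + l) : ℕ) * (-1 : ℝ)) := by
          rw [Real.exp_le_exp]
          push_cast
          linarith
      _ = Real.exp (-1 : ℝ) ^ ((c + 1) * (1 + l)) := Real.exp_nat_mul _ _
      _ ≤ _ := pow_le_pow_left₀ (Real.exp_pos _).le h1 _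
  have h3 : ((1 : ℝ) / 2) ^ ((c + 1) * (1 + l)) ≤ 1 / 2 * (1 / n ^ c) := by
    have e : (c + 1) * (1 + l) = l * c + (1 + l + c) := by ring
    rw [e, pow_add, pow_mul, mul_comm]
    have h4 : ((1 : ℝ) / 2) ^ (1 + l + c) ≤ 1 / 2 := by
      calc ((1 : ℝ) / 2) ^ (1 + l + c) ≤ (1 / 2) ^ 1 :=
            pow_le_pow_of_le_one (by norm_num) (by norm_num) (by omega)
        _ = _ := pow_one _
    have h5 : (((1 : ℝ) / 2) ^ l) ^ c ≤ 1 / n ^ c := by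
      rw [← one_div_pow]
      refine pow_le_pow_left₀ (by positivity) ?_ c
      rw [one_div_pow]
      exact one_div_le_one_div_of_le hn hl
    exact mul_le_mul h4 h5 (by positivity) (by norm_num)
  linarith

/-- The choice of the parameter in the exponential moment method. -/
theorem exists_exp_parameter {n b k d ε q : ℝ} {l c : ℕ} (hn : 0 < n) (hl : n ≤ 2 ^ l)
    (hε : 0 < ε) (hε1 : ε < 1) (hb : 1 ≤ b) (hk : 1 ≤ k) (hd : 0 < d) (hbd : b ≤ d)
    (hdb : d ≤ b * b) (hq : 256 * (c + 1) * (1 + l) * (k * k * b) / ε ≤ q) :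
    ∃ r : ℝ, 0 ≤ r ∧ r * (2 * √(ε / (k * k * b) / d)) ≤ 1 ∧
      Real.exp (-(r * (q * (ε / (4 * d * k ^ 2))))) *
        (2 * Real.exp (q * (4 * r ^ 2 * √(ε / (k * k * b) / d) ^ 2))) ≤ 1 / n ^ c := by
  have hb0 : 0 < b := by linarith
  have hk0 : 0 < k := by linarith
  have hB0 : 0 < √(ε / (k * k * b) / d) := Real.sqrt_pos.2 (by positivity)
  have hB2 : √(ε / (k * k * b) / d) ^ 2 = ε / (k * k * b) / d := Real.sq_sqrt (by positivity)
  generalize √(ε / (k * k * b) / d) = B at hB0 hB2 ⊢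
  obtain ⟨δ, hδ⟩ : ∃ δ, δ = ε / (4 * d * k ^ 2) := ⟨_, rfl⟩
  rw [← hδ]
  have hδ0 : 0 < δ := by
    rw [hδ]
    positivity
  have hδB : δ ≤ 4 * B := by
    refine abs_le_of_sq_le_sq' ?_ (by positivity) |>.2
    have h2 : ε * b ≤ 256 * (d * k ^ 2) := by
      have : ε * b ≤ 1 * d := mul_le_mul hε1.le hbd (by positivity) (by norm_num)
      have h3 : (1 : ℝ) ≤ k ^ 2 := one_le_pow₀ hk
      nlinarith
    calc δ ^ 2 = ε * b * (ε / (16 * (d ^ 2 * k ^ 4 * b))) := by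
          rw [hδ]
          field_simp
          ring
      _ ≤ 256 * (d * k ^ 2) * (ε / (16 * (d ^ 2 * k ^ 4 * b))) := by gcongr
      _ = _ := by
          rw [mul_pow, hB2]
          field_simp
          ring
  refine ⟨δ / (8 * B ^ 2), by positivity, ?_, ?_⟩
  · rw [div_mul_eq_mul_div, div_le_one (by positivity)]
    nlinarith
  · have e1 : Real.exp (-(δ / (8 * B ^ 2) * (q * δ))) *
        (2 * Real.exp (q * (4 * (δ / (8 * B ^ 2)) ^ 2 * B ^ 2))) =
        2 * Real.exp (-(q * (δ ^ 2 / (16 * B ^ 2)))) := by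
      rw [mul_left_comm, ← Real.exp_add]
      congr 2
      field_simp
      ring
    rw [e1]
    refine two_mul_exp_le hn hl ?_
    have e2 : δ ^ 2 / (16 * B ^ 2) = ε * b / (256 * d * k ^ 2) := by
      rw [hB2, hδ]
      field_simp
      ring
    have e3 : 256 * (c + 1) * (1 + l) * (k * k * b) / ε * (ε * b / (256 * d * k ^ 2)) =
        (c + 1) * (1 + l) * (b * b / d) := by
      field_simp
    calc ((c : ℝ) + 1) * (1 + l) ≤ (c + 1) * (1 + l) * (b * b / d) := by
          refine le_mul_of_one_le_right (by positivity) ?_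
          rwa [one_le_div hd]
      _ = 256 * (c + 1) * (1 + l) * (k * k * b) / ε * (δ ^ 2 / (16 * B ^ 2)) := by rw [e2, e3]
      _ ≤ _ := by gcongr

theorem running_time_le {b e l k M q a : ℕ} {ε : ℝ} (hε : 0 < ε) (hε1 : ε < 1) (hb : 1 ≤ b)
    (hk : 1 ≤ k) (hek : e ≤ k) (hM : (M : ℝ) ≤ 4 / (ε / (k * k * b)))
    (hq : (q : ℝ) ≤ a * (1 + l) * (k * k * b) / ε + 1) :
    ((6 * (b + e + l + k) + 200 + (k * (80 * M + 51) + 50) + (q * (13 * k + 51) + 10) + 20 : ℕ) : ℝ)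
      ≤ (800 + 64 * a) * ((1 + l) * k ^ 3 * b / ε) := by
  have hb' : (1 : ℝ) ≤ b := by exact_mod_cast hb
  have hk' : (1 : ℝ) ≤ k := by exact_mod_cast hk
  have hek' : (e : ℝ) ≤ k := by exact_mod_cast hek
  have hl' : (0 : ℝ) ≤ l := Nat.cast_nonneg l
  have ha' : (0 : ℝ) ≤ a := Nat.cast_nonneg a
  set W : ℝ := k * k * b / ε with hW
  have hWb : (b : ℝ) ≤ W := by
    rw [hW, le_div_iff₀ hε]
    have : (1 : ℝ) ≤ k * k := by nlinarith
    nlinarith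
  set U : ℝ := (1 + l) * k ^ 3 * b / ε with hU
  have hUW : U = (1 + l) * k * W := by
    rw [hU, hW]
    ring
  have hkW : (k : ℝ) ≤ k * W := by nlinarith
  have hWk : W ≤ k * W := by nlinarith
  have hkWU : k * W ≤ U := by
    rw [hUW]
    have : 0 ≤ l * (k * W) := by positivity
    linarith
  have hlU : (l : ℝ) ≤ U := by
    rw [hUW]
    have h1 : (1 : ℝ) ≤ k * W := by linarith
    nlinarith
  have hM' : (M : ℝ) ≤ 4 * W := by
    refine hM.trans (le_of_eq ?_)
    rw [hW]
    field_simp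
  have hq' : (q : ℝ) ≤ a * (1 + l) * W + 1 := by
    refine hq.trans (le_of_eq ?_)
    rw [hW]
    ring
  have h1 : k * (80 * (M : ℝ) + 51) ≤ 320 * (k * W) + 51 * k := by nlinarith
  have h2 : (q : ℝ) * (13 * k + 51) ≤ 64 * a * U + 64 * k := by
    calc (q : ℝ) * (13 * k + 51) ≤ (a * (1 + l) * W + 1) * (64 * k) := by
          refine mul_le_mul hq' (by linarith) (by positivity) (by positivity)
      _ = _ := by
          rw [hUW]
          ring
  push_cast
  linarith

section Correctness

variable {n : ℕ} {G : SimpleGraph (Fin n)} [DecidableRel G.Adj] {N : AdjLists G}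

theorem abs_source_le {s t : Fin n} (hst : s ≠ t) (hd : ∀ v, 0 < G.degree v) (v : Fin n) :
    |source G s t v| ≤ 1 / (min (G.degree s) (G.degree t) : ℕ) := by
  have hmin : (0 : ℝ) < (min (G.degree s) (G.degree t) : ℕ) := by
    exact_mod_cast lt_min (hd s) (hd t)
  unfold source
  rw [abs_div, Nat.abs_cast]
  by_cases hs : v = s
  · subst hs
    simp only [Pi.sub_apply, Pi.single_eq_same, Pi.single_eq_of_ne hst, sub_zero, abs_one]
    exact one_div_le_one_div_of_le hmin (by exact_mod_cast min_le_left _ _)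
  · by_cases ht : v = t
    · subst ht
      simp only [Pi.sub_apply, Pi.single_eq_same, Pi.single_eq_of_ne hst.symm, zero_sub, abs_neg,
        abs_one]
      exact one_div_le_one_div_of_le hmin (by exact_mod_cast min_le_right _ _)
    · simp [hs, ht]

theorem sum_degree_mul_abs_source_le {s t : Fin n} (hd : ∀ v, 0 < G.degree v) :
    ∑ v, G.degree v * |source G s t v| ≤ 2 := by
  have h : ∀ v, G.degree v * |source G s t v| ≤
      (Pi.single s 1 : Fin n → ℝ) v + (Pi.single t 1 : Fin n → ℝ) v := fun v => by
    have hv : (0 : ℝ) < G.degree v := by exact_mod_cast hd v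
    unfold source
    rw [abs_div, Nat.abs_cast, mul_div_cancel₀ _ hv.ne']
    have h1 : ∀ w : Fin n, 0 ≤ (Pi.single w 1 : Fin n → ℝ) v := fun w => by
      rw [Pi.single_apply]
      split_ifs <;> norm_num
    refine (abs_sub _ _).trans (le_of_eq ?_)
    rw [abs_of_nonneg (h1 s), abs_of_nonneg (h1 t)]
  refine (Finset.sum_le_sum fun v _ => h v).trans (le_of_eq ?_)
  rw [Finset.sum_add_distrib]
  simp
  norm_num

theorem abs_sampleVal_le {s t : Fin n} (hst : s ≠ t) (hd : ∀ v, 0 < G.degree v) {θ : ℝ}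
    (hθ : 0 ≤ θ) (k m j : ℕ) (v : Fin n) : |sampleVal G θ (source G s t) k m j v| ≤
      √(θ / (min (G.degree s) (G.degree t) : ℕ)) := by
  unfold sampleVal
  split_ifs
  · obtain ⟨h1, h2⟩ := abs_residual_le hd hθ (abs_source_le hst hd) j v
    refine Real.le_sqrt_of_sq_le ?_
    rw [sq, div_eq_mul_one_div]
    exact mul_le_mul h1 h2 (abs_nonneg _) hθ
  · rw [abs_zero]
    exact Real.sqrt_nonneg _

/-- If the average of the samples is close to its expectation, then the output is close to the
effective resistance. -/
theorem approxEq_of_abs_sub_lt (hG : G.Connected) (hd : ∀ v, 0 < G.degree v) {κ : ℝ} (hκ0 : 0 < κ)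
    (hκ : ∀ i, eigval (G := G) i = 0 ∨ 1 ≤ κ * eigval (G := G) i) {s t : Fin n} (hst : s ≠ t)
    {k e : ℕ} (hk : 0 < k) {ε : ℝ} (hε : 0 < ε) (he : 4 ≤ ε * 2 ^ e) (hke : κ * e * 2 ≤ k)
    {θ z : ℝ} (hz : |z - sampleAvg G θ (source G s t) k s t id| <
      ε / (4 * (min (G.degree s) (G.degree t) : ℕ) * k ^ 2)) :
    ApproxEq ε ((∑ i ∈ Finset.range k, (large θ (level G θ (source G s t) i) s -
      large θ (level G θ (source G s t) i) t)) / 2 + k ^ 2 * z) (effRes G s t) := by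
  have hk' : (0 : ℝ) < k := by exact_mod_cast hk
  have hd' : (0 : ℝ) < (min (G.degree s) (G.degree t) : ℕ) := by
    exact_mod_cast lt_min (hd s) (hd t)
  have h1 := truncation_bounds hG hd hκ0 hκ s t k
  rw [truncation_eq θ _ hk] at h1
  set μ := sampleAvg G θ (source G s t) k s t id with hμ
  set A := ∑ i ∈ Finset.range k, (large θ (level G θ (source G s t) i) s -
      large θ (level G θ (source G s t) i) t) with hA
  have hr := le_effRes hG hd hκ0 hκ hst
  set R := effRes G s t with hR
  set d : ℝ := ((min (G.degree s) (G.degree t) : ℕ) : ℝ) with hdd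
  have hR0 : 0 < R := lt_of_lt_of_le (by positivity) hr
  have hexp : Real.exp (-(k / (2 * κ))) ≤ ε / 4 := by
    have h2 : (e : ℝ) ≤ k / (2 * κ) := by
      rw [le_div_iff₀ (by positivity)]
      linarith
    calc Real.exp (-(k / (2 * κ))) ≤ Real.exp (e * (-1 : ℝ)) := by
          rw [Real.exp_le_exp]
          linarith
      _ = (Real.exp 1)⁻¹ ^ e := by rw [Real.exp_nat_mul, Real.exp_neg]
      _ ≤ (2 : ℝ)⁻¹ ^ e := by
          gcongr
          linarith [Real.add_one_le_exp (1 : ℝ)]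
      _ ≤ _ := by
          rw [inv_pow, inv_le_comm₀ (by positivity) (by positivity), inv_div,
            div_le_iff₀ hε]
          linarith
  have herr : |k ^ 2 * z - k ^ 2 * μ| < ε / 2 * R := by
    rw [← mul_sub, abs_mul, abs_of_pos (by positivity)]
    calc (k : ℝ) ^ 2 * |z - μ| < k ^ 2 * (ε / (4 * d * k ^ 2)) := by gcongr
      _ = ε / 2 * (1 / (2 * d)) := by field_simp; ring
      _ ≤ _ := by gcongr
  rw [abs_lt] at herr
  have hexp' := mul_le_mul_of_nonneg_right hexp hR0.le
  constructor <;> nlinarith [h1.1, h1.2, herr.1, herr.2, mul_pos hε hR0]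

theorem sure_outputProg {σ : Store} {y z : ℝ} (h10 : σ.rreg 10 = y) (h15 : σ.rreg 15 = z)
    (h17 : σ.rreg 17 = 2) : Sure G N outputProg 11 σ
      fun σ' => σ'.rreg 0 = σ.rreg 13 / 2 + y ^ 2 * (σ.rreg 14 / z) := by
  refine sure_block rfl ?_
  simp [effect, Store.setR, h10, h15, h17]
  ring

open Classical in
theorem triple_sample_output (hG : G.Connected) (hd : ∀ v, 0 < G.degree v) {κ : ℝ} (hκ0 : 0 < κ)
    (hκ : ∀ i, eigval (G := G) i = 0 ∨ 1 ≤ κ * eigval (G := G) i) {s t : Fin n} (hst : s ≠ t)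
    {k e : ℕ} (hk : 0 < k) {ε : ℝ} (hε : 0 < ε) (he : 4 ≤ ε * 2 ^ e) (hke : κ * e * 2 ≤ k)
    {θ x r : ℝ} (hθ : 0 ≤ θ) (hx : 0 < x) (hr : 0 ≤ r)
    (hrB : r * (2 * √(θ / (min (G.degree s) (G.degree t) : ℕ))) ≤ 1) {M : ℕ} {σ : Store}
    (h : LevelState G s t k θ x (source G s t) M k σ) :
    Triple G N (.seq samplePhase outputProg) (⌈x⌉₊ * (13 * k + 51) + 10 + 12) σ
      (fun _ => True) (fun σ' => if ApproxEq ε (σ'.rreg 0) (effRes G s t) then 0 else 1)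
      (Real.exp (-(r * (⌈x⌉₊ * (ε / (4 * (min (G.degree s) (G.degree t) : ℕ) * k ^ 2))))) *
        (2 * Real.exp (⌈x⌉₊ * (4 * r ^ 2 *
          √(θ / (min (G.degree s) (G.degree t) : ℕ)) ^ 2)))) := by
  obtain ⟨δ, hδ⟩ : ∃ δ, δ = ε / (4 * (min (G.degree s) (G.degree t) : ℕ) * k ^ 2) := ⟨_, rfl⟩
  refine ((triple_samplePhase hd hk h (fun m j v => abs_sampleVal_le hst hd hθ k m j v) hr hrB
    (Real.exp_pos _).le).seq fun σ₃ h₃ => ((sure_outputProg h₃.1.consts.2.2.2.2.2.2.2.1 h₃.2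
      h₃.1.consts.2.2.2.2.2.2.2.2.2.1).triple fun σ' h' => ?_).mono
      le_rfl (fun _ _ => ⟨trivial, le_rfl⟩) le_rfl).mono (le_of_eq (add_assoc _ 11 1))
      (fun _ h => ⟨h, le_rfl⟩) le_rfl
  · rw [h', h₃.1.acc]
    split_ifs with happ
    · positivity
    · rw [← hδ]
      generalize hμ : sampleAvg G θ (source G s t) k s t id = μ
      have hz : δ ≤ |σ₃.rreg 14 / ⌈x⌉₊ - μ| := not_lt.1 fun hlt =>
        happ (approxEq_of_abs_sub_lt hG hd hκ0 hκ hst hk hε he hke (by rwa [hμ, ← hδ]))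
      have hq : (0 : ℝ) < ⌈x⌉₊ := by exact_mod_cast Nat.ceil_pos.2 hx
      have hS : σ₃.rreg 14 - ⌈x⌉₊ * μ = ⌈x⌉₊ * (σ₃.rreg 14 / ⌈x⌉₊ - μ) := by field_simp
      rw [hS, mul_add, ← Real.exp_add, ← Real.exp_add]
      rcases le_abs.1 hz with h1 | h1
      · have : 1 ≤ Real.exp (-(r * (⌈x⌉₊ * δ)) + r * (⌈x⌉₊ * (σ₃.rreg 14 / ⌈x⌉₊ - μ))) := by
          rw [Real.one_le_exp_iff, ← sub_eq_neg_add, sub_nonneg]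
          gcongr
        exact this.trans (le_add_of_nonneg_right (Real.exp_pos _).le)
      · have : 1 ≤ Real.exp (-(r * (⌈x⌉₊ * δ)) + -r * (⌈x⌉₊ * (σ₃.rreg 14 / ⌈x⌉₊ - μ))) := by
          rw [Real.one_le_exp_iff]
          linarith [mul_le_mul_of_nonneg_left (mul_le_mul_of_nonneg_left h1 hq.le) hr]
        exact this.trans (le_add_of_nonneg_left (Real.exp_pos _).le)

open Classical in
theorem triple_mainProg (hG : G.Connected) (hd : ∀ v, 0 < G.degree v) {κ : ℝ} (hκ0 : 1 / 2 ≤ κ)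
    (hκ : ∀ i, eigval (G := G) i = 0 ∨ 1 ≤ κ * eigval (G := G) i) (s t : Fin n)
    {ε : ℝ} (hε : 0 < ε) (hε1 : ε < 1) {a c : ℕ}
    (ha : (a : ℝ) = 256 * (c + 1)) {b e l k : ℕ}
    (hb0 : ∀ i < b, i * i < min (G.degree s) (G.degree t))
    (hb1 : min (G.degree s) (G.degree t) ≤ b * b)
    (he0 : ∀ i < e, ε * 2 ^ i < 4) (he1 : 4 ≤ ε * 2 ^ e)
    (hl0 : ∀ i < l, 2 ^ i < n) (hl1 : n ≤ 2 ^ l) (hk : k = ⌈κ * e * 2⌉₊) :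
    ∃ τ : ℕ, (τ : ℝ) ≤ (800 + 64 * a) * ((1 + l) * k ^ 3 * b / ε) ∧
      ∀ σ : Store, σ.ireg 0 = n → σ.ireg 1 = s → σ.ireg 2 = t → σ.rreg 0 = ε → σ.rreg 1 = κ →
        (σ.iarr = fun _ _ => 0) → (σ.rarr = fun _ _ => 0) →
        Triple G N (mainProg a) τ σ (fun _ => True)
          (fun σ' => if ApproxEq ε (σ'.rreg 0) (effRes G s t) then 0 else 1) (1 / n ^ c) := by
  have hn0 : 0 < n := s.pos
  have hd0 : 0 < min (G.degree s) (G.degree t) := lt_min (hd s) (hd t)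
  have hb : 1 ≤ b := by
    rcases Nat.eq_zero_or_pos b with rfl | h
    · simp at hb1
      omega
    · exact h
  have he : 1 ≤ e := by
    rcases Nat.eq_zero_or_pos e with rfl | h
    · simp at he1
      linarith
    · exact h
  have hke : κ * e * 2 ≤ k := hk ▸ Nat.le_ceil _
  have hek : e ≤ k := by
    have h1 : (e : ℝ) ≤ κ * e * 2 := by
      have : (0 : ℝ) ≤ e := Nat.cast_nonneg e
      nlinarith
    exact_mod_cast h1.trans hke
  have hk1 : 1 ≤ k := he.trans hek
  have hk' : (1 : ℝ) ≤ k := by exact_mod_cast hk1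
  have hb' : (1 : ℝ) ≤ b := by exact_mod_cast hb
  set d := min (G.degree s) (G.degree t) with hdd
  have hd' : (0 : ℝ) < d := by exact_mod_cast hd0
  have hbd : b ≤ d := by
    by_contra h
    have := hb0 d (by omega)
    nlinarith
  set θ := ε / (k * k * b) with hθ
  have hθ0 : 0 < θ := by positivity
  have hθ1 : θ ≤ 1 := by
    rw [hθ, div_le_one (by positivity)]
    have : (1 : ℝ) ≤ k * k := by nlinarith
    nlinarith
  set x := a * (1 + l) * (k * k * b) / ε with hx
  have hx0 : 0 < x := by
    rw [hx, ha]
    positivity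
  set M := ⌊4 / θ⌋₊ with hM
  have hM4 : (M : ℝ) ≤ 4 / θ := Nat.floor_le (by positivity)
  refine ⟨6 * (b + e + l + k) + 200 + (k * (80 * M + 51) + 50) + (⌈x⌉₊ * (13 * k + 51) + 10) + 20,
    running_time_le hε hε1 hb hk1 hek hM4 (Nat.ceil_lt_add_one (by positivity)).le,
    fun σ hn hs ht hr0 hr1 hia hra => ?_⟩
  by_cases hst : s = t
  · refine Triple.mono (triple_ite (t := 3) (fun _ => (sure_block (Q := fun σ' => σ'.rreg 0 = 0)
      (l := [.rconst 0 0]) rfl ?_).triple (x := 0) fun σ' h => ?_) fun h => ?_) (by omega)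
      (fun _ _ => ⟨trivial, le_rfl⟩) (by positivity)
    · simp [effect, Store.setR]
    · subst hst
      simp [h, ApproxEq, effRes]
    · simp [Test.Holds, hs, ht, hst] at h
  have hMj : ∀ j, ∑ u ∈ bigSet G θ (source G s t) j, (G.degree u + 1) ≤ M := fun j => by
    refine Nat.le_floor ((sum_bigSet_le hd hθ0 (sum_degree_mul_abs_source_le hd) j).trans
      (le_of_eq ?_))
    norm_num
  have hM2 : 2 ≤ M := by
    refine Nat.le_floor ?_
    rw [le_div_iff₀ hθ0]
    push_cast
    linarith
  obtain ⟨r, hr, hrB, hfail⟩ := exists_exp_parameter (q := ⌈x⌉₊) (c := c) (n := n)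
    (by exact_mod_cast hn0) (by exact_mod_cast hl1) hε hε1 hb' hk' hd' (by exact_mod_cast hbd)
    (by exact_mod_cast hb1) (by rw [← ha]; exact Nat.le_ceil x)
  have hsetup := sure_setupProg (G := G) (N := N) (s := s) (t := t) (b := b) (e := e) (l := l)
    (k := k) a hn hs ht hb0 hb1 (by rwa [hr0]) (by rwa [hr0]) hl0 hl1 (by rw [hr1, hk])
  rw [hr0, ← hθ, ← hx] at hsetup
  refine Triple.mono (triple_ite (fun h => ?_) fun _ => hsetup.seq_triple fun σ₁ h₁ =>
    (sure_pushPhase hst hθ0.le hMj hM2 h₁.1 h₁.2.1 h₁.2.2.1 (h₁.2.2.2.1.trans hia)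
      (h₁.2.2.2.2.trans hra)).seq_triple fun σ₂ h₂ => triple_sample_output hG hd (by linarith) hκ
        hst hk1 hε he1 hke hθ0.le hx0 hr hrB h₂) (by omega) (fun _ _ => ⟨trivial, le_rfl⟩) hfail
  simp only [Test.Holds, hs, ht] at h
  exact absurd (Fin.ext h) hst

end Correctness

/-! ### Size of the parameters -/

theorem exists_sqrt_ceil {d : ℕ} (hd : 0 < d) :
    ∃ b : ℕ, (∀ i < b, i * i < d) ∧ d ≤ b * b ∧ (b : ℝ) ≤ 2 * √d := by
  classical
  have hex : ∃ b : ℕ, d ≤ b * b := ⟨d, Nat.le_mul_self d⟩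
  refine ⟨Nat.find hex, fun i hi => not_le.1 (Nat.find_min hex hi), Nat.find_spec hex, ?_⟩
  have h1 : (1 : ℝ) ≤ √d := by
    rw [Real.one_le_sqrt]
    exact_mod_cast hd
  rcases hb : Nat.find hex with _ | b
  · simp
  · have h2 : b * b < d := not_le.1 (Nat.find_min hex (by omega))
    have h3 : (b : ℝ) ≤ √d := Real.le_sqrt_of_sq_le (by rw [sq]; exact_mod_cast h2.le)
    push_cast
    linarith

theorem exists_log_ceil {n : ℕ} (hn : 2 ≤ n) :
    ∃ l : ℕ, (∀ i < l, 2 ^ i < n) ∧ n ≤ 2 ^ l ∧ (1 + l : ℝ) ≤ 5 * Real.log n ∧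
      Real.log n ≤ 1 + l := by
  classical
  have hex : ∃ l : ℕ, n ≤ 2 ^ l := ⟨n, Nat.lt_two_pow_self.le⟩
  have hn0 : (0 : ℝ) < n := by exact_mod_cast (by omega : 0 < n)
  have h2 : Real.log 2 ≤ Real.log n := Real.log_le_log two_pos (by exact_mod_cast hn)
  have h69 := Real.log_two_gt_d9
  have h70 := Real.log_two_lt_d9
  refine ⟨Nat.find hex, fun i hi => not_le.1 (Nat.find_min hex hi), Nat.find_spec hex, ?_, ?_⟩
  · rcases hb : Nat.find hex with _ | l
    · simp
      linarith
    · have h3 : 2 ^ l < n := not_le.1 (Nat.find_min hex (by omega))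
      have h4 : l * Real.log 2 ≤ Real.log n := by
        rw [← Real.log_pow]
        exact Real.log_le_log (by positivity) (by exact_mod_cast h3.le)
      have hl : (0 : ℝ) ≤ l := Nat.cast_nonneg l
      push_cast
      nlinarith
  · have h3 : Real.log n ≤ Nat.find hex * Real.log 2 := by
      rw [← Real.log_pow]
      exact Real.log_le_log hn0 (by exact_mod_cast Nat.find_spec hex)
    have hl : (0 : ℝ) ≤ Nat.find hex := Nat.cast_nonneg _
    nlinarith

theorem exists_precision {n : ℕ} (hn : 2 ≤ n) {ε : ℝ} (hε : 0 < ε) (hε1 : ε < 1) :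
    ∃ e : ℕ, (∀ i < e, ε * 2 ^ i < 4) ∧ 4 ≤ ε * 2 ^ e ∧ (e + 1 : ℝ) ≤ 8 * Real.log (n / ε) := by
  classical
  have hex : ∃ e : ℕ, 4 ≤ ε * 2 ^ e := by
    obtain ⟨e, he⟩ := pow_unbounded_of_one_lt (4 / ε) (one_lt_two (α := ℝ))
    exact ⟨e, by rw [div_lt_iff₀ hε] at he; linarith⟩
  have hn0 : (0 : ℝ) < n := by exact_mod_cast (by omega : 0 < n)
  have h2 : Real.log 2 ≤ Real.log n := Real.log_le_log two_pos (by exact_mod_cast hn)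
  have h69 := Real.log_two_gt_d9
  have h70 := Real.log_two_lt_d9
  refine ⟨Nat.find hex, fun i hi => not_le.1 (Nat.find_min hex hi), Nat.find_spec hex, ?_⟩
  rw [Real.log_div hn0.ne' hε.ne']
  rcases hb : Nat.find hex with _ | e
  · have h3 := Nat.find_spec hex
    rw [hb] at h3
    linarith
  · have h3 : ε * 2 ^ e < 4 := not_le.1 (Nat.find_min hex (by omega))
    have h4 : Real.log ε + e * Real.log 2 ≤ 2 * Real.log 2 := by
      rw [← Real.log_pow, ← Real.log_mul hε.ne' (by positivity)]
      have : 2 * Real.log 2 = Real.log (2 ^ 2) := by rw [Real.log_pow]; norm_num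
      rw [this]
      exact Real.log_le_log (by positivity) (by linarith)
    have he : (0 : ℝ) ≤ e * (Real.log 2 - 0.6931471803) :=
      mul_nonneg (Nat.cast_nonneg e) (by linarith)
    have hlog := Real.log_neg hε hε1
    push_cast
    linarith

open Classical in
/-- The part of the statement that concerns the algorithm for a given bound on the condition
number. -/
theorem exists_triple_mainProg {n : ℕ} {G : SimpleGraph (Fin n)} [DecidableRel G.Adj]
    {N : AdjLists G} (hn2 : 2 ≤ n) (hG : G.Connected) (hd : ∀ v, 0 < G.degree v) {κ : ℝ}
    (hκ0 : 1 / 2 ≤ κ) (hκ : ∀ i, eigval (G := G) i = 0 ∨ 1 ≤ κ * eigval (G := G) i) (s t : Fin n)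
    {ε : ℝ} (hε : 0 < ε) (hε1 : ε < 1) {a c : ℕ} (ha : (a : ℝ) = 256 * (c + 1)) {l : ℕ}
    (hl0 : ∀ i < l, 2 ^ i < n) (hl1 : n ≤ 2 ^ l) (hl : (1 + l : ℝ) ≤ 5 * Real.log n) :
    ∃ τ : ℕ, (τ : ℝ) ≤ (800 + 64 * a) * 40960 * (Real.log (n / ε) ^ 4 *
        (κ ^ 3 * (√(min (G.degree s) (G.degree t) : ℕ) / ε))) ∧
      ∀ σ : Store, σ.ireg 0 = n → σ.ireg 1 = s → σ.ireg 2 = t → σ.rreg 0 = ε → σ.rreg 1 = κ →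
        (σ.iarr = fun _ _ => 0) → (σ.rarr = fun _ _ => 0) →
        Triple G N (mainProg a) τ σ (fun _ => True)
          (fun σ' => if ApproxEq ε (σ'.rreg 0) (effRes G s t) then 0 else 1) (1 / n ^ c) := by
  obtain ⟨b, hb0, hb1, hb⟩ := exists_sqrt_ceil (lt_min (hd s) (hd t))
  obtain ⟨e, he0, he1, he⟩ := exists_precision hn2 hε hε1
  obtain ⟨τ, hτ, h⟩ := triple_mainProg (N := N) hG hd hκ0 hκ s t hε hε1 ha hb0 hb1 he0 he1 hl0 hl1
    rfl
  refine ⟨τ, hτ.trans ?_, h⟩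
  have hn0 : (0 : ℝ) < n := by exact_mod_cast (by omega : 0 < n)
  have hΛ : Real.log n ≤ Real.log (n / ε) :=
    Real.log_le_log hn0 (by rw [le_div_iff₀ hε]; nlinarith)
  set Λ := Real.log (n / ε)
  have he' : (0 : ℝ) ≤ e := Nat.cast_nonneg e
  have hk : (⌈κ * e * 2⌉₊ : ℝ) ≤ 16 * κ * Λ := by
    have h1 := (Nat.ceil_lt_add_one (show 0 ≤ κ * e * 2 by positivity)).le
    nlinarith
  have hΛ0 : 0 ≤ Λ := by linarith
  rw [mul_assoc (800 + 64 * (a : ℝ)) 40960]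
  refine mul_le_mul_of_nonneg_left ?_ (by positivity)
  calc (1 + l : ℝ) * (⌈κ * e * 2⌉₊ : ℝ) ^ 3 * b / ε
      ≤ 5 * Λ * (16 * κ * Λ) ^ 3 * (2 * √(min (G.degree s) (G.degree t) : ℕ)) / ε := by
        have h1 : (0 : ℝ) ≤ 5 * Λ * (16 * κ * Λ) ^ 3 := by positivity
        have h2 : (1 + l : ℝ) ≤ 5 * Λ := by linarith
        gcongr
    _ = _ := by ring

theorem sure_powProg {n : ℕ} {G : SimpleGraph (Fin n)} [DecidableRel G.Adj] {N : AdjLists G}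
    (A m : ℕ) {σ : Store} :
    Sure G N (block (.rconst 1 A :: List.replicate m (.rmul 1 1 8))) (2 * m + 3) σ
      fun σ' => Agree [] [1] σ σ' ∧ σ'.rreg 1 = A * σ.rreg 8 ^ m := by
  have hfold : ∀ (m : ℕ) (σ : Store),
      let σ' := (List.replicate m (Instr.rmul 1 1 8)).foldl (effect G N) σ
      Agree [] [1] σ σ' ∧ σ'.rreg 1 = σ.rreg 1 * σ.rreg 8 ^ m := fun m => by
    induction m with
    | zero => simp [Agree]
    | succ m ih =>
      intro σ
      obtain ⟨h1, h2⟩ := ih (effect G N σ (.rmul 1 1 8))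
      refine ⟨⟨h1.1, fun x hx => (h1.2.1 x hx).trans ?_, h1.2.2⟩, h2.trans ?_⟩
      · simp_all [effect, Store.setR]
      · simp [effect, Store.setR]
        ring
  refine Sure.mono (sure_block (by simp [isDet]) ?_) (by simp; omega) fun _ h => h
  obtain ⟨h1, h2⟩ := hfold m (effect G N σ (.rconst 1 A))
  refine ⟨⟨h1.1, fun x hx => (h1.2.1 x hx).trans ?_, h1.2.2⟩, h2.trans ?_⟩
  · simp_all [effect, Store.setR]
  · simp [effect, Store.setR]

open Classical in
theorem approximatesEffRes_of_triple_indicator {n : ℕ} {G : SimpleGraph (Fin n)} [DecidableRel G.Adj]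
    {N : AdjLists G} (hn : 2 ≤ n) {P : Program} {σ : Store} {s t : Fin n} {ε T : ℝ} {τ c : ℕ}
    (hτ : (τ : ℝ) ≤ T) (h : Triple G N P τ σ (fun _ => True)
      (fun σ' => if ApproxEq ε (σ'.rreg 0) (effRes G s t) then 0 else 1) (1 / n ^ c)) :
    ApproximatesEffRes G N P σ s t ε T (1 - 1 / (n : ℝ) ^ c) := by
  have hn1 : (1 : ℝ) ≤ n ^ c := one_le_pow₀ (by exact_mod_cast (by omega : 1 ≤ n))
  refine approximatesEffRes_of_triple G N hτ h (fun σ' _ h' => by rw [if_neg h']) ?_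
    (by positivity) ?_
  · linarith
  · rw [sub_nonneg]
    exact div_le_one_of_le₀ hn1 (by positivity)

theorem general_graphs (c : ℕ) : ∃ (P : Program) (C : ℝ) (a : ℕ),
    ∀ (n : ℕ) (G : SimpleGraph (Fin n)) [DecidableRel G.Adj] (N : AdjLists G)
      (s t : Fin n) (ε κ : ℝ),
      2 ≤ n → G.Connected → condNumber (normLap G) ≤ κ → 0 < ε → ε < 1 →
      ApproximatesEffRes G N P (input s t ε κ) s t ε
        (C * Real.log (n / ε) ^ a * (κ ^ 3 * √(min (G.degree s) (G.degree t) : ℕ) / ε))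
        (1 - 1 / (n : ℝ) ^ c) := by
  obtain ⟨a, ha⟩ : ∃ a : ℕ, (a : ℝ) = 256 * (c + 1) := ⟨256 * (c + 1), by push_cast; ring⟩
  refine ⟨mainProg a, (800 + 64 * a) * 40960, 4, fun n G _ N s t ε κ hn hG hκ hε hε1 => ?_⟩
  have : Nontrivial (Fin n) := Fin.nontrivial_iff_two_le.2 hn
  have : Nonempty (Fin n) := ⟨s⟩
  have hd : ∀ v, 0 < G.degree v := fun v => hG.preconnected.degree_pos_of_nontrivial v
  have hκ' := one_le_mul_eigval_of_condNumber_le hd hκ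
  obtain ⟨l, hl0, hl1, hl, -⟩ := exists_log_ceil hn
  obtain ⟨τ, hτ, h⟩ := exists_triple_mainProg (N := N) hn hG hd
    (half_le_of_forall_eigval hd hκ') hκ' s t hε hε1 ha hl0 hl1 hl
  refine approximatesEffRes_of_triple_indicator hn (hτ.trans (le_of_eq ?_)) (h (input s t ε κ)
    (by simp [input]) (by simp [input]) (by simp [input]) (by simp [input]) (by simp [input]) rfl rfl)
  ring

theorem expanders (c : ℕ) (φ₀ : ℝ) (k : ℕ) (hφ₀ : 0 < φ₀) :
    ∃ (P : Program) (C : ℝ) (a : ℕ),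
      ∀ (n : ℕ) (G : SimpleGraph (Fin n)) [DecidableRel G.Adj] (N : AdjLists G)
        (s t : Fin n) (ε : ℝ),
        2 ≤ n → φ₀ / Real.log n ^ k ≤ conductance G → 0 < ε → ε < 1 →
        ApproximatesEffRes G N P (input s t ε 0) s t ε
          (C * Real.log (n / ε) ^ a * (√(min (G.degree s) (G.degree t) : ℕ) / ε))
          (1 - 1 / (n : ℝ) ^ c) := by
  obtain ⟨a, ha⟩ : ∃ a : ℕ, (a : ℝ) = 256 * (c + 1) := ⟨256 * (c + 1), by push_cast; ring⟩
  obtain ⟨A, hA⟩ := exists_nat_ge (max 1 (2 / φ₀ ^ 2))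
  have hA1 : (1 : ℝ) ≤ A := (le_max_left _ _).trans hA
  have hA2 : 2 ≤ A * φ₀ ^ 2 := by
    rw [← div_le_iff₀ (by positivity)]
    exact (le_max_right _ _).trans hA
  refine ⟨.seq logProg (.seq (block (.rconst 1 A :: List.replicate (2 * k) (.rmul 1 1 8)))
    (mainProg a)), (800 + 64 * a) * 40960 * (A ^ 3 * 5 ^ (6 * k)) + (60 + 4 * k) * 2 ^ (4 + 6 * k),
    4 + 6 * k, fun n G _ N s t ε hn hφ hε hε1 => ?_⟩
  have : Nontrivial (Fin n) := Fin.nontrivial_iff_two_le.2 hn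
  have : Nonempty (Fin n) := ⟨s⟩
  have hn0 : (0 : ℝ) < n := by exact_mod_cast (by omega : 0 < n)
  have hlog2 : Real.log 2 ≤ Real.log n := Real.log_le_log two_pos (by exact_mod_cast hn)
  have h69 := Real.log_two_gt_d9
  have hlog : 0 < Real.log n := by linarith
  have hG : G.Connected := connected_of_conductance_pos (lt_of_lt_of_le (by positivity) hφ)
  have hd : ∀ v, 0 < G.degree v := fun v => hG.preconnected.degree_pos_of_nontrivial v
  obtain ⟨l, hl0, hl1, hl, hl2⟩ := exists_log_ceil hn
  set κ : ℝ := A * (1 + l) ^ (2 * k) with hκdef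
  have hl3 : (1 : ℝ) ≤ 1 + l := le_add_of_nonneg_right (Nat.cast_nonneg l)
  have hκ : ∀ i, eigval (G := G) i = 0 ∨ 1 ≤ κ * eigval (G := G) i := fun i => by
    rcases eq_or_ne (eigval (G := G) i) 0 with h0 | h0
    · exact Or.inl h0
    · right
      have h1 : φ₀ / (1 + l) ^ k ≤ conductance G := hφ.trans' (by gcongr)
      have h2 := conductance_sq_le_two_mul_eigval hd h0 (h1.trans' (by positivity))
      have h3 : (φ₀ / (1 + l) ^ k) ^ 2 ≤ 2 * eigval (G := G) i :=
        h2.trans' (pow_le_pow_left₀ (by positivity) h1 2)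
      rw [div_pow, div_le_iff₀ (by positivity), ← pow_mul, mul_comm k] at h3
      rw [hκdef]
      nlinarith
  have hκ1 : 1 ≤ κ := one_le_mul_of_one_le_of_one_le hA1 (one_le_pow₀ hl3)
  have hΛ : Real.log n ≤ Real.log (n / ε) :=
    Real.log_le_log hn0 (by rw [le_div_iff₀ hε]; nlinarith)
  have hsqrt : 1 ≤ √(min (G.degree s) (G.degree t) : ℕ) / ε := by
    rw [one_le_div hε]
    refine hε1.le.trans ?_
    rw [Real.one_le_sqrt]
    exact_mod_cast lt_min (hd s) (hd t)
  obtain ⟨τ, hτ, h⟩ := exists_triple_mainProg (N := N) hn hG hd (by linarith) hκ s t hε hε1 ha hl0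
    hl1 hl
  refine approximatesEffRes_of_triple_indicator (τ := 6 * l + 20 + (2 * (2 * k) + 3 + τ + 1) + 1) hn ?_
    ((sure_logProg (σ := input s t ε 0) (by simpa [input] using hl0)
      (by simpa [input] using hl1)).seq_triple fun σ₁ h₁ => (sure_powProg A (2 * k)).seq_triple
        fun σ₂ h₂ => ?_)
  · set Λ := Real.log (n / ε)
    set E := √(min (G.degree s) (G.degree t) : ℕ) / ε
    have hΛ1 : 1 ≤ 2 * Λ := by linarith
    have hΛ0 : 0 ≤ Λ := by linarith
    have hE0 : 0 ≤ E := by linarith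
    have h1 : (τ : ℝ) ≤ (800 + 64 * a) * 40960 * (A ^ 3 * 5 ^ (6 * k)) * Λ ^ (4 + 6 * k) * E := by
      have hκ3 : κ ^ 3 ≤ A ^ 3 * 5 ^ (6 * k) * Λ ^ (6 * k) := by
        have : (1 + l : ℝ) ^ (6 * k) ≤ (5 * Λ) ^ (6 * k) := by
          gcongr
          linarith
        calc κ ^ 3 = A ^ 3 * (1 + l : ℝ) ^ (6 * k) := by
              rw [hκdef, mul_pow, ← pow_mul]
              ring
          _ ≤ A ^ 3 * (5 * Λ) ^ (6 * k) := by gcongr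
          _ = _ := by rw [mul_pow, mul_assoc]
      calc (τ : ℝ) ≤ (800 + 64 * a) * 40960 * (Λ ^ 4 * (κ ^ 3 * E)) := hτ
        _ ≤ (800 + 64 * a) * 40960 * (Λ ^ 4 * (A ^ 3 * 5 ^ (6 * k) * Λ ^ (6 * k) * E)) := by gcongr
        _ = _ := by
          rw [pow_add]
          ring
    have h2 : (6 * l + 4 * k + 25 : ℝ) ≤ (60 + 4 * k) * 2 ^ (4 + 6 * k) * Λ ^ (4 + 6 * k) * E := by
      have hk0 : (0 : ℝ) ≤ k := Nat.cast_nonneg k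
      have h3 : 2 * Λ ≤ (2 * Λ) ^ (4 + 6 * k) := le_self_pow₀ hΛ1 (by omega)
      calc (6 * l + 4 * k + 25 : ℝ) ≤ (60 + 4 * k) * (2 * Λ) := by nlinarith
        _ ≤ (60 + 4 * k) * (2 * Λ) ^ (4 + 6 * k) := by gcongr
        _ ≤ (60 + 4 * k) * (2 * Λ) ^ (4 + 6 * k) * E :=
          le_mul_of_one_le_right (by positivity) hsqrt
        _ = _ := by simp only [mul_pow, mul_assoc]
    push_cast
    linarith
  · have hA : Agree [9] [3, 8, 1] (input s t ε 0) σ₂ := h₁.1.trans h₂.1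
    exact h σ₂ ((hA.ireg 0 (by decide)).trans (by simp [input]))
      ((hA.ireg 1 (by decide)).trans (by simp [input]))
      ((hA.ireg 2 (by decide)).trans (by simp [input]))
      ((hA.rreg 0 (by decide)).trans (by simp [input])) (h₂.2.trans (by rw [h₁.2])) hA.2.2.1 hA.2.2.2

end EffectiveResistance

end

open EffectiveResistance in
theorem theorem1 (c : ℕ) :
    -- expanders: conductance at least `φ₀ / (log n) ^ k`
    (∀ (φ₀ : ℝ) (k : ℕ), 0 < φ₀ →
      ∃ (P : Program) (C : ℝ) (a : ℕ),
        ∀ (n : ℕ) (G : SimpleGraph (Fin n)) [DecidableRel G.Adj] (N : AdjLists G)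
          (s t : Fin n) (ε : ℝ),
          2 ≤ n → φ₀ / Real.log n ^ k ≤ conductance G → 0 < ε → ε < 1 →
          ApproximatesEffRes G N P (input s t ε 0) s t ε
            (C * Real.log (n / ε) ^ a * (√(min (G.degree s) (G.degree t) : ℕ) / ε))
            (1 - 1 / (n : ℝ) ^ c)) ∧
    -- connected graphs, with an upper bound `κ` on the condition number as part of the input
    (∃ (P : Program) (C : ℝ) (a : ℕ),
      ∀ (n : ℕ) (G : SimpleGraph (Fin n)) [DecidableRel G.Adj] (N : AdjLists G)
        (s t : Fin n) (ε κ : ℝ),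
        2 ≤ n → G.Connected → condNumber (normLap G) ≤ κ → 0 < ε → ε < 1 →
        ApproximatesEffRes G N P (input s t ε κ) s t ε
          (C * Real.log (n / ε) ^ a * (κ ^ 3 * √(min (G.degree s) (G.degree t) : ℕ) / ε))
          (1 - 1 / (n : ℝ) ^ c)) := by
  exact ⟨fun φ₀ k hφ₀ => expanders c φ₀ k hφ₀, general_graphs c⟩
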